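/- **Setting and notation.** Let $T>0$ and let $(\Omega,\mathcal F,(\mathcal F_t)_{t\in[0,T]},\mathbb P)$ be a filtered probability space (the usual conditions are not assumed). All processes take values in finite-dimensional real normed spaces. Write $\delta A_{s,t}=A_t-A_s$, $\mathbb E_s[\,\cdot\,]=\mathbb E[\,\cdot\mid\mathcal F_s]$, and let $|\mathcal P|$ be the mesh size of a finite partition $\mathcal P$; $[u,v]\in\mathcal P$ means that $u<v$ are consecutive points of $\mathcal P$. All suprema over $\mathcal P$ below are over the partitions of $[0,T]$. For $p\ge 1$, $V^p$ is the space of càdlàg paths $A$ on $[0,T]$ with finite $p$-variation $\big(\sup_{\mathcal P}\sum_{[u,v]\in\mathcal P}|\delta A_{u,v}|^p\big)^{1/p}$. For a random variable $Y$, $q\in[1,\infty)$ and $r\in[1,\infty]$ let $\|Y\|_{q,r,s}=\big\|\mathbb E_s[|Y|^q]\big\|_{L^r}^{1/q}$. The space $V^pL^{q}$ (resp. $V^pL^{q,r}$) consists of the processes $Y$ that are right-continuous in probability, with $Y_0\in L^q$ and $\sup_{\mathcal P}\sum_{[u,v]\in\mathcal P}\|\delta Y_{u,v}\|_{L^q}^p<\infty$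 (resp. $\sup_{\mathcal P}\sum_{[u,v]\in\mathcal P}\|\delta Y_{u,v}\|_{q,r,u}^p<\infty$). Let $p\in[2,3)$. A càdlàg rough path $\mathbf X=(X,\mathbb X)$ is a path $X\in V^p$ with values in $\mathbb R^d$ together with a càdlàg function $\mathbb X\colon\{0\le s\le t\le T\}\to\mathbb R^{d\times d}\cong\mathbb R^d\otimes\mathbb R^d$ such that $\sup_{\mathcal P}\sum_{[u,v]\in\mathcal P}|\mathbb X_{u,v}|^{p/2}<\infty$ and $\mathbb X_{s,t}=\mathbb X_{s,u}+\mathbb X_{u,t}+\delta X_{s,u}\otimes\delta X_{u,t}$ for all $s\le u\le t$. Let $\mathrm{Sym}(\mathbb X)$ be the symmetric part of $\mathbb X$. The bracket of $\mathbf X$ is the path $[\mathbf X]$ with $[\mathbf X]_0=0$ and $\delta[\mathbf X]_{s,t}=\delta X_{s,t}\otimes\delta X_{s,t}-2\,\mathrm{Sym}(\mathbb X_{s,t})$. For $q\in[2,\infty)$ and $r\in[1,\infty]$, a stochastic controlled path $(Y,Y')\in\mathcal V^{p,q,r}_X$ is a pair of adapted processes, $Y$ with values in $E$ and $Y'$ with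 values in $\mathcal L(\mathbb R^d;E)$, such that $Y,Y'\in V^pL^{q,r}$, $\sup_{s\in[0,T]}\|Y'_s\|_{L^{qr}}<\infty$, and the remainder $R^Y_{s,t}=\delta Y_{s,t}-Y'_s\,\delta X_{s,t}$ satisfies $\sup_{\mathcal P}\sum_{[u,v]\in\mathcal P}\big\|\mathbb E_u[R^Y_{u,v}]\big\|_{L^{qr}}^{p/2}<\infty$. **Lemma.** Let $p\in[2,3)$, $q\in[4,\infty)$, $r\in[1,\infty]$, and let $\mathbf X=(X,\mathbb X)$ be a càdlàg rough path. 1. Let $(Y,Y'),(Z,Z')\in\mathcal V^{p,q,r}_X$ be stochastic controlled paths. Then there exists an adapted process $[Y,Z]\in V^{p/2}L^{q/2}$ such that, for each $t\in[0,T]$, $$[Y,Z]_t=\lim_{|\mathcal P|\to0}\ \sum_{[u,v]\in\mathcal P}\Big(\delta Y_{u,v}\otimes\delta Z_{u,v}-2\,(Y'_u\otimes Z'_u)\,\mathrm{Sym}(\mathbb X_{u,v})\Big)$$ as a limit in $L^{q/2}$, along partitions $\mathcal P$ of $[0,t]$ as the mesh size tends to zero. 2. If $M,N\in V^pL^{q,r}$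 are martingales, then $(M,0),(N,0)\in\mathcal V^{p,q,r}_X$, and $[M,N]$ is the quadratic covariation of $M$ and $N$; that is, for each $t\in[0,T]$, $[M,N]_t$ is the limit in probability of $\sum_{[u,v]\in\mathcal P}\delta M_{u,v}\otimes\delta N_{u,v}$ along partitions $\mathcal P$ of $[0,t]$ as $|\mathcal P|\to0$. 3. The pair $(X,1)$, where $1$ is the identity of $\mathbb R^d$, belongs to $\mathcal V^{p,q,r}_X$, the bracket $[\mathbf X]$ exists and lies in $V^{p/2}$, and the process $[X,X]$ of part 1 for the pair $(X,1)$ satisfies $[X,X]_t=[\mathbf X]_t$ almost surely for each $t\in[0,T]$. -/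

import Mathlib

open MeasureTheory ProbabilityTheory Set Filter Topology
open scoped ENNReal NNReal TensorProduct

noncomputable section

namespace RoughStoch

/-! Processes and paths on `[0, T]` are functions on `ℝ` of which only the values at times in
`[0, T]` are ever used; a filtration on `[0, T]` is a filtration on `ℝ` of which only the
`σ`-algebras at times in `[0, T]` are ever used. -/

section Partitions

/-- A partition `s = t₀ < t₁ < ⋯ < tₙ = t` of `[s, t]` (for `s = t` this forces `n = 0`);
the values of `pts` beyond the index `n` are irrelevant. -/
structure Partition (s t : ℝ) where
  n : ℕ
  pts : ℕ → ℝ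
  pts_zero : pts 0 = s
  pts_last : pts n = t
  pts_lt : ∀ i < n, pts i < pts (i + 1)

namespace Partition

variable {s t : ℝ}

/-- The sum of `Ξ u v` over the consecutive points `u, v` of the partition. -/
def sum {M : Type*} [AddCommMonoid M] (P : Partition s t) (Ξ : ℝ → ℝ → M) : M :=
  ∑ i ∈ Finset.range P.n, Ξ (P.pts i) (P.pts (i + 1))

/-- The mesh size, the maximum of the lengths of the intervals of the partition. -/
def mesh (P : Partition s t) : ℝ≥0 :=
  (Finset.range P.n).sup fun i => Real.toNNReal (P.pts (i + 1) - P.pts i)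

end Partition

/-- The filter of partitions of `[s, t]` whose mesh size tends to zero. -/
def meshFilter (s t : ℝ) : Filter (Partition s t) :=
  comap Partition.mesh (𝓝 0)

/-- The `p`-variation `(sup_P ∑_{[u,v] ∈ P} ρ(u,v)^p)^{1/p}` over `[s, t]` of a two-parameter
function, where `ρ u v` is the size of its value at `(u, v)`. -/
def pVarOf (ρ : ℝ → ℝ → ℝ≥0∞) (p s t : ℝ) : ℝ≥0∞ :=
  (⨆ P : Partition s t, P.sum fun u v => ρ u v ^ p) ^ (1 / p)

end Partitions

section Paths

variable {E : Type*} [NormedAddCommGroup E]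

/-- `f` is càdlàg on `[a, b]`. -/
def IsCadlagOn (f : ℝ → E) (a b : ℝ) : Prop :=
  (∀ t ∈ Ico a b, Tendsto f (𝓝[>] t) (𝓝 (f t))) ∧
    ∀ t ∈ Ioc a b, ∃ l, Tendsto f (𝓝[<] t) (𝓝 l)

/-- The `p`-variation of a deterministic two-parameter function. -/
def pVar (F : ℝ → ℝ → E) (p s t : ℝ) : ℝ≥0∞ :=
  pVarOf (fun u v => ‖F u v‖ₑ) p s t

/-- The space `V^p([0,T]; E)` of càdlàg paths of finite `p`-variation. -/
def MemV (p T : ℝ) (A : ℝ → E) : Prop :=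
  IsCadlagOn A 0 T ∧ pVar (fun u v => A v - A u) p 0 T < ∞

end Paths

section RoughPaths

/-- A càdlàg `p`-rough path `(X, 𝕏)` over `ℝ^d` on `[0, T]`. The space `ℝ^{d × d}` carries the
Euclidean (Frobenius) norm. -/
structure RoughPath (p T : ℝ) (d : ℕ) where
  X : ℝ → EuclideanSpace ℝ (Fin d)
  XX : ℝ → ℝ → EuclideanSpace ℝ (Fin d × Fin d)
  memV : MemV p T X
  cadlag_right : ∀ s ∈ Icc 0 T, IsCadlagOn (fun t => XX s t) s T
  cadlag_left : ∀ t ∈ Icc 0 T, IsCadlagOn (fun s => XX s t) 0 t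
  pVar_lt_top : pVar XX (p / 2) 0 T < ∞
  chen : ∀ s u t, 0 ≤ s → s ≤ u → u ≤ t → t ≤ T → ∀ i j,
    XX s t (i, j) = XX s u (i, j) + XX u t (i, j) + (X u i - X s i) * (X t j - X u j)

variable {d : ℕ}

/-- The symmetric part of a `d × d` matrix. -/
def symPart (A : EuclideanSpace ℝ (Fin d × Fin d)) : EuclideanSpace ℝ (Fin d × Fin d) :=
  WithLp.toLp 2 fun ij => (A (ij.1, ij.2) + A (ij.2, ij.1)) / 2

/-- The identification of `ℝ^{d × d}` with `ℝ^d ⊗ ℝ^d`. -/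
def toTensor (A : EuclideanSpace ℝ (Fin d × Fin d)) :
    EuclideanSpace ℝ (Fin d) ⊗[ℝ] EuclideanSpace ℝ (Fin d) :=
  ∑ i, ∑ j, A (i, j) • (EuclideanSpace.single i (1 : ℝ) ⊗ₜ[ℝ] EuclideanSpace.single j (1 : ℝ))

/-- `b` is the bracket of the rough path `𝒳`: the path in `V^{p/2}` started at zero with
increments `δX ⊗ δX - 2 Sym(𝕏)`. Here `H` is the tensor product `ℝ^d ⊗ ℝ^d` (via `σ`),
with any choice of a norm. -/
structure IsRoughBracket {p T : ℝ} (𝒳 : RoughPath p T d)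
    {H : Type*} [NormedAddCommGroup H] [NormedSpace ℝ H]
    (σ : EuclideanSpace ℝ (Fin d) ⊗[ℝ] EuclideanSpace ℝ (Fin d) ≃ₗ[ℝ] H)
    (b : ℝ → H) : Prop where
  zero : b 0 = 0
  increment : ∀ s t, 0 ≤ s → s ≤ t → t ≤ T →
    b t - b s = σ ((𝒳.X t - 𝒳.X s) ⊗ₜ[ℝ] (𝒳.X t - 𝒳.X s)
      - (2 : ℝ) • toTensor (symPart (𝒳.XX s t)))
  memV : MemV (p / 2) T b

end RoughPaths

section Processes

variable {Ω : Type*} [mΩ : MeasurableSpace Ω]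
variable {E : Type*} [NormedAddCommGroup E]

/-- `‖Y‖_{q,r,s} = ‖𝔼_s[|Y|^q]‖_{L^r}^{1/q}`; the conditional expectation is that of
`[0, ∞]`-valued random variables, so no integrability is presupposed. -/
def condNorm (μ : Measure Ω) (ℱ : Filtration ℝ mΩ) (q : ℝ) (r : ℝ≥0∞) (s : ℝ) (Y : Ω → E) :
    ℝ≥0∞ :=
  eLpNorm (condLExp (ℱ s) μ fun ω => ‖Y ω‖ₑ ^ q) r μ ^ (1 / q)

/-- `‖F‖_{p,q,[s,t]}`, the `p`-variation of a two-parameter process with respect to the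
`L^q` norm, for `q ∈ [1, ∞]`. -/
def pqVar (μ : Measure Ω) (F : ℝ → ℝ → Ω → E) (p : ℝ) (q : ℝ≥0∞) (s t : ℝ) : ℝ≥0∞ :=
  pVarOf (fun u v => eLpNorm (F u v) q μ) p s t

/-- `‖F‖_{p,q,r,[s,t]}`, the `p`-variation of a two-parameter process with respect to the
norms `‖·‖_{q,r,u}`, with `u` the left end point of the interval. -/
def pqrVar (μ : Measure Ω) (ℱ : Filtration ℝ mΩ) (F : ℝ → ℝ → Ω → E) (p q : ℝ) (r : ℝ≥0∞)
    (s t : ℝ) : ℝ≥0∞ :=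
  pVarOf (fun u v => condNorm μ ℱ q r u (F u v)) p s t

/-- `Y` is adapted on `[0, T]`. -/
def IsAdaptedOn (ℱ : Filtration ℝ mΩ) (T : ℝ) (Y : ℝ → Ω → E) : Prop :=
  ∀ t ∈ Icc 0 T, StronglyMeasurable[ℱ t] (Y t)

/-- `Y` is right-continuous in probability on `[0, T]`. -/
def RightContInProb (μ : Measure Ω) (T : ℝ) (Y : ℝ → Ω → E) : Prop :=
  ∀ s ∈ Ico 0 T, TendstoInMeasure μ Y (𝓝[>] s) (Y s)

/-- The space `V^p L^q` of processes. -/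
structure MemVL (μ : Measure Ω) (T p q : ℝ) (Y : ℝ → Ω → E) : Prop where
  meas : ∀ t ∈ Icc 0 T, StronglyMeasurable (Y t)
  rightCont : RightContInProb μ T Y
  init : MemLp (Y 0) (ENNReal.ofReal q) μ
  pVar_lt_top : pqVar μ (fun u v => Y v - Y u) p (ENNReal.ofReal q) 0 T < ∞

/-- The space `V^p L^{q,r}` of processes. -/
structure MemVLr (μ : Measure Ω) (ℱ : Filtration ℝ mΩ) (T p q : ℝ) (r : ℝ≥0∞)
    (Y : ℝ → Ω → E) : Prop where
  meas : ∀ t ∈ Icc 0 T, StronglyMeasurable (Y t)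
  rightCont : RightContInProb μ T Y
  init : MemLp (Y 0) (ENNReal.ofReal q) μ
  pVar_lt_top : pqrVar μ ℱ (fun u v => Y v - Y u) p q r 0 T < ∞

variable [NormedSpace ℝ E]

/-- `M` is a martingale on `[0, T]`. -/
structure IsMartingaleOn [CompleteSpace E] (μ : Measure Ω) (ℱ : Filtration ℝ mΩ) (T : ℝ)
    (M : ℝ → Ω → E) : Prop where
  adapted : IsAdaptedOn ℱ T M
  integrable : ∀ t ∈ Icc 0 T, Integrable (M t) μ
  condExp_eq : ∀ s t, 0 ≤ s → s ≤ t → t ≤ T → μ[M t | ℱ s] =ᵐ[μ] M s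

/-- The remainder `R^Y_{s,t} = δY_{s,t} - Y'_s δX_{s,t}`. -/
def remainder {d : ℕ} (X : ℝ → EuclideanSpace ℝ (Fin d)) (Y : ℝ → Ω → E)
    (Y' : ℝ → Ω → EuclideanSpace ℝ (Fin d) →L[ℝ] E) (s t : ℝ) : Ω → E :=
  fun ω => Y t ω - Y s ω - Y' s ω (X t - X s)

/-- `(Y, Y')` is a stochastic controlled path relative to `X`, that is, an element of
`𝒱^{p,q,r}_X`. -/
structure IsControlled [CompleteSpace E] {d : ℕ} (μ : Measure Ω) (ℱ : Filtration ℝ mΩ)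
    (T p q : ℝ) (r : ℝ≥0∞) (X : ℝ → EuclideanSpace ℝ (Fin d)) (Y : ℝ → Ω → E)
    (Y' : ℝ → Ω → EuclideanSpace ℝ (Fin d) →L[ℝ] E) : Prop where
  adapted : IsAdaptedOn ℱ T Y
  adapted' : IsAdaptedOn ℱ T Y'
  memVLr : MemVLr μ ℱ T p q r Y
  memVLr' : MemVLr μ ℱ T p q r Y'
  sup_lt_top : (⨆ s ∈ Icc 0 T, eLpNorm (Y' s) (ENNReal.ofReal q * r) μ) < ∞
  remainder_lt_top :
    pqVar μ (fun s t => μ[remainder X Y Y' s t | ℱ s]) (p / 2) (ENNReal.ofReal q * r) 0 T < ∞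

end Processes

section Brackets

variable {Ω : Type*} [mΩ : MeasurableSpace Ω]
variable {E F G : Type*} [NormedAddCommGroup E] [NormedSpace ℝ E]
  [NormedAddCommGroup F] [NormedSpace ℝ F] [NormedAddCommGroup G] [NormedSpace ℝ G]

/-- The summand `δY_{u,v} ⊗ δZ_{u,v} - 2 (Y'_u ⊗ Z'_u) Sym(𝕏_{u,v})`. Here `G` is the tensor
product `E ⊗ F` (via `τ`), with any choice of a norm, and `Y'_u ⊗ Z'_u` is the tensor product of
the two linear maps. -/
def bracketGerm {p T : ℝ} {d : ℕ} (𝒳 : RoughPath p T d) (τ : E ⊗[ℝ] F ≃ₗ[ℝ] G)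
    (Y : ℝ → Ω → E) (Y' : ℝ → Ω → EuclideanSpace ℝ (Fin d) →L[ℝ] E)
    (Z : ℝ → Ω → F) (Z' : ℝ → Ω → EuclideanSpace ℝ (Fin d) →L[ℝ] F) (u v : ℝ) : Ω → G :=
  fun ω => τ ((Y v ω - Y u ω) ⊗ₜ[ℝ] (Z v ω - Z u ω)
    - (2 : ℝ) • TensorProduct.map (Y' u ω).toLinearMap (Z' u ω).toLinearMap
        (toTensor (symPart (𝒳.XX u v))))

/-- `B` is a bracket process `[Y, Z]` of the stochastic controlled paths `(Y, Y')` and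
`(Z, Z')`. -/
structure IsBracket {p T : ℝ} {d : ℕ} (μ : Measure Ω) (ℱ : Filtration ℝ mΩ) (q : ℝ)
    (𝒳 : RoughPath p T d) (τ : E ⊗[ℝ] F ≃ₗ[ℝ] G)
    (Y : ℝ → Ω → E) (Y' : ℝ → Ω → EuclideanSpace ℝ (Fin d) →L[ℝ] E)
    (Z : ℝ → Ω → F) (Z' : ℝ → Ω → EuclideanSpace ℝ (Fin d) →L[ℝ] F)
    (B : ℝ → Ω → G) : Prop where
  adapted : IsAdaptedOn ℱ T B
  memVL : MemVL μ T (p / 2) (q / 2) B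
  tendsto : ∀ t ∈ Icc 0 T,
    Tendsto (fun P : Partition 0 t =>
        eLpNorm (P.sum (bracketGerm 𝒳 τ Y Y' Z Z') - B t) (ENNReal.ofReal (q / 2)) μ)
      (meshFilter 0 t) (𝓝 0)

/-- `B` is the quadratic covariation of `M` and `N` on `[0, T]`: at each time `t`, the limit in
probability of the sums `∑ δM ⊗ δN` along partitions of `[0, t]` of vanishing mesh size. -/
def IsQuadCovariation (μ : Measure Ω) (T : ℝ) (τ : E ⊗[ℝ] F ≃ₗ[ℝ] G)
    (M : ℝ → Ω → E) (N : ℝ → Ω → F) (B : ℝ → Ω → G) : Prop :=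
  ∀ t ∈ Icc 0 T,
    TendstoInMeasure μ
      (fun (P : Partition 0 t) =>
        P.sum fun u v ω => τ ((M v ω - M u ω) ⊗ₜ[ℝ] (N v ω - N u ω)))
      (meshFilter 0 t) (B t)

end Brackets

end RoughStoch

end

open RoughStoch

/-!
For the germ `ξ_{s,t} = δY_{s,t} ⊗ δZ_{s,t} - 2 (Y'_s ⊗ Z'_s) Sym(𝕏_{s,t})`, Chen's relation
turns the defect of additivity `δξ_{s,u,t} = ξ_{s,t} - ξ_{s,u} - ξ_{u,t}` into the two cross terms
`δY_{s,u} ⊗ δZ_{u,t} - Y'_s δX_{s,u} ⊗ Z'_s δX_{u,t}` (and the same with `Y` and `Z` exchanged) plus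
a term carrying `𝕏_{u,t}` (`delta_scalarGerm`). If one control `w` governs all the variations
involved and `e = 1 / p`, then `δξ_{s,u,t}` is of size `w(s,u)^e w(u,t)^e` in `L^{q/2}`. Under `𝔼_s`
it is of third order, of size `w(s,u)^e w(u,t)^{2e} + w(s,u)^{2e} w(u,t)^e`, since the increments of
`Y` and `Z` agree with `Y' δX` and `Z' δX` up to remainders whose conditional expectations are of
second order (`isSewable_scalarGerm`). As `2e > 1/2` and `3e > 1`, this is the situation of the
stochastic sewing lemma.

The sewing lemma is proved here for germs with jumps (`IsSewable.exists_process`). Splitting an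
interval of a partition at the point where the control is halved, again and again, writes the
difference of the sums over a partition and a refinement as a sum over scales. At each scale the
conditional means are estimated by the triangle inequality and the martingale parts by the
orthogonality of martingale increments in `L^m`, `m ≥ 2` (`exists_eLpNorm_add_sq_le`); both
estimates decay geometrically (`exists_refinement_bound`). For the limit along vanishing mesh size,
`w` is chosen right-continuous on the diagonal; this is possible as all the data are
right-continuous. Then `w` is small on intervals avoiding a suitable finite set of times
(`IsRightControl.exists_finset`), so that refinements of a partition containing that set change
little. Inserting one of these times `u` into an interval `[a, b]` of small length costs
`δξ_{a,u,b}`, which is small because of the factor `w(u,b)^e` and right-continuity, whatever the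
jump at `u` (`IsSewable.exists_insert_bound`). The vector-valued bracket is obtained from the scalar
ones by bases of `E` and `F` (`exists_isBracket`).

For martingales the remainder of `(M, 0)` is the increment of `M`, which vanishes under `𝔼_s`, and
convergence in `L^{q/2}` implies convergence in probability. For `(X, 1)` the remainder vanishes and
the germ is `δX ⊗ δX - 2 Sym(𝕏)`, which is additive by Chen's relation; hence the sums telescope to
the bracket of the rough path.
-/

noncomputable section

namespace RoughStoch

/-! ### Partitions -/

namespace Partition

variable {s t u : ℝ}

lemma pts_lt_pts (P : Partition s t) {i j : ℕ} (hij : i < j) (hj : j ≤ P.n) :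
    P.pts i < P.pts j := by
  induction j, hij using Nat.le_induction with
  | base => exact P.pts_lt i (by omega)
  | succ k hk ih => exact (ih (by omega)).trans (P.pts_lt k (by omega))

lemma pts_le_pts (P : Partition s t) {i j : ℕ} (hij : i ≤ j) (hj : j ≤ P.n) :
    P.pts i ≤ P.pts j := by
  rcases hij.eq_or_lt with rfl | h
  · exact le_rfl
  · exact (P.pts_lt_pts h hj).le

lemma le_pts (P : Partition s t) {i : ℕ} (hi : i ≤ P.n) : s ≤ P.pts i :=
  P.pts_zero.symm.trans_le (P.pts_le_pts (Nat.zero_le i) hi)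

lemma pts_le (P : Partition s t) {i : ℕ} (hi : i ≤ P.n) : P.pts i ≤ t := by
  have := P.pts_le_pts hi le_rfl
  rwa [P.pts_last] at this

lemma left_le_right (P : Partition s t) : s ≤ t :=
  (P.le_pts (Nat.zero_le _)).trans (P.pts_le (Nat.zero_le _))

lemma le_of_pts_le (P : Partition s t) {i j : ℕ} (hi : i ≤ P.n) (h : P.pts i ≤ P.pts j) :
    i ≤ j := by
  by_contra! hji
  exact absurd (P.pts_lt_pts hji hi) (not_lt.2 h)

lemma lt_of_pts_lt (P : Partition s t) {i j : ℕ} (hi : i ≤ P.n) (h : P.pts i < P.pts j) :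
    i < j := by
  refine lt_of_le_of_ne (P.le_of_pts_le hi h.le) ?_
  rintro rfl
  exact lt_irrefl _ h

lemma mesh_le_iff (P : Partition s t) {δ : ℝ≥0} :
    P.mesh ≤ δ ↔ ∀ i < P.n, P.pts (i + 1) - P.pts i ≤ δ := by
  simp [mesh, Finset.sup_le_iff, Real.toNNReal_le_iff_le_coe]

/-- The finite set of points of a partition. -/
def points (P : Partition s t) : Finset ℝ := (Finset.range (P.n + 1)).image P.pts

lemma mem_points (P : Partition s t) {x : ℝ} : x ∈ P.points ↔ ∃ i ≤ P.n, P.pts i = x := by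
  simp [points]

/-- If `P` is refined by `P'`, then `k j` is the index in `P'` of the `j`-th point of `P`. -/
lemma exists_index_of_subset {P P' : Partition s t} (h : P.points ⊆ P'.points) :
    ∃ k : ℕ → ℕ, k 0 = 0 ∧ k P.n = P'.n ∧ (∀ j < P.n, k j ≤ k (j + 1)) ∧
      (∀ j ≤ P.n, k j ≤ P'.n) ∧ ∀ j ≤ P.n, P'.pts (k j) = P.pts j := by
  have H : ∀ j, ∃ i, j ≤ P.n → i ≤ P'.n ∧ P'.pts i = P.pts j := fun j => by
    by_cases hj : j ≤ P.n
    · obtain ⟨i, hi, hi'⟩ := P'.mem_points.1 (h (P.mem_points.2 ⟨j, hj, rfl⟩))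
      exact ⟨i, fun _ => ⟨hi, hi'⟩⟩
    · exact ⟨0, fun h => absurd h hj⟩
  choose k hk using H
  refine ⟨k, ?_, ?_, fun j hj => ?_, fun j hj => (hk j hj).1, fun j hj => (hk j hj).2⟩
  · have h0 := hk 0 (Nat.zero_le _)
    refine Nat.le_zero.1 (P'.le_of_pts_le h0.1 ?_)
    rw [h0.2, P.pts_zero, P'.pts_zero]
  · have h0 := hk P.n le_rfl
    refine le_antisymm h0.1 (P'.le_of_pts_le le_rfl ?_)
    rw [h0.2, P.pts_last, P'.pts_last]
  · refine P'.le_of_pts_le (hk j hj.le).1 ?_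
    rw [(hk j hj.le).2, (hk (j + 1) hj).2]
    exact (P.pts_lt j hj).le

/-- Inserting a point into a partition either does nothing or splits exactly one interval. -/
lemma exists_insert {M : Type*} [AddCommGroup M] (P : Partition s t) (hu : u ∈ Icc s t) :
    ∃ P' : Partition s t, P.points ⊆ P'.points ∧ u ∈ P'.points ∧ P'.mesh ≤ P.mesh ∧
      ((∀ Ξ : ℝ → ℝ → M, P'.sum Ξ = P.sum Ξ) ∨
        ∃ a b, s ≤ a ∧ a < u ∧ u < b ∧ b ≤ t ∧ b - u ≤ P.mesh ∧
          ∀ Ξ : ℝ → ℝ → M, P.sum Ξ - P'.sum Ξ = Ξ a b - Ξ a u - Ξ u b) := by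
  by_cases hmem : u ∈ P.points
  · exact ⟨P, subset_rfl, hmem, le_rfl, Or.inl fun _ => rfl⟩
  have hne : ∀ i ≤ P.n, P.pts i ≠ u := fun i hi h => hmem (P.mem_points.2 ⟨i, hi, h⟩)
  have hsu : s < u := lt_of_le_of_ne hu.1 (P.pts_zero ▸ hne 0 (Nat.zero_le _))
  have hut : u < t := lt_of_le_of_ne hu.2 (P.pts_last ▸ (hne P.n le_rfl).symm)
  have hex : ∃ k, u < P.pts k := ⟨P.n, by rwa [P.pts_last]⟩
  classical
  obtain ⟨k, hk⟩ : ∃ k, Nat.find hex = k + 1 := Nat.exists_eq_succ_of_ne_zero fun h => by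
    have := Nat.find_spec hex
    rw [h, P.pts_zero] at this
    exact lt_asymm hsu this
  have hkn : k + 1 ≤ P.n := hk ▸ Nat.find_min' hex (by rwa [P.pts_last])
  have hk1 : u < P.pts (k + 1) := hk ▸ Nat.find_spec hex
  have hk0 : P.pts k < u :=
    lt_of_le_of_ne (not_lt.1 (Nat.find_min hex (by omega))) (hne k (by omega))
  let f : ℕ → ℝ := fun j => if j ≤ k then P.pts j else if j = k + 1 then u else P.pts (j - 1)
  have f1 : ∀ j ≤ k, f j = P.pts j := fun j hj => by simp [f, hj]
  have f2 : f (k + 1) = u := by simp [f]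
  have f3 : ∀ j, k + 1 ≤ j → f (j + 1) = P.pts j := fun j hj => by
    have h1 : ¬ (j + 1 ≤ k) := by omega
    have h2 : ¬ (j = k) := by omega
    simp [f, h1, h2]
  have hstep : ∀ i < P.n + 1, f i < f (i + 1) ∧ f (i + 1) - f i ≤ P.mesh := fun i hi => by
    have hm := P.mesh_le_iff.1 le_rfl
    rcases lt_trichotomy i k with h | rfl | h
    · rw [f1 i h.le, f1 (i + 1) h]
      exact ⟨P.pts_lt i (by omega), hm i (by omega)⟩
    · rw [f1 i le_rfl, f2]
      exact ⟨hk0, by linarith [hm i (by omega)]⟩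
    · rcases Nat.lt_iff_add_one_le.1 h |>.eq_or_lt with rfl | h'
      · rw [f2, f3 (k + 1) le_rfl]
        exact ⟨hk1, by linarith [hm k (by omega)]⟩
      · obtain ⟨j, rfl⟩ : ∃ j, i = j + 1 := ⟨i - 1, by omega⟩
        rw [f3 j (by omega), f3 (j + 1) (by omega)]
        exact ⟨P.pts_lt j (by omega), hm j (by omega)⟩
  let P' : Partition s t :=
    { n := P.n + 1
      pts := f
      pts_zero := by rw [f1 0 (Nat.zero_le _), P.pts_zero]
      pts_last := by rw [f3 P.n hkn, P.pts_last]
      pts_lt := fun i hi => (hstep i hi).1 }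
  refine ⟨P', fun x hx => ?_, ?_, ?_, Or.inr ⟨P.pts k, P.pts (k + 1), P.le_pts (by omega), hk0, hk1,
    P.pts_le hkn, ?_, fun Ξ => ?_⟩⟩
  · obtain ⟨i, hi, rfl⟩ := P.mem_points.1 hx
    rw [P'.mem_points]
    rcases le_or_gt i k with h | h
    · exact ⟨i, by simp only [P']; omega, f1 i h⟩
    · exact ⟨i + 1, by simp only [P']; omega, f3 i h⟩
  · exact P'.mem_points.2 ⟨k + 1, by simp only [P']; omega, f2⟩
  · exact P'.mesh_le_iff.2 fun i hi => (hstep i hi).2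
  · have := P.mesh_le_iff.1 le_rfl k (by omega)
    linarith
  · obtain ⟨l, hl⟩ : ∃ l, P.n = k + 1 + l := ⟨P.n - (k + 1), by omega⟩
    have e1 : P.sum Ξ = ∑ i ∈ Finset.range k, Ξ (P.pts i) (P.pts (i + 1)) +
        Ξ (P.pts k) (P.pts (k + 1)) +
        ∑ i ∈ Finset.range l, Ξ (P.pts (k + 1 + i)) (P.pts (k + 1 + i + 1)) := by
      rw [sum, hl, Finset.sum_range_add, Finset.sum_range_succ]
    have e2 : P'.sum Ξ = ∑ i ∈ Finset.range k, Ξ (P.pts i) (P.pts (i + 1)) +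
        Ξ (P.pts k) u + Ξ u (P.pts (k + 1)) +
        ∑ i ∈ Finset.range l, Ξ (P.pts (k + 1 + i)) (P.pts (k + 1 + i + 1)) := by
      have : P'.n = k + 1 + 1 + l := by simp only [P']; omega
      rw [sum, this, Finset.sum_range_add, Finset.sum_range_succ, Finset.sum_range_succ]
      congr 1
      · congr 1
        · congr 1
          · refine Finset.sum_congr rfl fun i hi => ?_
            have := Finset.mem_range.1 hi
            change Ξ (f i) (f (i + 1)) = _
            rw [f1 i (by omega), f1 (i + 1) (by omega)]
          · change Ξ (f k) (f (k + 1)) = _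
            rw [f1 k le_rfl, f2]
        · change Ξ (f (k + 1)) (f (k + 1 + 1)) = _
          rw [f2, f3 (k + 1) le_rfl]
      · refine Finset.sum_congr rfl fun i hi => ?_
        change Ξ (f (k + 1 + 1 + i)) (f (k + 1 + 1 + i + 1)) = _
        have h1 := f3 (k + 1 + i) (by omega)
        have h2 := f3 (k + 1 + i + 1) (by omega)
        rw [← h1, ← h2]
        congr 2 <;> ring
    rw [e1, e2]
    abel

lemma exists_refine (P : Partition s t) (F : Finset ℝ) (hF : ∀ u ∈ F, u ∈ Icc s t) :
    ∃ P' : Partition s t, P.points ⊆ P'.points ∧ F ⊆ P'.points ∧ P'.mesh ≤ P.mesh := by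
  classical
  induction F using Finset.induction_on with
  | empty => exact ⟨P, subset_rfl, by simp, le_rfl⟩
  | insert u F _ ih =>
    obtain ⟨P', h1, h2, h3⟩ := ih fun v hv => hF v (Finset.mem_insert_of_mem hv)
    obtain ⟨P'', g1, g2, g3, -⟩ :=
      exists_insert (M := ℝ) P' (hF u (Finset.mem_insert_self _ _))
    exact ⟨P'', h1.trans g1, Finset.insert_subset g2 (h2.trans g1), g3.trans h3⟩

/-- The concatenation of a partition of `[s, u]` and one of `[u, t]`. -/
def concat (P : Partition s u) (Q : Partition u t) : Partition s t where
  n := P.n + Q.n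
  pts i := if i ≤ P.n then P.pts i else Q.pts (i - P.n)
  pts_zero := by simp [P.pts_zero]
  pts_last := by
    by_cases h : Q.n = 0
    · have h1 := Q.pts_zero
      have h2 := Q.pts_last
      rw [h] at h2
      simp [h, P.pts_last, ← h1, h2]
    · simp [h, Q.pts_last]
  pts_lt i hi := by
    rcases lt_trichotomy i P.n with h | rfl | h
    · simpa [h.le, Nat.succ_le_of_lt h] using P.pts_lt i h
    · have := Q.pts_lt 0 (by omega)
      simpa [P.pts_last, Q.pts_zero] using this
    · have h1 : ¬ i ≤ P.n := by omega
      have h2 : ¬ i + 1 ≤ P.n := by omega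
      have h3 : i + 1 - P.n = i - P.n + 1 := by omega
      simpa [h1, h2, h3] using Q.pts_lt (i - P.n) (by omega)

lemma concat_pts_left (P : Partition s u) (Q : Partition u t) {i : ℕ} (hi : i ≤ P.n) :
    (P.concat Q).pts i = P.pts i := by simp [concat, hi]

lemma concat_pts_right (P : Partition s u) (Q : Partition u t) (i : ℕ) :
    (P.concat Q).pts (P.n + i) = Q.pts i := by
  rcases Nat.eq_zero_or_pos i with rfl | h
  · simp [concat, P.pts_last, Q.pts_zero]
  · have : ¬ i = 0 := by omega
    simp [concat, this]

lemma sum_concat {M : Type*} [AddCommMonoid M] (P : Partition s u) (Q : Partition u t)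
    (Ξ : ℝ → ℝ → M) : (P.concat Q).sum Ξ = P.sum Ξ + Q.sum Ξ := by
  rw [sum, show (P.concat Q).n = P.n + Q.n from rfl, Finset.sum_range_add]
  congr 1
  · refine Finset.sum_congr rfl fun i hi => ?_
    have := Finset.mem_range.1 hi
    rw [concat_pts_left P Q this.le, concat_pts_left P Q this]
  · refine Finset.sum_congr rfl fun i hi => ?_
    rw [concat_pts_right, add_assoc, concat_pts_right]

lemma mesh_concat_le (P : Partition s u) (Q : Partition u t) {δ : ℝ≥0} (hP : P.mesh ≤ δ)
    (hQ : Q.mesh ≤ δ) : (P.concat Q).mesh ≤ δ := by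
  rw [mesh_le_iff] at *
  intro i hi
  rcases lt_or_ge i P.n with h | h
  · rw [concat_pts_left P Q h.le, concat_pts_left P Q h]
    exact hP i h
  · obtain ⟨j, rfl⟩ := Nat.exists_eq_add_of_le h
    rw [concat_pts_right, add_assoc, concat_pts_right]
    exact hQ j (by change P.n + j < P.n + Q.n at hi; omega)

/-- The partition with at most one interval. -/
def single (h : s ≤ t) : Partition s t where
  n := if s = t then 0 else 1
  pts i := if i = 0 then s else t
  pts_zero := by simp
  pts_last := by split_ifs with h1 h2 <;> simp_all
  pts_lt i hi := by
    by_cases hst : s = t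
    · simp [hst] at hi
    · have : i = 0 := by simpa [hst] using hi
      simpa [this] using lt_of_le_of_ne h hst

lemma sum_single {M : Type*} [AddCommMonoid M] (h : s < t) (Ξ : ℝ → ℝ → M) :
    (single h.le).sum Ξ = Ξ s t := by
  simp [sum, single, h.ne]

lemma points_single_subset (P : Partition s t) : (single P.left_le_right).points ⊆ P.points := by
  intro x hx
  obtain ⟨i, -, rfl⟩ := (single P.left_le_right).mem_points.1 hx
  rw [mem_points]
  by_cases h : i = 0
  · exact ⟨0, Nat.zero_le _, by simp [single, h, P.pts_zero]⟩
  · exact ⟨P.n, le_rfl, by simp [single, h, P.pts_last]⟩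

lemma n_eq_zero (P : Partition s s) : P.n = 0 := by
  by_contra h
  have := P.pts_lt_pts (Nat.pos_of_ne_zero h) le_rfl
  rw [P.pts_zero, P.pts_last] at this
  exact lt_irrefl _ this

lemma sum_self {M : Type*} [AddCommMonoid M] (P : Partition s s) (Ξ : ℝ → ℝ → M) :
    P.sum Ξ = 0 := by
  simp [sum, P.n_eq_zero]

lemma sum_sub_eq {M : Type*} [AddCommGroup M] (P : Partition s t) (f : ℝ → M) :
    P.sum (fun u v => f v - f u) = f t - f s := by
  rw [sum, Finset.sum_range_sub (fun i => f (P.pts i)), P.pts_last, P.pts_zero]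

/-- The partition into `n + 1` intervals of equal length. -/
def uniform (h : s < t) (n : ℕ) : Partition s t where
  n := n + 1
  pts i := s + i * ((t - s) / (n + 1))
  pts_zero := by simp
  pts_last := by
    push_cast
    field_simp
    ring
  pts_lt i _ := by
    have : 0 < (t - s) / (n + 1) := div_pos (sub_pos.2 h) (by positivity)
    push_cast
    nlinarith

lemma exists_mesh_le (h : s ≤ t) {δ : ℝ≥0} (hδ : 0 < δ) : ∃ P : Partition s t, P.mesh ≤ δ := by
  rcases h.eq_or_lt with rfl | h
  · refine ⟨single le_rfl, ?_⟩
    rw [mesh_le_iff]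
    simp [single]
  · obtain ⟨n, hn⟩ := exists_nat_gt ((t - s) / δ)
    refine ⟨uniform h n, (mesh_le_iff _).2 fun i _ => ?_⟩
    have hδ' : (0 : ℝ) < δ := hδ
    rw [div_lt_iff₀ hδ'] at hn
    have : (uniform h n).pts (i + 1) - (uniform h n).pts i = (t - s) / (n + 1) := by
      simp only [uniform]
      push_cast
      ring
    rw [this, div_le_iff₀ (by positivity)]
    nlinarith

end Partition

/-! ### Vanishing mesh size -/

lemma mem_meshFilter {s t : ℝ} {S : Set (Partition s t)} :
    S ∈ meshFilter s t ↔ ∃ δ : ℝ≥0, 0 < δ ∧ ∀ P : Partition s t, P.mesh ≤ δ → P ∈ S := by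
  rw [meshFilter, ← bot_eq_zero, (nhds_bot_basis_Iic.comap _).mem_iff]
  simp [subset_def, pos_iff_ne_zero]

lemma meshFilter_neBot {s t : ℝ} (h : s ≤ t) : (meshFilter s t).NeBot := by
  refine ⟨fun hb => ?_⟩
  obtain ⟨δ, hδ, H⟩ := mem_meshFilter.1 (hb ▸ mem_bot : (∅ : Set (Partition s t)) ∈ meshFilter s t)
  obtain ⟨P, hP⟩ := Partition.exists_mesh_le h hδ
  exact H P hP

/-! ### Controls that are right-continuous on the diagonal -/

/-- A superadditive two-parameter function on `[0, T]` that is finite on `[0, T]` and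
right-continuous on the diagonal. -/
structure IsRightControl (w : ℝ → ℝ → ℝ≥0∞) (T : ℝ) : Prop where
  superadd : ∀ s u t, 0 ≤ s → s ≤ u → u ≤ t → t ≤ T → w s u + w u t ≤ w s t
  lt_top : w 0 T < ∞
  right : ∀ s ∈ Ico 0 T, Tendsto (w s) (𝓝[>] s) (𝓝 0)

namespace IsRightControl

variable {w : ℝ → ℝ → ℝ≥0∞} {T : ℝ}

lemma mono (hw : IsRightControl w T) {s s' t t' : ℝ} (h0 : 0 ≤ s) (h1 : s ≤ s') (h2 : s' ≤ t')
    (h3 : t' ≤ t) (h4 : t ≤ T) : w s' t' ≤ w s t :=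
  calc w s' t' ≤ w s s' + w s' t' := le_add_self
    _ ≤ w s t' := hw.superadd s s' t' h0 h1 h2 (h3.trans h4)
    _ ≤ w s t' + w t' t := le_self_add
    _ ≤ w s t := hw.superadd s t' t h0 (h1.trans h2) h3 h4

lemma ne_top (hw : IsRightControl w T) {s t : ℝ} (h0 : 0 ≤ s) (h1 : s ≤ t) (h2 : t ≤ T) :
    w s t ≠ ∞ :=
  ((hw.mono le_rfl h0 h1 h2 le_rfl).trans_lt hw.lt_top).ne

lemma self_eq_zero (hw : IsRightControl w T) {s : ℝ} (h0 : 0 ≤ s) (h1 : s ≤ T) : w s s = 0 := by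
  have h := hw.superadd s s s h0 le_rfl le_rfl h1
  by_contra hne
  exact absurd h (not_le.2 (ENNReal.lt_add_right (hw.ne_top h0 le_rfl h1) hne))

end IsRightControl

section Superadditive

variable {w : ℝ → ℝ → ℝ≥0∞} {T : ℝ}

/-- A finite superadditive function is small on intervals close to `x` on the left and not reaching
`x`: otherwise there would be arbitrarily many disjoint intervals on which it exceeds `η`. -/
lemma exists_left_small
    (hs : ∀ s u t, 0 ≤ s → s ≤ u → u ≤ t → t ≤ T → w s u + w u t ≤ w s t)
    (hfin : w 0 T < ∞) {η : ℝ≥0∞} (hη : 0 < η) {x : ℝ} (hx0 : 0 < x) (hxT : x ≤ T) :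
    ∃ a ∈ Ico 0 x, ∀ s u, a ≤ s → s ≤ u → u < x → w s u ≤ η := by
  by_contra! H
  have key : ∀ n : ℕ, ∀ a ∈ Ico 0 x, ∃ b ∈ Ico a x, (n : ℝ≥0∞) * η ≤ w a b := by
    intro n
    induction n with
    | zero => exact fun a ha => ⟨a, ⟨le_rfl, ha.2⟩, by simp⟩
    | succ n ih =>
      intro a ha
      obtain ⟨b, hb, hab⟩ := ih a ha
      obtain ⟨s, u, h1, h2, h3, h4⟩ := H b ⟨ha.1.trans hb.1, hb.2⟩
      refine ⟨u, ⟨hb.1.trans (h1.trans h2), h3⟩, ?_⟩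
      push_cast
      rw [add_mul, one_mul]
      calc (n : ℝ≥0∞) * η + η ≤ w a b + w s u := add_le_add hab h4.le
        _ ≤ w a b + (w b s + w s u) := by gcongr; exact le_add_self
        _ ≤ w a b + w b u := by
          gcongr
          exact hs b s u (ha.1.trans hb.1) h1 h2 (h3.le.trans hxT)
        _ ≤ w a u := hs a b u ha.1 hb.1 (h1.trans h2) (h3.le.trans hxT)
  obtain ⟨n, hn⟩ := ENNReal.exists_nat_mul_gt hη.ne' hfin.ne
  obtain ⟨b, hb, hb'⟩ := key n 0 ⟨le_rfl, hx0⟩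
  refine absurd (hb'.trans ?_) (not_le.2 hn)
  exact (le_self_add).trans (hs 0 b T le_rfl hb.1 (hb.2.le.trans hxT) le_rfl)

/-- The analogue of `exists_left_small` on the right of `x`, with `x` excluded. -/
lemma exists_right_small
    (hs : ∀ s u t, 0 ≤ s → s ≤ u → u ≤ t → t ≤ T → w s u + w u t ≤ w s t)
    (hfin : w 0 T < ∞) {η : ℝ≥0∞} (hη : 0 < η) {x : ℝ} (hx0 : 0 ≤ x) (hxT : x < T) :
    ∃ b ∈ Ioc x T, ∀ s u, x < s → s ≤ u → u ≤ b → w s u ≤ η := by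
  by_contra! H
  have key : ∀ n : ℕ, ∀ b ∈ Ioc x T, ∃ a ∈ Ioc x b, (n : ℝ≥0∞) * η ≤ w a b := by
    intro n
    induction n with
    | zero => exact fun b hb => ⟨b, ⟨hb.1, le_rfl⟩, by simp⟩
    | succ n ih =>
      intro b hb
      obtain ⟨a, ha, hab⟩ := ih b hb
      obtain ⟨s, u, h1, h2, h3, h4⟩ := H a ⟨ha.1, ha.2.trans hb.2⟩
      refine ⟨s, ⟨h1, h2.trans (h3.trans ha.2)⟩, ?_⟩
      push_cast
      rw [add_mul, one_mul, add_comm]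
      have h0 : 0 ≤ s := hx0.trans h1.le
      calc η + (n : ℝ≥0∞) * η ≤ w s u + w a b := add_le_add h4.le hab
        _ ≤ (w s u + w u a) + w a b := by gcongr; exact le_self_add
        _ ≤ w s a + w a b := by
          gcongr
          exact hs s u a h0 h2 h3 (ha.2.trans hb.2)
        _ ≤ w s b := hs s a b h0 (h2.trans h3) ha.2 hb.2
  obtain ⟨n, hn⟩ := ENNReal.exists_nat_mul_gt hη.ne' hfin.ne
  obtain ⟨a, ha, ha'⟩ := key n T ⟨hxT, le_rfl⟩
  refine absurd (ha'.trans ?_) (not_le.2 hn)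
  exact (le_add_self).trans (hs 0 a T le_rfl (hx0.trans ha.1.le) ha.2 le_rfl)

end Superadditive

/-- A control that is right-continuous on the diagonal becomes small on the intervals `[s, u]`
that meet a suitable finite set `Q` at most in their left end point; jumps are absorbed by `Q`. -/
lemma IsRightControl.exists_finset {w : ℝ → ℝ → ℝ≥0∞} {T : ℝ} (hw : IsRightControl w T)
    (hT : 0 ≤ T) {η : ℝ≥0∞} (hη : 0 < η) :
    ∃ Q : Finset ℝ, (∀ x ∈ Q, x ∈ Icc 0 T) ∧
      ∀ s u, 0 ≤ s → s ≤ u → u ≤ T → (∀ x ∈ Q, x ∉ Ioc s u) → w s u ≤ η := by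
  classical
  -- The supremum of the times `t` up to which such a set exists belongs to `A`, by
  -- `exists_left_small`, and can only be `T`, by right-continuity on the diagonal.
  let A : Set ℝ := {t | t ∈ Icc 0 T ∧ ∃ Q : Finset ℝ, (∀ x ∈ Q, x ∈ Icc 0 T) ∧
      ∀ s u, 0 ≤ s → s ≤ u → u ≤ t → (∀ x ∈ Q, x ∉ Ioc s u) → w s u ≤ η}
  have h0 : (0 : ℝ) ∈ A := by
    refine ⟨⟨le_rfl, hT⟩, ∅, by simp, fun s u h1 h2 h3 _ => ?_⟩
    obtain rfl : s = 0 := le_antisymm (h2.trans h3) h1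
    obtain rfl : u = 0 := le_antisymm h3 h2
    simp [hw.self_eq_zero le_rfl hT]
  have hbdd : BddAbove A := ⟨T, fun t ht => ht.1.2⟩
  set x := sSup A with hx
  have hx0 : 0 ≤ x := le_csSup hbdd h0
  have hxT : x ≤ T := csSup_le ⟨0, h0⟩ fun t ht => ht.1.2
  have hxA : x ∈ A := by
    rcases hx0.eq_or_lt with h | hpos
    · exact h ▸ h0
    obtain ⟨a, ha, hsmall⟩ := exists_left_small hw.superadd hw.lt_top hη hpos hxT
    obtain ⟨t, ht, hat⟩ := exists_lt_of_lt_csSup ⟨0, h0⟩ ha.2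
    have htI := ht.1
    obtain ⟨_, Q, hQ, hQ'⟩ := ht
    refine ⟨⟨hx0, hxT⟩, insert t (insert x Q), ?_, fun s u h1 h2 h3 h4 => ?_⟩
    · intro y hy
      rcases Finset.mem_insert.1 hy with rfl | hy
      · exact htI
      rcases Finset.mem_insert.1 hy with rfl | hy
      · exact ⟨hx0, hxT⟩
      · exact hQ y hy
    · rcases h2.eq_or_lt with rfl | hsu
      · simp [hw.self_eq_zero h1 (h3.trans hxT)]
      rcases le_or_gt u t with hut | hut
      · exact hQ' s u h1 h2 hut fun y hy => h4 y (by simp [hy])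
      · have hts : t ≤ s := by
          by_contra! hst
          exact h4 t (by simp) ⟨hst, hut.le⟩
        have hux : u ≠ x := by
          intro h
          exact h4 u (by simp [h]) ⟨hsu, le_rfl⟩
        exact hsmall s u (hat.le.trans hts) h2 (lt_of_le_of_ne h3 hux)
  rcases hxT.eq_or_lt with hxT' | hxT'
  · obtain ⟨-, Q, hQ, hQ'⟩ := hxA
    exact ⟨Q, hQ, hxT' ▸ hQ'⟩
  · exfalso
    have hr := (hw.right x ⟨hx0, hxT'⟩).eventually (eventually_le_nhds hη)
    obtain ⟨b, hb, hb'⟩ := (mem_nhdsGT_iff_exists_Ioo_subset).1 hr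
    have hb : x < b := hb
    obtain ⟨-, Q, hQ, hQ'⟩ := hxA
    obtain ⟨y, hy1, hy2⟩ := exists_between (lt_min hb hxT')
    have hyT : y ≤ T := (hy2.trans_le (min_le_right _ _)).le
    have : y ∈ A := by
      refine ⟨⟨hx0.trans hy1.le, hyT⟩, insert x Q, ?_, fun s u h1 h2 h3 h4 => ?_⟩
      · intro z hz
        rcases Finset.mem_insert.1 hz with rfl | hz
        · exact ⟨hx0, hxT⟩
        · exact hQ z hz
      · rcases le_or_gt u x with hux | hux
        · exact hQ' s u h1 h2 hux fun z hz => h4 z (by simp [hz])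
        · have hxs : x ≤ s := by
            by_contra! hsx
            exact h4 x (by simp) ⟨hsx, hux.le⟩
          exact (hw.mono hx0 hxs h2 le_rfl (h3.trans hyT)).trans
            (hb' ⟨hux, h3.trans_lt (hy2.trans_le (min_le_left _ _))⟩)
    exact absurd (le_csSup hbdd this) (not_le.2 hy1)

/-- The smallest superadditive majorant: the supremum of the sums of `Ψ` over partitions. -/
def varControl (Ψ : ℝ → ℝ → ℝ≥0∞) (s t : ℝ) : ℝ≥0∞ := ⨆ P : Partition s t, P.sum Ψ

section VarControl

variable {Ψ : ℝ → ℝ → ℝ≥0∞} {T : ℝ}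

lemma le_varControl {s t : ℝ} (h : s < t) : Ψ s t ≤ varControl Ψ s t := by
  rw [← Partition.sum_single h Ψ]
  exact le_iSup (fun P : Partition s t => P.sum Ψ) _

lemma varControl_superadd (s u t : ℝ) (h1 : s ≤ u) (h2 : u ≤ t) :
    varControl Ψ s u + varControl Ψ u t ≤ varControl Ψ s t := by
  have : Nonempty (Partition s u) := ⟨Partition.single h1⟩
  have : Nonempty (Partition u t) := ⟨Partition.single h2⟩
  refine ENNReal.iSup_add_iSup_le fun P Q => ?_
  rw [← Partition.sum_concat]
  exact le_iSup (fun P : Partition s t => P.sum Ψ) _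

/-- Right-continuity on the diagonal of the control only needs the smallness of `Ψ s v` as
`v ↓ s`: the intervals that do not start at `s` contribute little by superadditivity. -/
lemma varControl_isRightControl (hfin : varControl Ψ 0 T < ∞)
    (hΨ : ∀ s ∈ Ico 0 T, Tendsto (Ψ s) (𝓝[>] s) (𝓝 0)) : IsRightControl (varControl Ψ) T := by
  refine ⟨fun s u t _ h1 h2 _ => varControl_superadd s u t h1 h2, hfin, fun s hs => ?_⟩
  refine ENNReal.tendsto_nhds_zero.2 fun ε hε => ?_
  have hε2 : 0 < ε / 2 := ENNReal.half_pos hε.ne'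
  obtain ⟨b, hb, hsmall⟩ := exists_right_small
    (fun s u t _ h1 h2 _ => varControl_superadd s u t h1 h2) hfin hε2 hs.1 hs.2
  obtain ⟨c, hc, hc'⟩ := (mem_nhdsGT_iff_exists_Ioo_subset).1
    ((hΨ s hs).eventually (eventually_le_nhds hε2))
  have hc : s < c := hc
  refine mem_of_superset (Ioo_mem_nhdsGT (lt_min hb.1 hc)) fun u hu => ?_
  have hub : u ≤ b := (hu.2.trans_le (min_le_left _ _)).le
  change (⨆ P : Partition s u, P.sum Ψ) ≤ ε
  refine iSup_le fun P => ?_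
  obtain ⟨n, hn⟩ : ∃ n, P.n = n + 1 := Nat.exists_eq_succ_of_ne_zero fun h0 => by
    have h1 := P.pts_last
    rw [h0, P.pts_zero] at h1
    exact absurd hu.1 (by simp [h1])
  let P' : Partition (P.pts 1) u :=
    { n := n
      pts := fun i => P.pts (i + 1)
      pts_zero := rfl
      pts_last := by rw [← hn, P.pts_last]
      pts_lt := fun i hi => P.pts_lt (i + 1) (by omega) }
  have hs1 : s < P.pts 1 := by
    have := P.pts_lt 0 (by omega)
    rwa [P.pts_zero] at this
  have h1u : P.pts 1 ≤ u := P.pts_le (by omega)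
  have : P.sum Ψ = P'.sum Ψ + Ψ s (P.pts 1) := by
    rw [Partition.sum, hn, Finset.sum_range_succ']
    simp [P', Partition.sum, P.pts_zero]
  rw [this, ← ENNReal.add_halves ε]
  refine add_le_add ((le_iSup (fun P : Partition (P.pts 1) u => P.sum Ψ) P').trans
    (hsmall _ _ hs1 h1u hub)) (hc' ⟨hs1, h1u.trans_lt (hu.2.trans_le (min_le_right _ _))⟩)

end VarControl

/-! ### Orthogonality of martingale increments in `L^m` -/

lemma rpow_eq_rpow_sub_two_mul_sq {m c : ℝ} (hm : 2 ≤ m) (hc : 0 ≤ c) :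
    c ^ m = c ^ (m - 2) * c ^ 2 := by
  rw [← Real.rpow_natCast c 2, ← Real.rpow_add_of_nonneg hc (by linarith) (by norm_num)]
  norm_num

/-- A second order Taylor bound for `|·| ^ m`, with a remainder of the correct homogeneity. -/
lemma exists_abs_add_rpow_le {m : ℝ} (hm : 2 ≤ m) :
    ∃ K : ℝ, 0 ≤ K ∧ ∀ a b : ℝ, |a + b| ^ m ≤
      |a| ^ m + m * (a * |a| ^ (m - 2) * b) + K * (|a| ^ (m - 2) * b ^ 2 + |b| ^ m) := by
  set K1 : ℝ := 3 ^ m + m * 2 * 2 ^ (m - 2) with hK1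
  set K2 : ℝ := m ^ 2 * Real.exp m with hK2
  have hK1' : 0 ≤ K1 := by positivity
  have hK2' : 0 ≤ K2 := by positivity
  have key : ∀ c : ℝ, 0 ≤ c → c ^ m = c ^ (m - 2) * c ^ 2 := fun c hc =>
    rpow_eq_rpow_sub_two_mul_sq hm hc
  refine ⟨K1 + K2, by positivity, fun a b => ?_⟩
  have hA : 0 ≤ |a| ^ (m - 2) := by positivity
  have hB : 0 ≤ |b| ^ m := by positivity
  have hAb : 0 ≤ |a| ^ (m - 2) * b ^ 2 := by positivity
  -- For `|a| ≤ 2 |b|` every term is dominated by `|b| ^ m`; otherwise factor out `a` and expand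
  -- `(1 + x) ^ m` for `|x| < 1 / 2`.
  rcases le_or_gt |a| (2 * |b|) with h | h
  · have h1 : |a + b| ^ m ≤ 3 ^ m * |b| ^ m := by
      rw [← Real.mul_rpow (by norm_num) (abs_nonneg b)]
      exact Real.rpow_le_rpow (abs_nonneg _) (by linarith [abs_add_le a b]) (by linarith)
    have h2 : -(a * |a| ^ (m - 2) * b) ≤ 2 * 2 ^ (m - 2) * |b| ^ m := by
      calc -(a * |a| ^ (m - 2) * b) ≤ |a * |a| ^ (m - 2) * b| := neg_le_abs _
        _ = |a| * |a| ^ (m - 2) * |b| := by rw [abs_mul, abs_mul, abs_of_nonneg hA]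
        _ ≤ (2 * |b|) * (2 * |b|) ^ (m - 2) * |b| := by
          gcongr
        _ = 2 * 2 ^ (m - 2) * |b| ^ m := by
          rw [Real.mul_rpow (by norm_num) (abs_nonneg b), key |b| (abs_nonneg b)]
          ring
    have h3 : 0 ≤ |a| ^ m := by positivity
    have h4 : m * -(a * |a| ^ (m - 2) * b) ≤ m * (2 * 2 ^ (m - 2) * |b| ^ m) :=
      mul_le_mul_of_nonneg_left h2 (by linarith)
    have h5 : 0 ≤ (K1 + K2) * (|a| ^ (m - 2) * b ^ 2) := by positivity
    have h6 : 0 ≤ K2 * |b| ^ m := by positivity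
    have h7 : K1 * |b| ^ m = 3 ^ m * |b| ^ m + m * (2 * 2 ^ (m - 2) * |b| ^ m) := by
      rw [hK1]; ring
    nlinarith
  · have ha : a ≠ 0 := by
      rintro rfl
      simp only [abs_zero] at h
      linarith [abs_nonneg b]
    have ha' : 0 < |a| := abs_pos.2 ha
    set x := b / a with hx
    have hbx : b = a * x := by rw [hx]; field_simp
    have hx1 : |x| < 1 / 2 := by
      rw [hx, abs_div, div_lt_iff₀ ha']
      linarith
    have hx2 := abs_lt.1 hx1
    have h1 : |a + b| ^ m = |a| ^ m * (1 + x) ^ m := by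
      rw [hbx, show a + a * x = a * (1 + x) by ring, abs_mul, abs_of_nonneg (a := 1 + x)
        (by linarith), Real.mul_rpow ha'.le (by linarith)]
    have h2 : (1 + x) ^ m ≤ 1 + m * x + K2 * x ^ 2 := by
      have e1 : (1 + x) ^ m ≤ Real.exp (m * x) := by
        calc (1 + x) ^ m ≤ Real.exp x ^ m :=
              Real.rpow_le_rpow (by linarith) (by linarith [Real.add_one_le_exp x]) (by linarith)
          _ = Real.exp (m * x) := by rw [← Real.exp_mul, mul_comm]
      have e2 : Real.exp (m * x) - (1 + m * x) ≤ |m * x| ^ 2 * Real.exp |m * x| := by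
        have := Complex.norm_exp_sub_sum_le_norm_mul_exp ((m * x : ℝ) : ℂ) 2
        rw [Finset.sum_range_succ, Finset.sum_range_one] at this
        simp only [pow_zero, Nat.factorial_zero, Nat.cast_one, div_one, pow_one,
          Nat.factorial_one] at this
        rw [← Complex.ofReal_exp, ← Complex.ofReal_one, ← Complex.ofReal_add,
          ← Complex.ofReal_sub, Complex.norm_real, Complex.norm_real] at this
        exact (le_abs_self _).trans this
      have e3 : |m * x| ^ 2 * Real.exp |m * x| ≤ K2 * x ^ 2 := by
        have : |m * x| ≤ m := by
          rw [abs_mul, abs_of_nonneg (by linarith : (0 : ℝ) ≤ m)]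
          nlinarith
        have := Real.exp_le_exp.2 this
        rw [sq_abs, hK2]
        have : (m * x) ^ 2 * Real.exp |m * x| ≤ (m * x) ^ 2 * Real.exp m := by gcongr
        linarith
      linarith
    have h3 : |a| ^ m = |a| ^ (m - 2) * a ^ 2 := by rw [key _ ha'.le, sq_abs]
    have h4 : |a| ^ m * (1 + x) ^ m ≤ |a| ^ m * (1 + m * x + K2 * x ^ 2) := by gcongr
    have h5 : |a| ^ m * (1 + m * x + K2 * x ^ 2) =
        |a| ^ m + m * (a * |a| ^ (m - 2) * b) + K2 * (|a| ^ (m - 2) * b ^ 2) := by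
      rw [h3, hbx]; ring
    have h6 : 0 ≤ K1 * (|a| ^ (m - 2) * b ^ 2) := by positivity
    have h7 : 0 ≤ (K1 + K2) * |b| ^ m := by positivity
    rw [h1]
    nlinarith

lemma rpow_sub_two_mul_sq_le {m : ℝ} (hm : 2 ≤ m) {x y : ℝ} (hx : 0 ≤ x) (hy : 0 ≤ y) :
    x ^ (m - 2) * y ^ 2 ≤ x ^ m + y ^ m := by
  have key : ∀ c : ℝ, 0 ≤ c → c ^ m = c ^ (m - 2) * c ^ 2 := fun c hc =>
    rpow_eq_rpow_sub_two_mul_sq hm hc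
  have hxm : 0 ≤ x ^ m := by positivity
  have hym : 0 ≤ y ^ m := by positivity
  rcases le_total x y with h | h
  · have : x ^ (m - 2) * y ^ 2 ≤ y ^ (m - 2) * y ^ 2 := by
      gcongr
    linarith [key y hy]
  · have : x ^ (m - 2) * y ^ 2 ≤ x ^ (m - 2) * x ^ 2 := by gcongr
    linarith [key x hx]

/-- The estimate of `z ^ m` is dominated by the first terms of `(x ^ 2 + L y ^ 2) ^ (m / 2)` for a
large constant `L`, which gives an estimate of `z ^ 2` with constant one in front of `x ^ 2`. -/
lemma sq_le_of_rpow_le {m : ℝ} (hm : 2 ≤ m) {K x y z : ℝ} (hK : 0 ≤ K) (hx : 0 ≤ x) (hy : 0 ≤ y)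
    (hz : 0 ≤ z) (h : z ^ m ≤ x ^ m + K * (2 * (x ^ (m - 2) * y ^ 2) + y ^ m)) :
    z ^ 2 ≤ x ^ 2 + (4 * K + 1) * y ^ 2 := by
  set L := 4 * K + 1 with hL
  have hL1 : 1 ≤ L := by linarith
  have hsq : ∀ c : ℝ, 0 ≤ c → ∀ e : ℝ, (c ^ 2) ^ e = c ^ (2 * e) := fun c hc e => by
    rw [← Real.rpow_natCast c 2, ← Real.rpow_mul hc]
    norm_num
  set A := x ^ 2
  set B := L * y ^ 2
  have hA : 0 ≤ A := by positivity
  have hB : 0 ≤ B := by positivity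
  set g := m / 2 - 1 with hg
  have hg0 : 0 ≤ g := by rw [hg]; linarith
  have split : ∀ c : ℝ, 0 ≤ c → c ^ (m / 2) = c ^ g * c := fun c hc => by
    conv_rhs => rw [← Real.rpow_one c, ← Real.rpow_mul hc,
      ← Real.rpow_add_of_nonneg hc (by linarith) (by norm_num)]
    congr 1; rw [hg]; ring
  have hAg : A ^ g = x ^ (m - 2) := by rw [hsq x hx]; congr 1; rw [hg]; ring
  have hAh : A ^ (m / 2) = x ^ m := by rw [hsq x hx]; congr 1; ring
  have hBh : B ^ (m / 2) = L ^ (m / 2) * y ^ m := by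
    rw [Real.mul_rpow (by linarith) (by positivity), hsq y hy]
    congr 2; ring
  have hLh : L ≤ L ^ (m / 2) := by
    conv_lhs => rw [← Real.rpow_one L]
    exact Real.rpow_le_rpow_of_exponent_le hL1 (by linarith)
  have h1 : A ^ g ≤ (A + B) ^ g := Real.rpow_le_rpow hA (by linarith) hg0
  have h2 : B ^ g ≤ (A + B) ^ g := Real.rpow_le_rpow hB (by linarith) hg0
  have h3 : x ^ m + K * (2 * (x ^ (m - 2) * y ^ 2) + y ^ m) ≤ (A + B) ^ (m / 2) := by
    rw [split _ (by linarith)]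
    have e1 : A ^ g * A ≤ (A + B) ^ g * A := by gcongr
    have e2 : A ^ g * B ≤ (A + B) ^ g * B := by gcongr
    have e3 : B ^ g * B ≤ (A + B) ^ g * B := by gcongr
    rw [← split A hA, hAh] at e1
    rw [← split B hB, hBh] at e3
    have e4 : A ^ g * B = L * (x ^ (m - 2) * y ^ 2) := by rw [hAg]; ring
    rw [e4] at e2
    have hxy : 0 ≤ x ^ (m - 2) * y ^ 2 := by positivity
    have hym : 0 ≤ y ^ m := by positivity
    have e5 : L * y ^ m ≤ L ^ (m / 2) * y ^ m := by gcongr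
    have e6 : 2 * K * y ^ m ≤ L * y ^ m := by gcongr; linarith
    have e7 : 4 * K * (x ^ (m - 2) * y ^ 2) ≤ L * (x ^ (m - 2) * y ^ 2) := by gcongr; linarith
    nlinarith
  have h4 : (z ^ 2) ^ (m / 2) ≤ (A + B) ^ (m / 2) := by
    rw [hsq z hz, show 2 * (m / 2) = m by ring]
    exact h.trans h3
  exact (Real.rpow_le_rpow_iff (by positivity) (by linarith) (by linarith)).1 h4

section Martingale

variable {Ω : Type*} {mΩ : MeasurableSpace Ω} {μ : Measure Ω} {m : ℝ}

lemma integrable_abs_rpow (hm : 2 ≤ m) {X : Ω → ℝ} (hX : MemLp X (ENNReal.ofReal m) μ) :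
    Integrable (fun ω => |X ω| ^ m) μ := by
  have := hX.integrable_norm_rpow (by simp; linarith) ENNReal.ofReal_ne_top
  simpa [ENNReal.toReal_ofReal (by linarith : (0 : ℝ) ≤ m)] using this

lemma toReal_eLpNorm_rpow (hm : 2 ≤ m) {X : Ω → ℝ} (hX : MemLp X (ENNReal.ofReal m) μ) :
    (eLpNorm X (ENNReal.ofReal m) μ).toReal ^ m = ∫ ω, |X ω| ^ m ∂μ := by
  have h0 : 0 ≤ ∫ ω, |X ω| ^ m ∂μ := integral_nonneg fun ω => by positivity
  rw [hX.eLpNorm_eq_integral_rpow_norm (by simp; linarith) ENNReal.ofReal_ne_top,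
    ENNReal.toReal_ofReal (by linarith : (0 : ℝ) ≤ m)]
  simp only [Real.norm_eq_abs]
  rw [ENNReal.toReal_ofReal (by positivity), ← Real.rpow_mul h0,
    inv_mul_cancel₀ (by linarith), Real.rpow_one]

/-- Orthogonality of martingale increments in `L^m`: adding an increment with vanishing conditional
expectation increases the squared norm at most by a multiple of the squared norm of the
increment. -/
lemma exists_eLpNorm_add_sq_le [IsProbabilityMeasure μ] (hm : 2 ≤ m) :
    ∃ K : ℝ≥0, ∀ (m₀ : MeasurableSpace Ω), m₀ ≤ mΩ → ∀ X Y : Ω → ℝ, StronglyMeasurable[m₀] X →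
      MemLp X (ENNReal.ofReal m) μ → MemLp Y (ENNReal.ofReal m) μ → μ[Y | m₀] =ᵐ[μ] 0 →
      eLpNorm (X + Y) (ENNReal.ofReal m) μ ^ 2 ≤
        eLpNorm X (ENNReal.ofReal m) μ ^ 2 + K * eLpNorm Y (ENNReal.ofReal m) μ ^ 2 := by
  obtain ⟨K, hK, hTaylor⟩ := exists_abs_add_rpow_le hm
  refine ⟨Real.toNNReal (4 * K + 1), fun m₀ hm₀ X Y hXm hX hY hE => ?_⟩
  have hp1 : 1 ≤ ENNReal.ofReal m := by simp; linarith
  set p := ENNReal.ofReal m with hp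
  set x := (eLpNorm X p μ).toReal with hx
  set y := (eLpNorm Y p μ).toReal with hy
  set z := (eLpNorm (X + Y) p μ).toReal with hz
  have hx0 : 0 ≤ x := ENNReal.toReal_nonneg
  have hy0 : 0 ≤ y := ENNReal.toReal_nonneg
  have hz0 : 0 ≤ z := ENNReal.toReal_nonneg
  have hXY : MemLp (X + Y) p μ := hX.add hY
  have hxm := toReal_eLpNorm_rpow hm hX
  have hym := toReal_eLpNorm_rpow hm hY
  have hzm := toReal_eLpNorm_rpow hm hXY
  have iX := integrable_abs_rpow hm hX
  have iY := integrable_abs_rpow hm hY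
  have iXY := integrable_abs_rpow hm hXY
  have meas1 : StronglyMeasurable[m₀] fun ω => X ω * |X ω| ^ (m - 2) := by
    have h1 := hXm.measurable
    exact (h1.mul ((h1.norm).pow_const (m - 2))).stronglyMeasurable
  have i1 : Integrable (fun ω => X ω * |X ω| ^ (m - 2) * Y ω) μ := by
    refine ((iX.add iY).const_mul 2).mono'
      ((meas1.mono hm₀).aestronglyMeasurable.mul hY.aestronglyMeasurable)
      (Eventually.of_forall fun ω => ?_)
    have h1 := rpow_sub_two_mul_sq_le hm (abs_nonneg (X ω)) (abs_nonneg (Y ω))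
    have h2 := rpow_sub_two_mul_sq_le hm (abs_nonneg (X ω)) (abs_nonneg (X ω))
    have h3 : 0 ≤ |X ω| ^ (m - 2) := by positivity
    have h4 : 0 ≤ |Y ω| ^ m := by positivity
    simp only [norm_mul, Real.norm_eq_abs, abs_of_nonneg h3, Pi.add_apply]
    nlinarith [mul_nonneg h3 (sq_nonneg (|X ω| - |Y ω|))]
  have i2 : Integrable (fun ω => |X ω| ^ (m - 2) * Y ω ^ 2) μ := by
    refine (iX.add iY).mono' ?_ (Eventually.of_forall fun ω => ?_)
    · exact ((Real.continuous_rpow_const (by linarith)).comp_aestronglyMeasurable hX.1.norm).mul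
        (hY.1.pow 2)
    · have h1 := rpow_sub_two_mul_sq_le hm (abs_nonneg (X ω)) (abs_nonneg (Y ω))
      rw [sq_abs] at h1
      rw [Real.norm_of_nonneg (by positivity)]
      exact h1
  have hzero : ∫ ω, X ω * |X ω| ^ (m - 2) * Y ω ∂μ = 0 := by
    -- The first order term vanishes, as `X |X| ^ (m - 2)` is `m₀`-measurable.
    rw [← integral_condExp hm₀]
    have := condExp_mul_of_stronglyMeasurable_left (μ := μ) meas1 (g := Y) i1 (hY.integrable hp1)
    have h2 : μ[fun ω => X ω * |X ω| ^ (m - 2) * Y ω | m₀] =ᵐ[μ] 0 := by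
      filter_upwards [this, hE] with ω h1 h2
      refine h1.trans ?_
      simp [h2]
    rw [integral_congr_ae h2]
    simp
  have hineq : ∫ ω, |X ω + Y ω| ^ m ∂μ ≤ ∫ ω, |X ω| ^ m ∂μ +
      K * (∫ ω, |X ω| ^ (m - 2) * Y ω ^ 2 ∂μ + ∫ ω, |Y ω| ^ m ∂μ) := by
    have h := integral_mono (μ := μ) iXY
      ((iX.add (i1.const_mul m)).add ((i2.add iY).const_mul K)) fun ω => hTaylor (X ω) (Y ω)
    refine h.trans (le_of_eq ?_)
    rw [integral_add' (iX.add (i1.const_mul m)) ((i2.add iY).const_mul K),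
      integral_add' iX (i1.const_mul m), integral_const_mul, hzero, integral_const_mul]
    simp only [Pi.add_apply]
    rw [integral_add i2 iY]
    ring
  suffices hreal : z ^ 2 ≤ x ^ 2 + (4 * K + 1) * y ^ 2 by
    have e1 : eLpNorm X p μ = ENNReal.ofReal x := (ENNReal.ofReal_toReal hX.2.ne).symm
    have e2 : eLpNorm Y p μ = ENNReal.ofReal y := (ENNReal.ofReal_toReal hY.2.ne).symm
    have e3 : eLpNorm (X + Y) p μ = ENNReal.ofReal z := (ENNReal.ofReal_toReal hXY.2.ne).symm
    rw [e1, e2, e3, ← ENNReal.ofReal_pow hx0, ← ENNReal.ofReal_pow hy0, ← ENNReal.ofReal_pow hz0]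
    change _ ≤ _ + ENNReal.ofReal (4 * K + 1) * _
    rw [← ENNReal.ofReal_mul (by linarith), ← ENNReal.ofReal_add (by positivity) (by positivity)]
    exact ENNReal.ofReal_le_ofReal hreal
  have htri : z ≤ x + y := by
    rw [hx, hy, hz, ← ENNReal.toReal_add hX.2.ne hY.2.ne]
    exact ENNReal.toReal_mono (ENNReal.add_ne_top.2 ⟨hX.2.ne, hY.2.ne⟩)
      (eLpNorm_add_le hX.1 hY.1 hp1)
  rcases hx0.eq_or_lt with hx00 | hxpos
  · rw [← hx00] at htri ⊢
    nlinarith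
  rcases hy0.eq_or_lt with hy00 | hypos
  · rw [← hy00] at htri ⊢
    nlinarith
  refine sq_le_of_rpow_le hm hK hx0 hy0 hz0 ?_
  rw [hzm]
  refine hineq.trans ?_
  rw [← hxm, ← hym]
  -- Hölder's inequality up to the factor two, by normalizing both variables
  have hcross : ∫ ω, |X ω| ^ (m - 2) * Y ω ^ 2 ∂μ ≤ 2 * (x ^ (m - 2) * y ^ 2) := by
    have hle : ∀ ω, |X ω| ^ (m - 2) * Y ω ^ 2 ≤
        x ^ (m - 2) * y ^ 2 * ((x ^ m)⁻¹ * |X ω| ^ m + (y ^ m)⁻¹ * |Y ω| ^ m) := fun ω => by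
      have h1 := rpow_sub_two_mul_sq_le hm (x := |X ω| / x) (y := |Y ω| / y)
        (by positivity) (by positivity)
      rw [Real.div_rpow (abs_nonneg _) hx0, Real.div_rpow (abs_nonneg _) hx0,
        Real.div_rpow (abs_nonneg _) hy0, div_pow, sq_abs, div_eq_inv_mul (|X ω| ^ m),
        div_eq_inv_mul (|Y ω| ^ m)] at h1
      have h2 : |X ω| ^ (m - 2) * Y ω ^ 2 =
          x ^ (m - 2) * y ^ 2 * (|X ω| ^ (m - 2) / x ^ (m - 2) * (Y ω ^ 2 / y ^ 2)) := by
        have := (Real.rpow_pos_of_pos hxpos (m - 2)).ne'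
        field_simp
      rw [h2]
      gcongr
    have h := integral_mono (μ := μ) i2
      (((iX.const_mul (x ^ m)⁻¹).add (iY.const_mul (y ^ m)⁻¹)).const_mul
        (x ^ (m - 2) * y ^ 2)) hle
    refine h.trans (le_of_eq ?_)
    rw [integral_const_mul]
    simp only [Pi.add_apply]
    rw [integral_add (iX.const_mul _) (iY.const_mul _), integral_const_mul, integral_const_mul,
      ← hxm, ← hym, inv_mul_cancel₀ (Real.rpow_pos_of_pos hxpos m).ne',
      inv_mul_cancel₀ (Real.rpow_pos_of_pos hypos m).ne']
    ring
  gcongr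

/-- `M` behaves like the end value of an `L^m` martingale transform between the `σ`-algebras
`m₁ ≤ m₂`, of square function at most `c`: it raises the squared norm of every `m₁`-measurable
variable by at most `c`. In this form the property adds up along consecutive increments. -/
structure IsSqIncrement (μ : Measure Ω) (m : ℝ) (m₁ m₂ : MeasurableSpace Ω) (M : Ω → ℝ)
    (c : ℝ≥0∞) : Prop where
  meas : StronglyMeasurable[m₂] M
  memLp : MemLp M (ENNReal.ofReal m) μ
  le : ∀ W : Ω → ℝ, StronglyMeasurable[m₁] W → MemLp W (ENNReal.ofReal m) μ →
    eLpNorm (W + M) (ENNReal.ofReal m) μ ^ 2 ≤ eLpNorm W (ENNReal.ofReal m) μ ^ 2 + c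

namespace IsSqIncrement

variable {m₁ m₂ m₃ : MeasurableSpace Ω} {M N : Ω → ℝ} {c c' : ℝ≥0∞}

lemma zero : IsSqIncrement μ m m₁ m₂ 0 0 :=
  ⟨stronglyMeasurable_zero, MemLp.zero, fun W _ _ => by simp⟩

lemma mono (h : IsSqIncrement μ m m₁ m₂ M c) (hc : c ≤ c') : IsSqIncrement μ m m₁ m₂ M c' :=
  ⟨h.meas, h.memLp, fun W h1 h2 => (h.le W h1 h2).trans (by gcongr)⟩

lemma mono_right (h : IsSqIncrement μ m m₁ m₂ M c) (h23 : m₂ ≤ m₃) :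
    IsSqIncrement μ m m₁ m₃ M c :=
  ⟨h.meas.mono h23, h.memLp, h.le⟩

lemma add (h12 : m₁ ≤ m₂) (h23 : m₂ ≤ m₃) (hM : IsSqIncrement μ m m₁ m₂ M c)
    (hN : IsSqIncrement μ m m₂ m₃ N c') : IsSqIncrement μ m m₁ m₃ (M + N) (c + c') := by
  refine ⟨(hM.meas.mono h23).add hN.meas, hM.memLp.add hN.memLp, fun W h1 h2 => ?_⟩
  rw [← add_assoc, ← add_assoc]
  refine (hN.le (W + M) ((h1.mono h12).add hM.meas) (h2.add hM.memLp)).trans ?_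
  gcongr
  exact hM.le W h1 h2

lemma eLpNorm_le (h : IsSqIncrement μ m m₁ m₂ M c) :
    eLpNorm M (ENNReal.ofReal m) μ ≤ c ^ (1 / 2 : ℝ) := by
  have h1 := h.le 0 stronglyMeasurable_zero MemLp.zero
  rw [zero_add, eLpNorm_zero, zero_pow two_ne_zero, zero_add] at h1
  have h2 := ENNReal.rpow_le_rpow h1 (by norm_num : (0 : ℝ) ≤ 1 / 2)
  rwa [← ENNReal.rpow_natCast, ← ENNReal.rpow_mul, Nat.cast_two, mul_one_div_cancel two_ne_zero,
    ENNReal.rpow_one] at h2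

end IsSqIncrement

end Martingale

/-! ### Sums over a partition and over a refinement -/

section Sewing

variable {Ω : Type*} {mΩ : MeasurableSpace Ω} {μ : Measure Ω} {ℱ : Filtration ℝ mΩ} {m α β : ℝ}
  {a b : ℝ≥0∞} {n : ℕ} {s u v t : ℝ} {X Y : Ω → ℝ} {W W' : ℝ≥0∞}

/-- The decomposition behind the stochastic sewing lemma: `X` is a sum over scales `k < n` of a
part of finite variation type, estimated by the triangle inequality, and a martingale part,
estimated by orthogonality; both decay geometrically in `k`. Here `W` is the size of the control
on `[s, t]`. -/
def HasScaleDecomp (μ : Measure Ω) (ℱ : Filtration ℝ mΩ) (m α β : ℝ) (a b : ℝ≥0∞) (n : ℕ)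
    (s t : ℝ) (X : Ω → ℝ) (W : ℝ≥0∞) : Prop :=
  ∃ A M : ℕ → Ω → ℝ, X = ∑ k ∈ Finset.range n, (A k + M k) ∧
    ∀ k, AEStronglyMeasurable (A k) μ ∧
      eLpNorm (A k) (ENNReal.ofReal m) μ ≤ a * (2 ^ (1 - β)) ^ k * W ^ β ∧
      IsSqIncrement μ m (ℱ s) (ℱ t) (M k) (b * (2 ^ (1 - 2 * α)) ^ k * W ^ (2 * α))

lemma HasScaleDecomp.zero : HasScaleDecomp μ ℱ m α β a b n s t 0 W :=
  ⟨fun _ => 0, fun _ => 0, by simp, fun _ =>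
    ⟨aestronglyMeasurable_zero, by simp, IsSqIncrement.zero.mono zero_le⟩⟩

lemma HasScaleDecomp.mono (h : HasScaleDecomp μ ℱ m α β a b n s t X W) (hα : 0 ≤ 2 * α)
    (hβ : 0 ≤ β) (hW : W ≤ W') : HasScaleDecomp μ ℱ m α β a b n s t X W' := by
  obtain ⟨A, M, rfl, H⟩ := h
  refine ⟨A, M, rfl, fun k => ⟨(H k).1, (H k).2.1.trans ?_, (H k).2.2.mono ?_⟩⟩
  · gcongr
  · gcongr

lemma HasScaleDecomp.add (hm : 2 ≤ m) (hα : 1 ≤ 2 * α) (hβ : 1 ≤ β) (hsu : s ≤ u) (hut : u ≤ t)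
    (hX : HasScaleDecomp μ ℱ m α β a b n s u X W)
    (hY : HasScaleDecomp μ ℱ m α β a b n u t Y W') :
    HasScaleDecomp μ ℱ m α β a b n s t (X + Y) (W + W') := by
  obtain ⟨A, M, rfl, H⟩ := hX
  obtain ⟨A', M', rfl, H'⟩ := hY
  refine ⟨fun k => A k + A' k, fun k => M k + M' k, ?_, fun k =>
    ⟨(H k).1.add (H' k).1, ?_, ((H k).2.2.add (ℱ.mono hsu) (ℱ.mono hut) (H' k).2.2).mono ?_⟩⟩
  · rw [← Finset.sum_add_distrib]
    exact Finset.sum_congr rfl fun k _ => add_add_add_comm _ _ _ _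
  · refine (eLpNorm_add_le (H k).1 (H' k).1 (by simp; linarith)).trans ?_
    refine (add_le_add (H k).2.1 (H' k).2.1).trans ?_
    rw [← mul_add]
    gcongr
    exact ENNReal.add_rpow_le_rpow_add _ _ hβ
  · rw [← mul_add]
    gcongr
    exact ENNReal.add_rpow_le_rpow_add _ _ hα

lemma half_rpow_add_half_rpow {e : ℝ} (he : 0 ≤ e) (W : ℝ≥0∞) :
    (W / 2) ^ e + (W / 2) ^ e = 2 ^ (1 - e) * W ^ e := by
  rw [ENNReal.div_rpow_of_nonneg _ _ he, ← two_mul, ENNReal.rpow_sub _ _ two_ne_zero (by simp),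
    ENNReal.rpow_one, div_eq_mul_inv, div_eq_mul_inv]
  ring

/-- On each half of the interval the control is at most `W / 2`, so that the parts of scale `k`
there add up to a part of scale `k + 1` on the whole interval; the new part of scale zero is the one that
comes from joining the halves. -/
lemma HasScaleDecomp.step (hm : 2 ≤ m) (hα : 1 ≤ 2 * α) (hβ : 1 ≤ β) (hsu : s ≤ u) (huv : u ≤ v)
    (hvt : v ≤ t) (hX : HasScaleDecomp μ ℱ m α β a b n s u X (W / 2))
    (hY : HasScaleDecomp μ ℱ m α β a b n v t Y (W / 2)) {A₀ M₀ : Ω → ℝ}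
    (hA : AEStronglyMeasurable A₀ μ) (hA' : eLpNorm A₀ (ENNReal.ofReal m) μ ≤ a * W ^ β)
    (hM : IsSqIncrement μ m (ℱ s) (ℱ t) M₀ (b * W ^ (2 * α))) :
    HasScaleDecomp μ ℱ m α β a b (n + 1) s t (X + Y + (A₀ + M₀)) W := by
  obtain ⟨A, M, rfl, H⟩ := hX
  obtain ⟨A', M', rfl, H'⟩ := hY
  refine ⟨fun k => Nat.casesOn k A₀ fun k => A k + A' k,
    fun k => Nat.casesOn k M₀ fun k => M k + M' k, ?_, fun k => ?_⟩
  · rw [Finset.sum_range_succ', ← Finset.sum_add_distrib]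
    congr 1
    exact Finset.sum_congr rfl fun k _ => add_add_add_comm _ _ _ _
  · cases k with
    | zero => exact ⟨hA, by simpa using hA', by simpa using hM⟩
    | succ k =>
      refine ⟨(H k).1.add (H' k).1, ?_, ((H k).2.2.mono_right (ℱ.mono huv)).add
        (ℱ.mono (hsu.trans huv)) (ℱ.mono hvt) (H' k).2.2 |>.mono ?_⟩
      · refine (eLpNorm_add_le (H k).1 (H' k).1 (by simp; linarith)).trans ?_
        refine (add_le_add (H k).2.1 (H' k).2.1).trans ?_
        rw [← mul_add, half_rpow_add_half_rpow (by linarith), pow_succ]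
        ring_nf
        rfl
      · rw [← mul_add, half_rpow_add_half_rpow (by linarith), pow_succ]
        ring_nf
        rfl

lemma HasScaleDecomp.eLpNorm_le (hm : 2 ≤ m)
    (h : HasScaleDecomp μ ℱ m α β a b n s t X W) :
    eLpNorm X (ENNReal.ofReal m) μ ≤ a * (1 - 2 ^ (1 - β))⁻¹ * W ^ β +
      b ^ (1 / 2 : ℝ) * (1 - 2 ^ ((1 - 2 * α) / 2))⁻¹ * W ^ α := by
  obtain ⟨A, M, rfl, H⟩ := h
  have hM : ∀ k, eLpNorm (M k) (ENNReal.ofReal m) μ ≤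
      b ^ (1 / 2 : ℝ) * (2 ^ ((1 - 2 * α) / 2)) ^ k * W ^ α := fun k => by
    refine (H k).2.2.eLpNorm_le.trans (le_of_eq ?_)
    rw [ENNReal.mul_rpow_of_nonneg _ _ (by norm_num), ENNReal.mul_rpow_of_nonneg _ _ (by norm_num),
      ← ENNReal.rpow_mul, ← ENNReal.rpow_natCast, ← ENNReal.rpow_natCast, ← ENNReal.rpow_mul,
      ← ENNReal.rpow_mul, ← ENNReal.rpow_mul]
    ring_nf
  have hp1 : 1 ≤ ENNReal.ofReal m := by simp; linarith
  calc eLpNorm (∑ k ∈ Finset.range n, (A k + M k)) (ENNReal.ofReal m) μ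
      ≤ ∑ k ∈ Finset.range n, eLpNorm (A k + M k) (ENNReal.ofReal m) μ :=
        eLpNorm_sum_le (fun k _ => (H k).1.add (H k).2.2.memLp.1) hp1
    _ ≤ ∑ k ∈ Finset.range n, (a * (2 ^ (1 - β)) ^ k * W ^ β +
          b ^ (1 / 2 : ℝ) * (2 ^ ((1 - 2 * α) / 2)) ^ k * W ^ α) := by
        gcongr with k
        exact (eLpNorm_add_le (H k).1 (H k).2.2.memLp.1 hp1).trans (add_le_add (H k).2.1 (hM k))
    _ ≤ ∑' k : ℕ, (a * (2 ^ (1 - β)) ^ k * W ^ β +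
          b ^ (1 / 2 : ℝ) * (2 ^ ((1 - 2 * α) / 2)) ^ k * W ^ α) := ENNReal.sum_le_tsum _
    _ = _ := by
        rw [ENNReal.tsum_add, ENNReal.tsum_mul_right, ENNReal.tsum_mul_left,
          ENNReal.tsum_mul_right, ENNReal.tsum_mul_left, ENNReal.tsum_geometric,
          ENNReal.tsum_geometric]

/-- The defect of additivity of a two-parameter function. -/
def delta {M : Type*} [AddCommGroup M] (ξ : ℝ → ℝ → M) (s u t : ℝ) : M := ξ s t - ξ s u - ξ u t

/-- An adapted two-parameter process in `L^m` that vanishes on the diagonal. -/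
structure IsGerm (μ : Measure Ω) (ℱ : Filtration ℝ mΩ) (T m : ℝ) (ξ : ℝ → ℝ → Ω → ℝ) : Prop where
  meas : ∀ s t, 0 ≤ s → s ≤ t → t ≤ T → StronglyMeasurable[ℱ t] (ξ s t)
  memLp : ∀ s t, 0 ≤ s → s ≤ t → t ≤ T → MemLp (ξ s t) (ENNReal.ofReal m) μ
  self : ∀ s, 0 ≤ s → s ≤ T → ξ s s = 0

variable {T : ℝ} {ξ : ℝ → ℝ → Ω → ℝ}

lemma IsGerm.meas_delta (hξ : IsGerm μ ℱ T m ξ) (h0 : 0 ≤ s) (h1 : s ≤ u) (h2 : u ≤ t)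
    (h3 : t ≤ T) : StronglyMeasurable[ℱ t] (delta ξ s u t) :=
  ((hξ.meas s t h0 (h1.trans h2) h3).sub
    ((hξ.meas s u h0 h1 (h2.trans h3)).mono (ℱ.mono h2))).sub (hξ.meas u t (h0.trans h1) h2 h3)

lemma IsGerm.memLp_delta (hξ : IsGerm μ ℱ T m ξ) (h0 : 0 ≤ s) (h1 : s ≤ u) (h2 : u ≤ t)
    (h3 : t ≤ T) : MemLp (delta ξ s u t) (ENNReal.ofReal m) μ :=
  ((hξ.memLp s t h0 (h1.trans h2) h3).sub (hξ.memLp s u h0 h1 (h2.trans h3))).sub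
    (hξ.memLp u t (h0.trans h1) h2 h3)

lemma IsGerm.memLp_sum (hξ : IsGerm μ ℱ T m ξ) (h0 : 0 ≤ s) (h3 : t ≤ T) (P : Partition s t) :
    MemLp (P.sum ξ) (ENNReal.ofReal m) μ := by
  refine memLp_finsetSum' _ fun i hi => ?_
  have hi := Finset.mem_range.1 hi
  exact hξ.memLp _ _ (h0.trans (P.le_pts hi.le)) (P.pts_lt i hi).le ((P.pts_le hi).trans h3)

lemma IsGerm.meas_sum (hξ : IsGerm μ ℱ T m ξ) (h0 : 0 ≤ s) (h3 : t ≤ T) (P : Partition s t) :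
    StronglyMeasurable[ℱ t] (P.sum ξ) := by
  refine Finset.stronglyMeasurable_sum _ fun i hi => ?_
  have hi := Finset.mem_range.1 hi
  exact (hξ.meas _ _ (h0.trans (P.le_pts hi.le)) (P.pts_lt i hi).le ((P.pts_le hi).trans h3)).mono
    (ℱ.mono (P.pts_le hi))

/-- A discrete interval can be split, up to one elementary step, into two intervals on which the
control is at most half as large. -/
lemma exists_split {w : ℝ → ℝ → ℝ≥0∞} (hw : IsRightControl w T) {τ : ℕ → ℝ} {i k : ℕ} (hik : i < k)
    (hτ : ∀ j l, i ≤ j → j ≤ l → l ≤ k → τ j ≤ τ l) (h0 : 0 ≤ τ i) (hT : τ k ≤ T) :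
    ∃ j, i ≤ j ∧ j < k ∧ w (τ i) (τ j) ≤ w (τ i) (τ k) / 2 ∧
      w (τ (j + 1)) (τ k) ≤ w (τ i) (τ k) / 2 := by
  classical
  set W := w (τ i) (τ k) with hW
  have hk0 : 0 ≤ τ k := h0.trans (hτ i k le_rfl hik.le le_rfl)
  have hex : ∃ j, i ≤ j ∧ (k ≤ j + 1 ∨ W / 2 < w (τ i) (τ (j + 1))) :=
    ⟨k, hik.le, Or.inl (by omega)⟩
  obtain ⟨hij, hj⟩ := Nat.find_spec hex
  set j := Nat.find hex
  have hjk : j < k := by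
    have : j ≤ k - 1 := Nat.find_min' hex ⟨by omega, Or.inl (by omega)⟩
    omega
  refine ⟨j, hij, hjk, ?_, ?_⟩
  · rcases hij.eq_or_lt with h | h
    · rw [← h, hw.self_eq_zero h0 ((hτ i k le_rfl hik.le le_rfl).trans hT)]
      exact zero_le
    · have := Nat.find_min hex (show j - 1 < j by omega)
      push Not at this
      have h2 := (this (by omega)).2
      rwa [show j - 1 + 1 = j by omega] at h2
  · rcases hj with h | h
    · have : j + 1 = k := by omega
      rw [this, hw.self_eq_zero hk0 hT]
      exact zero_le
    · by_contra! hc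
      have h1 := hτ i (j + 1) le_rfl (by omega) hjk
      have h2 := hτ (j + 1) k (by omega) hjk le_rfl
      have := hw.superadd _ _ _ h0 h1 h2 hT
      have h3 := ENNReal.add_lt_add h hc
      rw [ENNReal.add_halves] at h3
      exact absurd this (not_le.2 h3)

/-- The germ on `[τ i, τ k]` minus the sum over the intermediate points decomposes over scales. The
proof is by induction on the number of steps: after splitting at `[τ j, τ (j + 1)]` as in
`exists_split`, the new part is `D₁ + D₂`, where `D₁` is `δξ` at `(τ i, τ j, τ k)` and `D₂` is `δξ`
at `(τ j, τ (j + 1), τ k)`; its conditional mean given `ℱ (τ i)` and the rest are estimated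
separately. -/
lemma hasScaleDecomp_of_bounds [IsProbabilityMeasure μ] (hm : 2 ≤ m) {K : ℝ≥0}
    (hK : ∀ (m₀ : MeasurableSpace Ω), m₀ ≤ mΩ → ∀ X Y : Ω → ℝ, StronglyMeasurable[m₀] X →
      MemLp X (ENNReal.ofReal m) μ → MemLp Y (ENNReal.ofReal m) μ → μ[Y | m₀] =ᵐ[μ] 0 →
      eLpNorm (X + Y) (ENNReal.ofReal m) μ ^ 2 ≤
        eLpNorm X (ENNReal.ofReal m) μ ^ 2 + K * eLpNorm Y (ENNReal.ofReal m) μ ^ 2)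
    (hα : 1 ≤ 2 * α) (hβ : 1 ≤ β) {w : ℝ → ℝ → ℝ≥0∞} (hw : IsRightControl w T)
    (hξ : IsGerm μ ℱ T m ξ) {K₁ K₂ : ℝ≥0∞} {τ : ℕ → ℝ} {lo hi : ℕ}
    (hτ : ∀ j l, lo ≤ j → j ≤ l → l ≤ hi → τ j ≤ τ l) (h0 : 0 ≤ τ lo) (hT : τ hi ≤ T)
    (H : ∀ i j k, lo ≤ i → i ≤ j → j ≤ k → k ≤ hi →
      eLpNorm (delta ξ (τ i) (τ j) (τ k)) (ENNReal.ofReal m) μ ≤ K₁ * w (τ i) (τ k) ^ α ∧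
      eLpNorm (μ[delta ξ (τ i) (τ j) (τ k) | ℱ (τ i)]) (ENNReal.ofReal m) μ ≤
        K₂ * w (τ i) (τ k) ^ β) (n : ℕ) :
    ∀ i k, lo ≤ i → i ≤ k → k ≤ hi → k ≤ i + n →
      HasScaleDecomp μ ℱ m α β (2 * K₂) (16 * K * K₁ ^ 2) n (τ i) (τ k)
        (ξ (τ i) (τ k) - ∑ l ∈ Finset.Ico i k, ξ (τ l) (τ (l + 1))) (w (τ i) (τ k)) := by
  have hp1 : 1 ≤ ENNReal.ofReal m := by simp; linarith
  have hτ0 : ∀ j, lo ≤ j → j ≤ hi → 0 ≤ τ j ∧ τ j ≤ T := fun j h1 h2 =>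
    ⟨h0.trans (hτ lo j le_rfl h1 h2), (hτ j hi h1 h2 le_rfl).trans hT⟩
  induction n with
  | zero =>
    intro i k h1 h2 h3 h4
    obtain rfl : i = k := by omega
    simp only [Finset.Ico_self, Finset.sum_empty, sub_zero, hξ.self _ (hτ0 i h1 h3).1
      (hτ0 i h1 h3).2]
    exact HasScaleDecomp.zero
  | succ n ih =>
    intro i k h1 h2 h3 h4
    rcases h2.eq_or_lt with rfl | hik
    · simp only [Finset.Ico_self, Finset.sum_empty, sub_zero, hξ.self _ (hτ0 i h1 h3).1
        (hτ0 i h1 h3).2]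
      exact HasScaleDecomp.zero
    have hi0 := hτ0 i h1 (h2.trans h3)
    have hk0 := hτ0 k (h1.trans h2) h3
    obtain ⟨j, hij, hjk, hs1, hs2⟩ := exists_split hw hik
      (fun j l g1 g2 g3 => hτ j l (h1.trans g1) g2 (g3.trans h3)) hi0.1 hk0.2
    have hj0 := hτ0 j (h1.trans hij) (hjk.le.trans h3)
    have hτij := hτ i j h1 hij (hjk.le.trans h3)
    have hτj := hτ j (j + 1) (by omega) (by omega) (by omega)
    have hτjk := hτ (j + 1) k (by omega) hjk h3
    have hL := (ih i j h1 hij (hjk.le.trans h3) (by omega)).mono (by linarith) (by linarith) hs1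
    have hR := (ih (j + 1) k (by omega) hjk h3 (by omega)).mono (by linarith) (by linarith) hs2
    set D₁ := delta ξ (τ i) (τ j) (τ k) with hD₁
    set D₂ := delta ξ (τ j) (τ (j + 1)) (τ k) with hD₂
    have mD₁ : MemLp D₁ (ENNReal.ofReal m) μ :=
      hξ.memLp_delta hi0.1 hτij (hτj.trans hτjk) hk0.2
    have mD₂ : MemLp D₂ (ENNReal.ofReal m) μ := hξ.memLp_delta hj0.1 hτj hτjk hk0.2
    have b₁ := H i j k h1 hij hjk.le h3
    have b₂ := H j (j + 1) k (by omega) (by omega) hjk h3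
    have hwjk : w (τ j) (τ k) ≤ w (τ i) (τ k) :=
      hw.mono hi0.1 hτij (hτj.trans hτjk) le_rfl hk0.2
    have hD : eLpNorm (D₁ + D₂) (ENNReal.ofReal m) μ ≤ 2 * K₁ * w (τ i) (τ k) ^ α := by
      refine (eLpNorm_add_le mD₁.1 mD₂.1 hp1).trans ((add_le_add b₁.1 b₂.1).trans ?_)
      rw [mul_assoc, two_mul]
      gcongr
      linarith
    have hE : eLpNorm (μ[D₁ + D₂ | ℱ (τ i)]) (ENNReal.ofReal m) μ ≤
        2 * K₂ * w (τ i) (τ k) ^ β := by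
      have e1 : μ[D₁ + D₂ | ℱ (τ i)] =ᵐ[μ] μ[D₁ | ℱ (τ i)] + μ[D₂ | ℱ (τ i)] :=
        condExp_add (mD₁.integrable hp1) (mD₂.integrable hp1) _
      have e2 : μ[μ[D₂ | ℱ (τ j)] | ℱ (τ i)] =ᵐ[μ] μ[D₂ | ℱ (τ i)] :=
        condExp_condExp_of_le (ℱ.mono hτij) (ℱ.le _)
      rw [eLpNorm_congr_ae e1]
      refine (eLpNorm_add_le (mD₁.condExp hp1).1 (mD₂.condExp hp1).1 hp1).trans ?_
      rw [← eLpNorm_congr_ae e2, mul_assoc, two_mul]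
      refine add_le_add b₁.2 ((eLpNorm_condExp_le_eLpNorm _ hp1).trans (b₂.2.trans ?_))
      gcongr
    have hDm : StronglyMeasurable[ℱ (τ k)] (D₁ + D₂) :=
      (hξ.meas_delta hi0.1 hτij (hτj.trans hτjk) hk0.2).add
        (hξ.meas_delta hj0.1 hτj hτjk hk0.2)
    have mD := mD₁.add mD₂
    have hM : IsSqIncrement μ m (ℱ (τ i)) (ℱ (τ k)) (D₁ + D₂ - μ[D₁ + D₂ | ℱ (τ i)])
        (16 * K * K₁ ^ 2 * w (τ i) (τ k) ^ (2 * α)) := by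
      refine ⟨hDm.sub (stronglyMeasurable_condExp.mono (ℱ.mono (hτij.trans (hτj.trans hτjk)))),
        mD.sub (mD.condExp hp1), fun V hV hV' => ?_⟩
      refine (hK _ (ℱ.le _) V _ hV hV' (mD.sub (mD.condExp hp1)) ?_).trans ?_
      · refine (condExp_sub (mD.integrable hp1) integrable_condExp _).trans ?_
        have : μ[μ[D₁ + D₂ | ℱ (τ i)] | ℱ (τ i)] = μ[D₁ + D₂ | ℱ (τ i)] :=
          condExp_of_stronglyMeasurable (ℱ.le _) stronglyMeasurable_condExp integrable_condExp
        rw [this, sub_self]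
      · refine add_le_add le_rfl ?_
        have h5 : eLpNorm (D₁ + D₂ - μ[D₁ + D₂ | ℱ (τ i)]) (ENNReal.ofReal m) μ ≤
            4 * K₁ * w (τ i) (τ k) ^ α := by
          refine (eLpNorm_sub_le mD.1 (mD.condExp hp1).1 hp1).trans ?_
          refine (add_le_add hD ((eLpNorm_condExp_le_eLpNorm _ hp1).trans hD)).trans (le_of_eq ?_)
          ring
        calc (K : ℝ≥0∞) * eLpNorm (D₁ + D₂ - μ[D₁ + D₂ | ℱ (τ i)]) (ENNReal.ofReal m) μ ^ 2
            ≤ K * (4 * K₁ * w (τ i) (τ k) ^ α) ^ 2 := by gcongr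
          _ = 16 * K * K₁ ^ 2 * w (τ i) (τ k) ^ (2 * α) := by
            rw [mul_comm 2 α, ENNReal.rpow_mul, ENNReal.rpow_two]
            ring
    have key := HasScaleDecomp.step hm hα hβ hτij hτj hτjk hL hR
      (mD.condExp hp1).1 hE hM
    convert key using 1
    rw [add_sub_cancel, ← Finset.sum_Ico_consecutive _ hij hjk.le,
      Finset.sum_eq_sum_Ico_succ_bot hjk, hD₁, hD₂, delta, delta]
    abel

/-- Comparison of the sums over a partition and a refinement of it. The germ only needs to be
controlled on triples that lie in a single interval of the coarser partition. -/
lemma exists_refinement_bound (μ : Measure Ω) [IsProbabilityMeasure μ] (hm : 2 ≤ m)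
    (hα : 1 / 2 < α) (hβ : 1 < β) :
    ∃ C : ℝ≥0∞, C < ∞ ∧ ∀ (ℱ : Filtration ℝ mΩ) (T : ℝ) (w : ℝ → ℝ → ℝ≥0∞) (ξ : ℝ → ℝ → Ω → ℝ)
      (K₁ K₂ : ℝ≥0∞) (s t : ℝ) (P P' : Partition s t),
      IsRightControl w T → IsGerm μ ℱ T m ξ → 0 ≤ s → t ≤ T → P.points ⊆ P'.points →
      (∀ x y z, s ≤ x → x ≤ y → y ≤ z → z ≤ t → (∀ v ∈ P.points, v ∉ Ioo x z) →
        eLpNorm (delta ξ x y z) (ENNReal.ofReal m) μ ≤ K₁ * w x z ^ α ∧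
        eLpNorm (μ[delta ξ x y z | ℱ x]) (ENNReal.ofReal m) μ ≤ K₂ * w x z ^ β) →
      eLpNorm (P.sum ξ - P'.sum ξ) (ENNReal.ofReal m) μ ≤
        C * (K₂ * w s t ^ β + K₁ * w s t ^ α) := by
  obtain ⟨K, hK⟩ := exists_eLpNorm_add_sq_le (μ := μ) hm
  have two_lt : ∀ e : ℝ, e < 0 → (2 : ℝ≥0∞) ^ e < 1 := fun e he =>
    ENNReal.rpow_lt_one_of_one_lt_of_neg (by norm_num) he
  set C₁ : ℝ≥0∞ := 2 * (1 - 2 ^ (1 - β))⁻¹ with hC₁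
  set C₂ : ℝ≥0∞ := (16 * K) ^ (1 / 2 : ℝ) * (1 - 2 ^ ((1 - 2 * α) / 2))⁻¹ with hC₂
  have hC₁' : C₁ < ∞ := ENNReal.mul_lt_top (by simp)
    (ENNReal.inv_lt_top.2 (tsub_pos_of_lt (two_lt _ (by linarith))))
  have hC₂' : C₂ < ∞ := ENNReal.mul_lt_top
    (ENNReal.rpow_lt_top_of_nonneg (by norm_num)
      (ENNReal.mul_ne_top (by simp) ENNReal.coe_ne_top))
    (ENNReal.inv_lt_top.2 (tsub_pos_of_lt (two_lt _ (by linarith))))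
  refine ⟨C₁ + C₂, ENNReal.add_lt_top.2 ⟨hC₁', hC₂'⟩,
    fun ℱ T w ξ K₁ K₂ s t P P' hw hξ h0 hT hPP' H => ?_⟩
  obtain ⟨κ, κ0, κn, κmono, κle, κpts⟩ := Partition.exists_index_of_subset hPP'
  have hcell : ∀ j < P.n, HasScaleDecomp μ ℱ m α β (2 * K₂) (16 * K * K₁ ^ 2) P'.n
      (P.pts j) (P.pts (j + 1)) (ξ (P.pts j) (P.pts (j + 1)) -
        ∑ l ∈ Finset.Ico (κ j) (κ (j + 1)), ξ (P'.pts l) (P'.pts (l + 1)))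
      (w (P.pts j) (P.pts (j + 1))) := fun j hj => by
    have h1 := κle (j + 1) hj
    have := hasScaleDecomp_of_bounds (ℱ := ℱ) hm hK (by linarith : 1 ≤ 2 * α) hβ.le hw hξ
      (K₁ := K₁) (K₂ := K₂) (τ := P'.pts) (lo := κ j) (hi := κ (j + 1))
      (fun i l _ g2 g3 => P'.pts_le_pts g2 (g3.trans h1))
      (h0.trans (P'.le_pts (κle j hj.le))) ((P'.pts_le h1).trans hT) ?_ P'.n (κ j) (κ (j + 1))
      le_rfl (κmono j hj) le_rfl (by omega)
    · rwa [κpts j hj.le, κpts (j + 1) hj] at this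
    · intro i l k g1 g2 g3 g4
      have hk := g4.trans h1
      refine H _ _ _ (P'.le_pts (by omega)) (P'.pts_le_pts g2 (g3.trans hk))
        (P'.pts_le_pts g3 hk) (P'.pts_le hk) fun v hv hv' => ?_
      obtain ⟨e, he, rfl⟩ := P.mem_points.1 hv
      have f1 : P.pts j < P.pts e := by
        rw [← κpts j hj.le]
        exact (P'.pts_le_pts g1 (g2.trans (g3.trans hk))).trans_lt hv'.1
      have f2 : P.pts e < P.pts (j + 1) := by
        rw [← κpts (j + 1) hj]
        exact hv'.2.trans_le (P'.pts_le_pts g4 h1)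
      have := P.lt_of_pts_lt hj.le f1
      have := P.lt_of_pts_lt he f2
      omega
  have hall : ∀ j ≤ P.n, HasScaleDecomp μ ℱ m α β (2 * K₂) (16 * K * K₁ ^ 2) P'.n
      s (P.pts j) (∑ i ∈ Finset.range j, ξ (P.pts i) (P.pts (i + 1)) -
        ∑ l ∈ Finset.range (κ j), ξ (P'.pts l) (P'.pts (l + 1))) (w s (P.pts j)) := by
    intro j
    induction j with
    | zero =>
      intro _
      simp only [Finset.range_zero, Finset.sum_empty, κ0, sub_zero]
      exact HasScaleDecomp.zero
    | succ j ih =>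
      intro hj
      have hle : P.pts j ≤ P.pts (j + 1) := (P.pts_lt j hj).le
      have := (HasScaleDecomp.add hm (by linarith) hβ.le (P.le_pts (by omega)) hle
        (ih (by omega)) (hcell j hj)).mono (by linarith) (by linarith)
        (hw.superadd _ _ _ h0 (P.le_pts (by omega)) hle ((P.pts_le hj).trans hT))
      convert this using 1
      rw [Finset.sum_range_succ, ← Finset.sum_range_add_sum_Ico _ (κmono j hj)]
      abel
  have hfin := (hall P.n le_rfl).eLpNorm_le hm
  rw [P.pts_last, κn] at hfin
  refine hfin.trans ?_
  rw [ENNReal.mul_rpow_of_nonneg _ _ (by norm_num), ← ENNReal.rpow_two, ← ENNReal.rpow_mul,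
    mul_one_div_cancel two_ne_zero, ENNReal.rpow_one]
  calc 2 * K₂ * (1 - 2 ^ (1 - β))⁻¹ * w s t ^ β +
        (16 * K) ^ (1 / 2 : ℝ) * K₁ * (1 - 2 ^ ((1 - 2 * α) / 2))⁻¹ * w s t ^ α
      = C₁ * (K₂ * w s t ^ β) + C₂ * (K₁ * w s t ^ α) := by rw [hC₁, hC₂]; ring
    _ ≤ (C₁ + C₂) * (K₂ * w s t ^ β) + (C₁ + C₂) * (K₁ * w s t ^ α) := by
      gcongr
      · exact le_self_add
      · exact le_add_self
    _ = _ := by ring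

end Sewing

/-! ### The stochastic sewing lemma with jumps -/

section SewingLimit

variable {Ω : Type*} {mΩ : MeasurableSpace Ω} {μ : Measure Ω}
  {ℱ : Filtration ℝ mΩ} {m e T : ℝ} {w : ℝ → ℝ → ℝ≥0∞} {ξ : ℝ → ℝ → Ω → ℝ} {K : ℝ≥0∞}

/-- The hypotheses of the stochastic sewing lemma with jumps. The factor depending on `[s, u]` and
the one depending on `[u, t]` are kept apart: each of them vanishes when its interval shrinks to
the right of a point, which is what yields limits along vanishing mesh size in the presence of
jumps. -/
structure IsSewable (μ : Measure Ω) (ℱ : Filtration ℝ mΩ) (T m e : ℝ) (w : ℝ → ℝ → ℝ≥0∞)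
    (K : ℝ≥0∞) (ξ : ℝ → ℝ → Ω → ℝ) : Prop where
  germ : IsGerm μ ℱ T m ξ
  bound : ∀ s u t, 0 ≤ s → s ≤ u → u ≤ t → t ≤ T →
    eLpNorm (delta ξ s u t) (ENNReal.ofReal m) μ ≤ K * (w s u ^ e * w u t ^ e)
  condExp_bound : ∀ s u t, 0 ≤ s → s ≤ u → u ≤ t → t ≤ T →
    eLpNorm (μ[delta ξ s u t | ℱ s]) (ENNReal.ofReal m) μ ≤
      K * (w s u ^ e * w u t ^ (2 * e) + w s u ^ (2 * e) * w u t ^ e)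

/-- The sums over partitions of `[s, t]` stay close to the germ. -/
lemma IsSewable.exists_sum_bound [IsProbabilityMeasure μ] (hm : 2 ≤ m) (he : 1 / 3 < e) (hK : K < ∞)
    (hw : IsRightControl w T) (hξ : IsSewable μ ℱ T m e w K ξ) :
    ∃ C : ℝ≥0∞, C < ∞ ∧ ∀ s t, 0 ≤ s → t ≤ T → ∀ P : Partition s t,
      eLpNorm (ξ s t - P.sum ξ) (ENNReal.ofReal m) μ ≤ C * w s t ^ (2 * e) := by
  obtain ⟨C, hC, H⟩ := exists_refinement_bound μ hm (α := 2 * e) (β := 3 * e) (by linarith)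
    (by linarith)
  refine ⟨C * (2 * K * w 0 T ^ e + K), ENNReal.mul_lt_top hC (ENNReal.add_lt_top.2
    ⟨ENNReal.mul_lt_top (ENNReal.mul_lt_top (by simp) hK)
      (ENNReal.rpow_lt_top_of_nonneg (by linarith) hw.lt_top.ne), hK⟩), fun s t h0 hT P => ?_⟩
  -- Compare `P` with the partition into a single interval; the jumps play no role here, so the
  -- values of `w` in the bounds may all be replaced by the one on the whole interval.
  rcases P.left_le_right.eq_or_lt with rfl | hst
  · rw [P.sum_self, hξ.germ.self s h0 hT]
    simp
  have h := H ℱ T w ξ K (2 * K) s t (Partition.single P.left_le_right) P hw hξ.germ h0 hT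
    P.points_single_subset fun x y z h1 h2 h3 h4 _ => ?_
  · rw [Partition.sum_single hst] at h
    refine h.trans ?_
    have h5 : w s t ^ (3 * e) ≤ w 0 T ^ e * w s t ^ (2 * e) := by
      rw [show 3 * e = e + 2 * e by ring, ENNReal.rpow_add_of_nonneg _ _ (by linarith)
        (by linarith)]
      gcongr
      exact hw.mono le_rfl h0 hst.le hT le_rfl
    calc C * (2 * K * w s t ^ (3 * e) + K * w s t ^ (2 * e))
        ≤ C * (2 * K * (w 0 T ^ e * w s t ^ (2 * e)) + K * w s t ^ (2 * e)) := by gcongr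
      _ = _ := by ring
  · have hx : 0 ≤ x := h0.trans h1
    have hz : z ≤ T := h4.trans hT
    have w1 : w x y ≤ w x z := hw.mono hx le_rfl h2 h3 hz
    have w2 : w y z ≤ w x z := hw.mono hx h2 h3 le_rfl hz
    refine ⟨(hξ.bound x y z hx h2 h3 hz).trans ?_, (hξ.condExp_bound x y z hx h2 h3 hz).trans ?_⟩
    · rw [two_mul, ENNReal.rpow_add_of_nonneg _ _ (by linarith) (by linarith)]
      gcongr
    · rw [mul_comm 2 K, mul_assoc, two_mul (w x z ^ (3 * e))]
      have e1 : w x z ^ (3 * e) = w x z ^ e * w x z ^ (2 * e) := by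
        rw [← ENNReal.rpow_add_of_nonneg _ _ (by linarith) (by linarith)]
        ring_nf
      have e2 : w x z ^ (3 * e) = w x z ^ (2 * e) * w x z ^ e := by rw [e1, mul_comm]
      gcongr
      · rw [e1]; gcongr
      · rw [e2]; gcongr

/-- A small factor `x` may be traded for a power of `η`; the alternative `y = 0` makes the left side
vanish. -/
lemma rpow_mul_rpow_le {x y z η : ℝ≥0∞} {a b κ : ℝ} (hκ : 0 ≤ κ) (hκa : κ ≤ a) (hb : 0 < b)
    (hxz : x ≤ z) (hyz : y ≤ z) (h : x ≤ η ∨ y = 0) : x ^ a * y ^ b ≤ η ^ κ * z ^ (a + b - κ) := by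
  rcases h with h | rfl
  · have e1 : x ^ a = x ^ κ * x ^ (a - κ) := by
      rw [← ENNReal.rpow_add_of_nonneg _ _ hκ (by linarith)]
      ring_nf
    rw [e1, mul_assoc, show a + b - κ = (a - κ) + b by ring,
      ENNReal.rpow_add_of_nonneg _ _ (by linarith) hb.le]
    gcongr
  · simp [ENNReal.zero_rpow_of_pos hb]

/-- Beyond a partition on whose intervals the control is small, away from the right end points,
refining no longer matters. -/
lemma IsSewable.exists_refine_bound [IsProbabilityMeasure μ] (hm : 2 ≤ m) (he : 1 / 3 < e)
    (he' : e ≤ 1 / 2) (hK : K < ∞) (hw : IsRightControl w T) (hξ : IsSewable μ ℱ T m e w K ξ) :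
    ∃ C : ℝ≥0∞, C < ∞ ∧ ∀ (η : ℝ≥0∞) (s t : ℝ), 0 ≤ s → t ≤ T → ∀ P P' : Partition s t,
      P.points ⊆ P'.points →
      (∀ x y, s ≤ x → x ≤ y → y ≤ t → (∀ v ∈ P.points, v ∉ Ioc x y) → w x y ≤ η) →
      eLpNorm (P.sum ξ - P'.sum ξ) (ENNReal.ofReal m) μ ≤ C * η ^ ((3 * e - 1) / 2) := by
  -- The exponent `κ` of `η` is chosen so as to leave `2e - κ > 1/2` and `3e - κ > 1`.
  set κ := (3 * e - 1) / 2 with hκ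
  have hκ0 : 0 ≤ κ := by rw [hκ]; linarith
  have hκe : κ ≤ e := by rw [hκ]; linarith
  obtain ⟨C, hC, H⟩ := exists_refinement_bound μ hm (α := e + e - κ) (β := e + 2 * e - κ)
    (by rw [hκ]; linarith) (by rw [hκ]; linarith)
  have hfin : ∀ a : ℝ, 0 ≤ a → w 0 T ^ a < ∞ := fun a ha =>
    ENNReal.rpow_lt_top_of_nonneg ha hw.lt_top.ne
  refine ⟨C * (2 * K * w 0 T ^ (e + 2 * e - κ) + K * w 0 T ^ (e + e - κ)),
    ENNReal.mul_lt_top hC (ENNReal.add_lt_top.2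
    ⟨ENNReal.mul_lt_top (ENNReal.mul_lt_top (by simp) hK) (hfin _ (by linarith)),
      ENNReal.mul_lt_top hK (hfin _ (by linarith))⟩), fun η s t h0 hT P P' hPP' hη => ?_⟩
  have hst := P.left_le_right
  refine (H ℱ T w ξ (K * η ^ κ) (2 * K * η ^ κ) s t P P' hw hξ.germ h0 hT hPP'
    fun x y z h1 h2 h3 h4 hv => ?_).trans ?_
  · have hx : 0 ≤ x := h0.trans h1
    have hz : z ≤ T := h4.trans hT
    have w1 : w x y ≤ w x z := hw.mono hx le_rfl h2 h3 hz
    have w2 : w y z ≤ w x z := hw.mono hx h2 h3 le_rfl hz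
    have hor : w x y ≤ η ∨ w y z = 0 := by
      rcases h3.eq_or_lt with rfl | h3'
      · exact Or.inr (hw.self_eq_zero (hx.trans h2) hz)
      · exact Or.inl (hη x y h1 h2 (h3.trans h4) fun v hv1 hv2 =>
          hv v hv1 ⟨hv2.1, hv2.2.trans_lt h3'⟩)
    refine ⟨(hξ.bound x y z hx h2 h3 hz).trans ?_, (hξ.condExp_bound x y z hx h2 h3 hz).trans ?_⟩
    · rw [mul_assoc]
      exact mul_le_mul_right (rpow_mul_rpow_le hκ0 hκe (by linarith) w1 w2 hor) _
    · have e1 := rpow_mul_rpow_le (a := e) hκ0 hκe (b := 2 * e) (by linarith) w1 w2 hor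
      have e2 := rpow_mul_rpow_le (a := 2 * e) hκ0 (by linarith) (b := e) (by linarith) w1 w2 hor
      rw [show 2 * e + e - κ = e + 2 * e - κ by ring] at e2
      calc K * (w x y ^ e * w y z ^ (2 * e) + w x y ^ (2 * e) * w y z ^ e)
          ≤ K * (η ^ κ * w x z ^ (e + 2 * e - κ) + η ^ κ * w x z ^ (e + 2 * e - κ)) := by
            gcongr
        _ = _ := by ring
  · have hw0 : w s t ≤ w 0 T := hw.mono le_rfl h0 hst hT le_rfl
    calc C * (2 * K * η ^ κ * w s t ^ (e + 2 * e - κ) + K * η ^ κ * w s t ^ (e + e - κ))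
        ≤ C * (2 * K * η ^ κ * w 0 T ^ (e + 2 * e - κ) + K * η ^ κ * w 0 T ^ (e + e - κ)) := by
          gcongr <;> linarith
      _ = _ := by ring

/-- Inserting finitely many given points into a partition of small mesh size hardly changes the
sums: an inserted point `u` costs `δξ_{a,u,b}` with `b` close to `u` on the right. -/
lemma IsSewable.exists_insert_bound (hm : 2 ≤ m) (he : 0 < e) (hK : K < ∞)
    (hw : IsRightControl w T) (hξ : IsSewable μ ℱ T m e w K ξ) {s t : ℝ} (h0 : 0 ≤ s) (hT : t ≤ T)
    (Q : Finset ℝ) {ε : ℝ≥0∞} (hε : 0 < ε) :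
    ∃ δ : ℝ≥0, 0 < δ ∧ ∀ P : Partition s t, P.mesh ≤ δ → ∃ P' : Partition s t,
      P.points ⊆ P'.points ∧ (∀ x ∈ Q, x ∈ Icc s t → x ∈ P'.points) ∧ P'.mesh ≤ P.mesh ∧
      eLpNorm (P.sum ξ - P'.sum ξ) (ENNReal.ofReal m) μ ≤ ε := by
  classical
  induction Q using Finset.induction_on generalizing ε with
  | empty => exact ⟨1, one_pos, fun P _ => ⟨P, subset_rfl, by simp, le_rfl, by simp⟩⟩
  | insert u Q _ ih =>
    obtain ⟨δ₁, hδ₁, H⟩ := ih (ENNReal.half_pos hε.ne')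
    have hsmall : ∃ δ₂ : ℝ≥0, 0 < δ₂ ∧ ∀ a b, s ≤ a → a < u → u < b → b ≤ t → b - u ≤ δ₂ →
        eLpNorm (delta ξ a u b) (ENNReal.ofReal m) μ ≤ ε / 2 := by
      by_cases hu : 0 ≤ u ∧ u < T
      swap
      · refine ⟨1, one_pos, fun a b g1 g2 g3 g4 _ => absurd ⟨?_, ?_⟩ hu⟩
        · exact h0.trans (g1.trans g2.le)
        · exact g3.trans_le (g4.trans hT)
      have hlim : Tendsto (fun b => K * (w 0 T ^ e * w u b ^ e)) (𝓝[>] u) (𝓝 0) := by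
        have h1 := (ENNReal.continuous_rpow_const (y := e)).tendsto 0 |>.comp (hw.right u hu)
        rw [ENNReal.zero_rpow_of_pos he] at h1
        have h2 := ENNReal.Tendsto.const_mul (a := w 0 T ^ e) h1
          (Or.inr (ENNReal.rpow_lt_top_of_nonneg he.le hw.lt_top.ne).ne)
        have h3 := ENNReal.Tendsto.const_mul (a := K) h2 (Or.inr hK.ne)
        simpa using h3
      obtain ⟨c, hc, hc'⟩ := (mem_nhdsGT_iff_exists_Ioc_subset).1
        (hlim.eventually (eventually_le_nhds (ENNReal.half_pos hε.ne')))
      have hc : u < c := hc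
      refine ⟨Real.toNNReal (c - u), Real.toNNReal_pos.2 (sub_pos.2 hc),
        fun a b g1 g2 g3 g4 g5 => ?_⟩
      have ha : 0 ≤ a := h0.trans g1
      have hbc : b ≤ c := by
        rw [Real.coe_toNNReal _ (sub_pos.2 hc).le] at g5
        linarith
      refine (hξ.bound a u b ha g2.le g3.le (g4.trans hT)).trans ?_
      refine le_trans ?_ (hc' ⟨g3, hbc⟩)
      have : w a u ≤ w 0 T := hw.mono le_rfl ha g2.le (g3.le.trans (g4.trans hT)) le_rfl
      gcongr
    obtain ⟨δ₂, hδ₂, H₂⟩ := hsmall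
    refine ⟨min δ₁ δ₂, lt_min hδ₁ hδ₂, fun P hP => ?_⟩
    obtain ⟨P₁, p1, p2, p3, p4⟩ := H P (hP.trans (min_le_left _ _))
    by_cases hu : u ∈ Icc s t
    · obtain ⟨P₂, r1, r2, r3, r4⟩ := Partition.exists_insert (M := Ω → ℝ) P₁ hu
      refine ⟨P₂, p1.trans r1, fun x hx hx' => ?_, r3.trans p3, ?_⟩
      · rcases Finset.mem_insert.1 hx with rfl | hx
        · exact r2
        · exact r1 (p2 x hx hx')
      · rcases r4 with r4 | ⟨a, b, g1, g2, g3, g4, g5, g6⟩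
        · rw [r4 ξ]
          exact p4.trans ENNReal.half_le_self
        · rw [← sub_add_sub_cancel (P.sum ξ) (P₁.sum ξ), ← ENNReal.add_halves ε]
          have m1 := hξ.germ.memLp_sum h0 hT P
          have m2 := hξ.germ.memLp_sum h0 hT P₁
          have m3 := hξ.germ.memLp_sum h0 hT P₂
          refine (eLpNorm_add_le (m1.sub m2).1 (m2.sub m3).1 (by simp; linarith)).trans
            (add_le_add p4 ?_)
          rw [g6 ξ]
          refine H₂ a b g1 g2 g3 g4 (g5.trans ?_)
          exact_mod_cast p3.trans (hP.trans (min_le_right _ _))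
    · refine ⟨P₁, p1, fun x hx hx' => ?_, p3, p4.trans ENNReal.half_le_self⟩
      rcases Finset.mem_insert.1 hx with rfl | hx
      · exact absurd hx' hu
      · exact p2 x hx hx'

/-- The sums over two partitions of small mesh size are close: insert into both the finitely many
times outside of which the control is small, then pass to a common refinement. -/
lemma IsSewable.exists_cauchy [IsProbabilityMeasure μ] (hm : 2 ≤ m) (he : 1 / 3 < e)
    (he' : e ≤ 1 / 2) (hK : K < ∞) (hw : IsRightControl w T) (hξ : IsSewable μ ℱ T m e w K ξ)
    {s t : ℝ} (h0 : 0 ≤ s) (hst : s ≤ t) (hT : t ≤ T) {ε : ℝ≥0∞} (hε : 0 < ε) :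
    ∃ δ : ℝ≥0, 0 < δ ∧ ∀ P P' : Partition s t, P.mesh ≤ δ → P'.mesh ≤ δ →
      eLpNorm (P.sum ξ - P'.sum ξ) (ENNReal.ofReal m) μ ≤ ε := by
  have hp1 : 1 ≤ ENNReal.ofReal m := by simp; linarith
  obtain ⟨C, hC, HC⟩ := hξ.exists_refine_bound hm he he' hK hw
  have hε2 : 0 < ε / 2 := ENNReal.half_pos hε.ne'
  have hε4 : 0 < ε / 2 / 2 := ENNReal.half_pos hε2.ne'
  obtain ⟨η, hη, hηε⟩ : ∃ η : ℝ≥0∞, 0 < η ∧ C * η ^ ((3 * e - 1) / 2) ≤ ε / 2 / 2 := by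
    have hlim : Tendsto (fun η : ℝ≥0∞ => C * η ^ ((3 * e - 1) / 2)) (𝓝[>] 0) (𝓝 0) := by
      have h1 := (ENNReal.continuous_rpow_const (y := (3 * e - 1) / 2)).tendsto 0
      rw [ENNReal.zero_rpow_of_pos (by linarith)] at h1
      have h2 := ENNReal.Tendsto.const_mul (a := C) h1 (Or.inr hC.ne)
      rw [mul_zero] at h2
      exact h2.mono_left nhdsWithin_le_nhds
    obtain ⟨η, h1, h2⟩ := ((hlim.eventually (eventually_le_nhds hε4)).and
      self_mem_nhdsWithin).exists
    exact ⟨η, h2, h1⟩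
  obtain ⟨Q, hQ, hQ'⟩ := hw.exists_finset (h0.trans (hst.trans hT)) hη
  obtain ⟨δ, hδ, H⟩ := hξ.exists_insert_bound hm (by linarith) hK hw h0 hT Q hε4
  refine ⟨δ, hδ, fun P P' hP hP' => ?_⟩
  obtain ⟨P₁, p1, p2, -, p4⟩ := H P hP
  obtain ⟨P₁', p1', p2', -, p4'⟩ := H P' hP'
  obtain ⟨R, r1, r2, -⟩ := P₁.exists_refine P₁'.points fun u hu => by
    obtain ⟨i, hi, rfl⟩ := P₁'.mem_points.1 hu
    exact ⟨P₁'.le_pts hi, P₁'.pts_le hi⟩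
  have cell : ∀ S : Partition s t, (∀ x ∈ Q, x ∈ Icc s t → x ∈ S.points) → ∀ x y, s ≤ x → x ≤ y →
      y ≤ t → (∀ v ∈ S.points, v ∉ Ioc x y) → w x y ≤ η := fun S hS x y g1 g2 g3 g4 =>
    hQ' x y (h0.trans g1) g2 (g3.trans hT) fun v hv hv' =>
      g4 v (hS v hv ⟨g1.trans hv'.1.le, hv'.2.trans g3⟩) hv'
  have b1 := (HC η s t h0 hT P₁ R r1 (cell P₁ p2)).trans hηε
  have b2 := (HC η s t h0 hT P₁' R r2 (cell P₁' p2')).trans hηε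
  have mem := fun S : Partition s t => hξ.germ.memLp_sum h0 hT S
  have tri : ∀ S S' : Partition s t,
      eLpNorm (S.sum ξ - S'.sum ξ) (ENNReal.ofReal m) μ ≤ ε / 2 / 2 →
      eLpNorm (S'.sum ξ - R.sum ξ) (ENNReal.ofReal m) μ ≤ ε / 2 / 2 →
      eLpNorm (S.sum ξ - R.sum ξ) (ENNReal.ofReal m) μ ≤ ε / 2 := fun S S' g1 g2 => by
    rw [← sub_add_sub_cancel (S.sum ξ) (S'.sum ξ), ← ENNReal.add_halves (ε / 2)]
    exact (eLpNorm_add_le ((mem _).sub (mem _)).1 ((mem _).sub (mem _)).1 hp1).trans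
      (add_le_add g1 g2)
  have t1 := tri P P₁ p4 b1
  have t2 := tri P' P₁' p4' b2
  rw [← sub_add_sub_cancel (P.sum ξ) (R.sum ξ), ← ENNReal.add_halves ε]
  refine (eLpNorm_add_le ((mem _).sub (mem _)).1 ((mem _).sub (mem _)).1 hp1).trans
    (add_le_add t1 ?_)
  rwa [eLpNorm_sub_comm]

lemma IsSewable.exists_limit [IsProbabilityMeasure μ] (hm : 2 ≤ m) (he : 1 / 3 < e)
    (he' : e ≤ 1 / 2) (hK : K < ∞) (hw : IsRightControl w T) (hξ : IsSewable μ ℱ T m e w K ξ)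
    {t : ℝ} (h0 : 0 ≤ t) (hT : t ≤ T) :
    ∃ B : Ω → ℝ, StronglyMeasurable[ℱ t] B ∧ MemLp B (ENNReal.ofReal m) μ ∧
      Tendsto (fun P : Partition 0 t => eLpNorm (P.sum ξ - B) (ENNReal.ofReal m) μ)
        (meshFilter 0 t) (𝓝 0) := by
  have : Fact (1 ≤ ENNReal.ofReal m) := ⟨by simp; linarith⟩
  have : (meshFilter 0 t).NeBot := meshFilter_neBot h0
  have mem := fun P : Partition 0 t => hξ.germ.memLp_sum le_rfl hT P
  let S : Partition 0 t → Lp ℝ (ENNReal.ofReal m) μ := fun P => (mem P).toLp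
  have hcauchy : Cauchy (map S (meshFilter 0 t)) := by
    refine EMetric.cauchy_iff.2 ⟨(NeBot.map this S).ne, fun ε hε => ?_⟩
    obtain ⟨ε', hε', hεε'⟩ := exists_between hε
    obtain ⟨δ, hδ, H⟩ := hξ.exists_cauchy hm he he' hK hw le_rfl h0 hT hε'
    refine ⟨S '' {P | P.mesh ≤ δ}, image_mem_map (mem_meshFilter.2 ⟨δ, hδ, fun P hP => hP⟩), ?_⟩
    rintro _ ⟨P, hP, rfl⟩ _ ⟨P', hP', rfl⟩
    rw [Lp.edist_toLp_toLp]
    exact (H P P' hP hP').trans_lt hεε'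
  obtain ⟨f, hf⟩ := CompleteSpace.complete hcauchy
  have hf : Tendsto S (meshFilter 0 t) (𝓝 f) := hf
  have hmeas : AEStronglyMeasurable[ℱ t] (f : Ω → ℝ) μ := by
    have hcl := isClosed_aestronglyMeasurable (F := ℝ) (p := ENNReal.ofReal m) (μ := μ) (ℱ.le t)
    refine hcl.mem_of_tendsto hf (Eventually.of_forall fun P => ?_)
    exact ((hξ.germ.meas_sum le_rfl hT P).aestronglyMeasurable).congr (mem P).coeFn_toLp.symm
  have hae := hmeas.ae_eq_mk
  refine ⟨hmeas.mk f, hmeas.stronglyMeasurable_mk, (memLp_congr_ae hae).1 (Lp.memLp f), ?_⟩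
  have h1 := tendsto_iff_edist_tendsto_0.1 hf
  refine h1.congr fun P => ?_
  rw [Lp.edist_def]
  refine eLpNorm_congr_ae ?_
  filter_upwards [(mem P).coeFn_toLp, hae] with ω g1 g2
  simp only [Pi.sub_apply, S, g1, g2]

/-- The stochastic sewing lemma with jumps: the sums of the germ converge in `L^m` as the mesh size
vanishes, and the increments of the limit are close to the germ. -/
theorem IsSewable.exists_process [IsProbabilityMeasure μ] (hm : 2 ≤ m) (he : 1 / 3 < e)
    (he' : e ≤ 1 / 2) (hK : K < ∞) (hw : IsRightControl w T) (hξ : IsSewable μ ℱ T m e w K ξ) :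
    ∃ B : ℝ → Ω → ℝ, (∀ t ∈ Icc 0 T, StronglyMeasurable[ℱ t] (B t) ∧
        MemLp (B t) (ENNReal.ofReal m) μ ∧
        Tendsto (fun P : Partition 0 t => eLpNorm (P.sum ξ - B t) (ENNReal.ofReal m) μ)
          (meshFilter 0 t) (𝓝 0)) ∧
      ∃ C : ℝ≥0∞, C < ∞ ∧ ∀ s t, 0 ≤ s → s ≤ t → t ≤ T →
        eLpNorm (B t - B s - ξ s t) (ENNReal.ofReal m) μ ≤ C * w s t ^ (2 * e) := by
  have hp1 : 1 ≤ ENNReal.ofReal m := by simp; linarith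
  choose! B hB1 hB2 hB3 using fun t (ht : t ∈ Icc 0 T) =>
    hξ.exists_limit hm he he' hK hw ht.1 ht.2
  obtain ⟨C, hC, HC⟩ := hξ.exists_sum_bound hm he hK hw
  refine ⟨B, fun t ht => ⟨hB1 t ht, hB2 t ht, hB3 t ht⟩, C, hC, fun s t h0 hst hT => ?_⟩
  have hs : s ∈ Icc 0 T := ⟨h0, hst.trans hT⟩
  have ht : t ∈ Icc 0 T := ⟨h0.trans hst, hT⟩
  -- Approximate `B s` along `P` and `B t` along the concatenation of `P` and `Q`.
  refine ENNReal.le_of_forall_pos_le_add fun ε hε _ => ?_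
  have hε2 : (0 : ℝ≥0∞) < ε / 2 := ENNReal.half_pos (by exact_mod_cast hε.ne')
  obtain ⟨δ₁, hδ₁, H₁⟩ := mem_meshFilter.1 ((hB3 s hs).eventually (eventually_le_nhds hε2))
  obtain ⟨δ₂, hδ₂, H₂⟩ := mem_meshFilter.1 ((hB3 t ht).eventually (eventually_le_nhds hε2))
  obtain ⟨P, hP⟩ := Partition.exists_mesh_le h0 (lt_min hδ₁ hδ₂)
  obtain ⟨Q, hQ⟩ := Partition.exists_mesh_le hst (lt_min hδ₁ hδ₂)
  have b1 : eLpNorm (P.sum ξ - B s) (ENNReal.ofReal m) μ ≤ ε / 2 :=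
    H₁ P (hP.trans (min_le_left _ _))
  have b2 : eLpNorm ((P.concat Q).sum ξ - B t) (ENNReal.ofReal m) μ ≤ ε / 2 :=
    H₂ _ ((Partition.mesh_concat_le P Q hP hQ).trans (min_le_right _ _))
  have b3 := HC s t h0 hT Q
  have mP := hξ.germ.memLp_sum le_rfl (hst.trans hT) P
  have mQ := hξ.germ.memLp_sum h0 hT Q
  have mξ := hξ.germ.memLp s t h0 hst hT
  have mR := hξ.germ.memLp_sum le_rfl hT (P.concat Q)
  have heq : B t - B s - ξ s t = (P.sum ξ - B s) - ((P.concat Q).sum ξ - B t) -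
      (ξ s t - Q.sum ξ) := by
    rw [Partition.sum_concat]
    abel
  rw [heq]
  have m1 := mP.sub (hB2 s hs)
  have m2 := mR.sub (hB2 t ht)
  refine (eLpNorm_sub_le (m1.sub m2).1 (mξ.sub mQ).1 hp1).trans ?_
  rw [add_comm]
  refine add_le_add b3 ((eLpNorm_sub_le m1.1 m2.1 hp1).trans ((add_le_add b1 b2).trans ?_))
  rw [ENNReal.add_halves]

end SewingLimit

/-! ### The bracket of real controlled paths -/

section ScalarGerm

variable {Ω : Type*} {mΩ : MeasurableSpace Ω} {μ : Measure Ω} {ℱ : Filtration ℝ mΩ}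
  {p T q e : ℝ} {d : ℕ} {w : ℝ → ℝ → ℝ≥0∞} {C : ℝ≥0∞}

lemma RoughPath.XX_self (𝒳 : RoughPath p T d) {s : ℝ} (h0 : 0 ≤ s) (hT : s ≤ T) :
    𝒳.XX s s = 0 := by
  ext ij
  simpa using 𝒳.chen s s s h0 le_rfl le_rfl hT ij.1 ij.2

lemma holderTriple_half (hq : 0 < q) :
    ENNReal.HolderTriple (ENNReal.ofReal q) (ENNReal.ofReal q) (ENNReal.ofReal (q / 2)) := by
  refine ⟨?_⟩
  have hq2 : 0 < q / 2 := by linarith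
  have h0 : 0 ≤ q⁻¹ := by positivity
  rw [← ENNReal.ofReal_inv_of_pos hq, ← ENNReal.ofReal_inv_of_pos hq2, ← ENNReal.ofReal_add h0 h0,
    show q⁻¹ + q⁻¹ = (q / 2)⁻¹ by field_simp; norm_num]

lemma eLpNorm_mul_le_half (hq : 0 < q) {f g : Ω → ℝ} (hf : AEStronglyMeasurable f μ)
    (hg : AEStronglyMeasurable g μ) :
    eLpNorm (f * g) (ENNReal.ofReal (q / 2)) μ ≤
      eLpNorm f (ENNReal.ofReal q) μ * eLpNorm g (ENNReal.ofReal q) μ := by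
  have := holderTriple_half hq
  rw [← smul_eq_mul]
  exact eLpNorm_smul_le_mul_eLpNorm hg hf

lemma memLp_mul_half (hq : 0 < q) {f g : Ω → ℝ} (hf : MemLp f (ENNReal.ofReal q) μ)
    (hg : MemLp g (ENNReal.ofReal q) μ) : MemLp (f * g) (ENNReal.ofReal (q / 2)) μ := by
  have := holderTriple_half hq
  exact hg.mul (r := ENNReal.ofReal (q / 2)) hf

lemma eLpNorm_sum_smul_le {ι : Type*} [Fintype ι] {r : ℝ≥0∞} (hr : 1 ≤ r) {c : ι → ℝ}
    {f : ι → Ω → ℝ} {A B : ℝ≥0∞} (hc : ∀ i, ‖c i‖ₑ ≤ A) (hf : ∀ i, AEStronglyMeasurable (f i) μ)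
    (hfB : ∀ i, eLpNorm (f i) r μ ≤ B) :
    eLpNorm (∑ i, c i • f i) r μ ≤ Fintype.card ι * (A * B) := by
  refine (eLpNorm_sum_le (fun i _ => (hf i).const_smul (c i)) hr).trans ?_
  refine (Finset.sum_le_sum (g := fun _ => A * B) fun i _ => ?_).trans ?_
  · rw [eLpNorm_const_smul]
    exact mul_le_mul' (hc i) (hfB i)
  · simp

/-- A real stochastic controlled path with derivative components `y' i`, whose seminorms are
expressed through a common control `w`; here `e = 1 / p`. -/
structure IsScalarControlled (μ : Measure Ω) (ℱ : Filtration ℝ mΩ) (T q e : ℝ)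
    (w : ℝ → ℝ → ℝ≥0∞) (C : ℝ≥0∞) (X : ℝ → EuclideanSpace ℝ (Fin d)) (y : ℝ → Ω → ℝ)
    (y' : Fin d → ℝ → Ω → ℝ) : Prop where
  meas : ∀ t ∈ Icc 0 T, StronglyMeasurable[ℱ t] (y t)
  meas' : ∀ i, ∀ t ∈ Icc 0 T, StronglyMeasurable[ℱ t] (y' i t)
  memLp : ∀ t ∈ Icc 0 T, MemLp (y t) (ENNReal.ofReal q) μ
  memLp' : ∀ i, ∀ t ∈ Icc 0 T, MemLp (y' i t) (ENNReal.ofReal q) μ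
  bound' : ∀ i, ∀ t ∈ Icc 0 T, eLpNorm (y' i t) (ENNReal.ofReal q) μ ≤ C
  incr : ∀ s t, 0 ≤ s → s ≤ t → t ≤ T →
    eLpNorm (y t - y s) (ENNReal.ofReal q) μ ≤ C * w s t ^ e
  incr' : ∀ i, ∀ s t, 0 ≤ s → s ≤ t → t ≤ T →
    eLpNorm (y' i t - y' i s) (ENNReal.ofReal q) μ ≤ C * w s t ^ e
  rem : ∀ s t, 0 ≤ s → s ≤ t → t ≤ T →
    eLpNorm (μ[y t - y s - ∑ i, (X t i - X s i) • y' i s | ℱ s]) (ENNReal.ofReal q) μ ≤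
      C * w s t ^ (2 * e)

/-- The rough path is controlled by `w`. -/
structure IsRoughControl (𝒳 : RoughPath p T d) (e : ℝ) (w : ℝ → ℝ → ℝ≥0∞) (C : ℝ≥0∞) :
    Prop where
  incr : ∀ i, ∀ s t, 0 ≤ s → s ≤ t → t ≤ T → ‖𝒳.X t i - 𝒳.X s i‖ₑ ≤ C * w s t ^ e
  area : ∀ ij, ∀ s t, 0 ≤ s → s ≤ t → t ≤ T → ‖𝒳.XX s t ij‖ₑ ≤ C * w s t ^ (2 * e)

/-- The germ `δy δz - 2 (y' ⊗ z') Sym(𝕏)` of the bracket, in coordinates. -/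
def scalarGerm (𝒳 : RoughPath p T d) (y : ℝ → Ω → ℝ) (y' : Fin d → ℝ → Ω → ℝ)
    (z : ℝ → Ω → ℝ) (z' : Fin d → ℝ → Ω → ℝ) (s t : ℝ) : Ω → ℝ :=
  (y t - y s) * (z t - z s) -
    ∑ ij : Fin d × Fin d, (𝒳.XX s t ij + 𝒳.XX s t ij.swap) • (y' ij.1 s * z' ij.2 s)

/-- The part `δy_{su} δz_{ut} - (y'_s δX_{su}) (z'_s δX_{ut})` of `δξ_{sut}`. -/
def crossTerm (X : ℝ → EuclideanSpace ℝ (Fin d)) (y : ℝ → Ω → ℝ) (y' : Fin d → ℝ → Ω → ℝ)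
    (z : ℝ → Ω → ℝ) (z' : Fin d → ℝ → Ω → ℝ) (s u t : ℝ) : Ω → ℝ :=
  (y u - y s) * (z t - z u) -
    (∑ i, (X u i - X s i) • y' i s) * (∑ i, (X t i - X u i) • z' i s)

/-- By Chen's relation, the products `δX_{su} δX_{ut}` that `𝕏_{st}` contributes complete the mixed
products of `δy` and `δz` to the two cross terms. -/
lemma delta_scalarGerm (𝒳 : RoughPath p T d) (y : ℝ → Ω → ℝ) (y' : Fin d → ℝ → Ω → ℝ)
    (z : ℝ → Ω → ℝ) (z' : Fin d → ℝ → Ω → ℝ) {s u t : ℝ} (h0 : 0 ≤ s) (h1 : s ≤ u) (h2 : u ≤ t)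
    (h3 : t ≤ T) :
    delta (scalarGerm 𝒳 y y' z z') s u t =
      crossTerm 𝒳.X y y' z z' s u t + crossTerm 𝒳.X z z' y y' s u t +
      ∑ ij : Fin d × Fin d, (𝒳.XX u t ij + 𝒳.XX u t ij.swap) •
        (y' ij.1 u * z' ij.2 u - y' ij.1 s * z' ij.2 s) := by
  ext ω
  have e2 : (∑ i, (𝒳.X u i - 𝒳.X s i) * z' i s ω) * (∑ i, (𝒳.X t i - 𝒳.X u i) * y' i s ω) =
      (∑ i, (𝒳.X t i - 𝒳.X u i) * y' i s ω) * (∑ i, (𝒳.X u i - 𝒳.X s i) * z' i s ω) :=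
    mul_comm _ _
  simp only [delta, scalarGerm, crossTerm, Pi.sub_apply, Pi.add_apply, Pi.mul_apply,
    Finset.sum_apply, Pi.smul_apply, smul_eq_mul, Fintype.sum_prod_type, Prod.swap_prod_mk, e2]
  rw [Finset.sum_mul_sum, Finset.sum_mul_sum]
  have key : ∑ i, ∑ j, (𝒳.XX s t (i, j) + 𝒳.XX s t (j, i)) * (y' i s ω * z' j s ω) =
      ∑ i, ∑ j, (𝒳.XX s u (i, j) + 𝒳.XX s u (j, i)) * (y' i s ω * z' j s ω) +
      ∑ i, ∑ j, (𝒳.XX u t (i, j) + 𝒳.XX u t (j, i)) * (y' i s ω * z' j s ω) +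
      ∑ i, ∑ j, (𝒳.X u i - 𝒳.X s i) * y' i s ω * ((𝒳.X t j - 𝒳.X u j) * z' j s ω) +
      ∑ i, ∑ j, (𝒳.X t i - 𝒳.X u i) * y' i s ω * ((𝒳.X u j - 𝒳.X s j) * z' j s ω) := by
    simp only [← Finset.sum_add_distrib]
    refine Finset.sum_congr rfl fun i _ => Finset.sum_congr rfl fun j _ => ?_
    rw [𝒳.chen s u t h0 h1 h2 h3 i j, 𝒳.chen s u t h0 h1 h2 h3 j i]
    ring
  simp only [mul_sub, Finset.sum_sub_distrib] at key ⊢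
  rw [key]
  ring

variable {𝒳 : RoughPath p T d} {X : ℝ → EuclideanSpace ℝ (Fin d)} {y z : ℝ → Ω → ℝ}
  {y' z' : Fin d → ℝ → Ω → ℝ}

lemma IsScalarControlled.memLp_contract (hy : IsScalarControlled μ ℱ T q e w C X y y') {s : ℝ}
    (hs : s ∈ Icc 0 T) (c : Fin d → ℝ) : MemLp (∑ i, c i • y' i s) (ENNReal.ofReal q) μ :=
  memLp_finsetSum' _ fun i _ => (hy.memLp' i s hs).const_smul (c i)

lemma IsScalarControlled.meas_contract (hy : IsScalarControlled μ ℱ T q e w C X y y') {s : ℝ}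
    (hs : s ∈ Icc 0 T) (c : Fin d → ℝ) : StronglyMeasurable[ℱ s] (∑ i, c i • y' i s) :=
  Finset.stronglyMeasurable_sum _ fun i _ => (hy.meas' i s hs).const_smul (c i)

lemma eLpNorm_condExp_mul_le [IsProbabilityMeasure μ] (hq : 4 ≤ q) {m₀ : MeasurableSpace Ω}
    (f g : Ω → ℝ) (hf : MemLp f (ENNReal.ofReal q) μ) (hg : MemLp g (ENNReal.ofReal q) μ) :
    eLpNorm (μ[f * g | m₀]) (ENNReal.ofReal (q / 2)) μ ≤
      eLpNorm f (ENNReal.ofReal q) μ * eLpNorm g (ENNReal.ofReal q) μ :=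
  (eLpNorm_condExp_le_eLpNorm _ (by simp; linarith)).trans
    (eLpNorm_mul_le_half (by linarith) hf.1 hg.1)

/-- If `f` is known at time `u`, then `f g` may be replaced by `f 𝔼_u[g]` under `𝔼_s`, `s ≤ u`. -/
lemma eLpNorm_condExp_mul_le_of_le [IsProbabilityMeasure μ] (hq : 4 ≤ q) {s u : ℝ} (hsu : s ≤ u)
    {f g : Ω → ℝ} (hfm : StronglyMeasurable[ℱ u] f) (hf : MemLp f (ENNReal.ofReal q) μ)
    (hg : MemLp g (ENNReal.ofReal q) μ) :
    eLpNorm (μ[f * g | ℱ s]) (ENNReal.ofReal (q / 2)) μ ≤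
      eLpNorm f (ENNReal.ofReal q) μ * eLpNorm (μ[g | ℱ u]) (ENNReal.ofReal q) μ := by
  have hq1 : 1 ≤ ENNReal.ofReal q := by simp; linarith
  have hq2 : 1 ≤ ENNReal.ofReal (q / 2) := by simp; linarith
  have hfg := (memLp_mul_half (by linarith) hf hg).integrable hq2
  have e1 : μ[f * g | ℱ u] =ᵐ[μ] f * μ[g | ℱ u] :=
    condExp_mul_of_stronglyMeasurable_left hfm hfg (hg.integrable hq1)
  have e2 : μ[μ[f * g | ℱ u] | ℱ s] =ᵐ[μ] μ[f * g | ℱ s] :=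
    condExp_condExp_of_le (ℱ.mono hsu) (ℱ.le u)
  have e3 : μ[f * g | ℱ s] =ᵐ[μ] μ[f * μ[g | ℱ u] | ℱ s] := e2.symm.trans (condExp_congr_ae e1)
  rw [eLpNorm_congr_ae e3]
  exact eLpNorm_condExp_mul_le hq _ _ hf (hg.condExp hq1)

lemma memLp_crossTerm (hq : 4 ≤ q) (hy : IsScalarControlled μ ℱ T q e w C X y y')
    (hz : IsScalarControlled μ ℱ T q e w C X z z') {s u t : ℝ} (h0 : 0 ≤ s) (h1 : s ≤ u)
    (h2 : u ≤ t) (h3 : t ≤ T) :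
    MemLp (crossTerm X y y' z z' s u t) (ENNReal.ofReal (q / 2)) μ := by
  have hs : s ∈ Icc 0 T := ⟨h0, h1.trans (h2.trans h3)⟩
  have hu : u ∈ Icc 0 T := ⟨h0.trans h1, h2.trans h3⟩
  have ht : t ∈ Icc 0 T := ⟨hu.1.trans h2, h3⟩
  exact (memLp_mul_half (by linarith) ((hy.memLp u hu).sub (hy.memLp s hs))
    ((hz.memLp t ht).sub (hz.memLp u hu))).sub
    (memLp_mul_half (by linarith) (hy.memLp_contract hs _) (hz.memLp_contract hs _))

lemma eLpNorm_crossTerm_le (hq : 4 ≤ q)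
    (h𝒳 : IsRoughControl 𝒳 e w C) (hy : IsScalarControlled μ ℱ T q e w C 𝒳.X y y')
    (hz : IsScalarControlled μ ℱ T q e w C 𝒳.X z z') {s u t : ℝ} (h0 : 0 ≤ s) (h1 : s ≤ u)
    (h2 : u ≤ t) (h3 : t ≤ T) :
    eLpNorm (crossTerm 𝒳.X y y' z z' s u t) (ENNReal.ofReal (q / 2)) μ ≤
      (C ^ 2 + d ^ 2 * C ^ 4) * (w s u ^ e * w u t ^ e) := by
  have hs : s ∈ Icc 0 T := ⟨h0, h1.trans (h2.trans h3)⟩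
  have hu : u ∈ Icc 0 T := ⟨h0.trans h1, h2.trans h3⟩
  have ht : t ∈ Icc 0 T := ⟨hu.1.trans h2, h3⟩
  have hq1 : 1 ≤ ENNReal.ofReal q := by simp; linarith
  have mA := hy.memLp_contract hs (fun i => 𝒳.X u i - 𝒳.X s i)
  have mB := hz.memLp_contract hs (fun i => 𝒳.X t i - 𝒳.X u i)
  have mδy := (hy.memLp u hu).sub (hy.memLp s hs)
  have mδz := (hz.memLp t ht).sub (hz.memLp u hu)
  have bA := eLpNorm_sum_smul_le hq1 (fun i => h𝒳.incr i s u h0 h1 hu.2)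
    (fun i => (hy.memLp' i s hs).1) (fun i => hy.bound' i s hs)
  have bB := eLpNorm_sum_smul_le hq1 (fun i => h𝒳.incr i u t hu.1 h2 h3)
    (fun i => (hz.memLp' i s hs).1) (fun i => hz.bound' i s hs)
  refine (eLpNorm_sub_le (memLp_mul_half (by linarith) mδy mδz).1
    (memLp_mul_half (by linarith) mA mB).1 (by simp; linarith)).trans ?_
  calc _ ≤ C * w s u ^ e * (C * w u t ^ e) +
        Fintype.card (Fin d) * (C * w s u ^ e * C) * (Fintype.card (Fin d) * (C * w u t ^ e * C)) :=
        add_le_add ((eLpNorm_mul_le_half (by linarith) mδy.1 mδz.1).trans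
          (mul_le_mul' (hy.incr s u h0 h1 hu.2) (hz.incr u t hu.1 h2 h3)))
          ((eLpNorm_mul_le_half (by linarith) mA.1 mB.1).trans (mul_le_mul' bA bB))
    _ = _ := by
      rw [Fintype.card_fin]
      ring

/-- The conditional expectation of the cross term is of third order, since
`δy_{su} δz_{ut} - (y'_s δX_{su}) (z'_s δX_{ut})` is the sum of `δy_{su} R^z_{ut}`,
`δy_{su} δz'_{su} δX_{ut}` and `R^y_{su} (z'_s δX_{ut})`. -/
lemma eLpNorm_condExp_crossTerm_le [IsProbabilityMeasure μ] (hq : 4 ≤ q) (he : 0 ≤ e)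
    (h𝒳 : IsRoughControl 𝒳 e w C) (hy : IsScalarControlled μ ℱ T q e w C 𝒳.X y y')
    (hz : IsScalarControlled μ ℱ T q e w C 𝒳.X z z') {s u t : ℝ} (h0 : 0 ≤ s) (h1 : s ≤ u)
    (h2 : u ≤ t) (h3 : t ≤ T) :
    eLpNorm (μ[crossTerm 𝒳.X y y' z z' s u t | ℱ s]) (ENNReal.ofReal (q / 2)) μ ≤
      (C ^ 2 + 2 * d * C ^ 3) *
        (w s u ^ e * w u t ^ (2 * e) + w s u ^ (2 * e) * w u t ^ e) := by
  have hs : s ∈ Icc 0 T := ⟨h0, h1.trans (h2.trans h3)⟩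
  have hu : u ∈ Icc 0 T := ⟨h0.trans h1, h2.trans h3⟩
  have ht : t ∈ Icc 0 T := ⟨hu.1.trans h2, h3⟩
  have hq0 : 0 < q := by linarith
  have hq1 : 1 ≤ ENNReal.ofReal q := by simp; linarith
  have hq2 : 1 ≤ ENNReal.ofReal (q / 2) := by simp; linarith
  set A := ∑ i, (𝒳.X u i - 𝒳.X s i) • y' i s with hA
  set B := ∑ i, (𝒳.X t i - 𝒳.X u i) • z' i s with hB
  set B' := ∑ i, (𝒳.X t i - 𝒳.X u i) • z' i u with hB'
  have mA : MemLp A (ENNReal.ofReal q) μ := hy.memLp_contract hs _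
  have mB : MemLp B (ENNReal.ofReal q) μ := hz.memLp_contract hs _
  have mB' : MemLp B' (ENNReal.ofReal q) μ := hz.memLp_contract hu _
  have mδy := (hy.memLp u hu).sub (hy.memLp s hs)
  have mδz := (hz.memLp t ht).sub (hz.memLp u hu)
  have hsplit : crossTerm 𝒳.X y y' z z' s u t =
      (y u - y s) * (z t - z u - B') + (y u - y s) * (B' - B) + B * (y u - y s - A) := by
    rw [crossTerm]
    ring
  have mδB := mB'.sub mB
  have m1 := memLp_mul_half hq0 mδy (mδz.sub mB')
  have m2 := memLp_mul_half hq0 mδy mδB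
  have m3 := memLp_mul_half hq0 mB (mδy.sub mA)
  have b1 : eLpNorm (μ[(y u - y s) * (z t - z u - B') | ℱ s]) (ENNReal.ofReal (q / 2)) μ ≤
      C * w s u ^ e * (C * w u t ^ (2 * e)) :=
    (eLpNorm_condExp_mul_le_of_le hq h1
      ((hy.meas u hu).sub ((hy.meas s hs).mono (ℱ.mono h1))) mδy (mδz.sub mB')).trans
      (mul_le_mul' (hy.incr s u h0 h1 hu.2) (hz.rem u t hu.1 h2 h3))
  have b2 : eLpNorm (μ[(y u - y s) * (B' - B) | ℱ s]) (ENNReal.ofReal (q / 2)) μ ≤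
      C * w s u ^ e * (Fintype.card (Fin d) * (C * w u t ^ e * (C * w s u ^ e))) := by
    refine (eLpNorm_condExp_mul_le hq _ _ mδy mδB).trans
      (mul_le_mul' (hy.incr s u h0 h1 hu.2) ?_)
    have : B' - B = ∑ i, (𝒳.X t i - 𝒳.X u i) • (z' i u - z' i s) := by
      rw [hB, hB', ← Finset.sum_sub_distrib]
      exact Finset.sum_congr rfl fun i _ => (smul_sub _ _ _).symm
    rw [this]
    exact eLpNorm_sum_smul_le hq1 (fun i => h𝒳.incr i u t hu.1 h2 h3)
      (fun i => ((hz.memLp' i u hu).sub (hz.memLp' i s hs)).1)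
      (fun i => hz.incr' i s u h0 h1 hu.2)
  have b3 : eLpNorm (μ[B * (y u - y s - A) | ℱ s]) (ENNReal.ofReal (q / 2)) μ ≤
      Fintype.card (Fin d) * (C * w u t ^ e * C) * (C * w s u ^ (2 * e)) :=
    (eLpNorm_condExp_mul_le_of_le hq le_rfl (hz.meas_contract hs _) mB (mδy.sub mA)).trans
      (mul_le_mul' (eLpNorm_sum_smul_le hq1 (fun i => h𝒳.incr i u t hu.1 h2 h3)
        (fun i => (hz.memLp' i s hs).1) (fun i => hz.bound' i s hs)) (hy.rem s u h0 h1 hu.2))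
  have hE : μ[crossTerm 𝒳.X y y' z z' s u t | ℱ s] =ᵐ[μ]
      μ[(y u - y s) * (z t - z u - B') | ℱ s] + μ[(y u - y s) * (B' - B) | ℱ s] +
        μ[B * (y u - y s - A) | ℱ s] := by
    rw [hsplit]
    refine (condExp_add ((m1.add m2).integrable hq2) (m3.integrable hq2) _).trans ?_
    exact (condExp_add (m1.integrable hq2) (m2.integrable hq2) _).add (EventuallyEq.refl _ _)
  rw [eLpNorm_congr_ae hE]
  have c1 := m1.condExp (m := ℱ s) hq2
  have c2 := m2.condExp (m := ℱ s) hq2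
  have c3 := m3.condExp (m := ℱ s) hq2
  refine (eLpNorm_add_le (c1.add c2).1 c3.1 hq2).trans
    ((add_le_add ((eLpNorm_add_le c1.1 c2.1 hq2).trans (add_le_add b1 b2)) b3).trans ?_)
  have hsq : w s u ^ (2 * e) = w s u ^ e * w s u ^ e := by
    rw [two_mul, ENNReal.rpow_add_of_nonneg _ _ he he]
  rw [Fintype.card_fin]
  calc C * w s u ^ e * (C * w u t ^ (2 * e)) +
        C * w s u ^ e * (d * (C * w u t ^ e * (C * w s u ^ e))) +
        d * (C * w u t ^ e * C) * (C * w s u ^ (2 * e))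
      = C ^ 2 * (w s u ^ e * w u t ^ (2 * e)) +
          2 * d * C ^ 3 * (w s u ^ (2 * e) * w u t ^ e) := by rw [hsq]; ring
    _ ≤ (C ^ 2 + 2 * d * C ^ 3) * (w s u ^ e * w u t ^ (2 * e)) +
          (C ^ 2 + 2 * d * C ^ 3) * (w s u ^ (2 * e) * w u t ^ e) := by
        gcongr
        · exact le_self_add
        · exact le_add_self
    _ = _ := by ring

lemma eLpNorm_area_term_le (hq : 4 ≤ q)
    (h𝒳 : IsRoughControl 𝒳 e w C) (hy : IsScalarControlled μ ℱ T q e w C 𝒳.X y y')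
    (hz : IsScalarControlled μ ℱ T q e w C 𝒳.X z z') {s u t : ℝ} (h0 : 0 ≤ s) (h1 : s ≤ u)
    (h2 : u ≤ t) (h3 : t ≤ T) :
    eLpNorm (∑ ij : Fin d × Fin d, (𝒳.XX u t ij + 𝒳.XX u t ij.swap) •
        (y' ij.1 u * z' ij.2 u - y' ij.1 s * z' ij.2 s)) (ENNReal.ofReal (q / 2)) μ ≤
      4 * d ^ 2 * C ^ 3 * (w s u ^ e * w u t ^ (2 * e)) := by
  have hs : s ∈ Icc 0 T := ⟨h0, h1.trans (h2.trans h3)⟩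
  have hu : u ∈ Icc 0 T := ⟨h0.trans h1, h2.trans h3⟩
  have hq0 : 0 < q := by linarith
  refine (eLpNorm_sum_smul_le (A := 2 * (C * w u t ^ (2 * e))) (B := 2 * (C ^ 2 * w s u ^ e))
    (by simp; linarith) (fun ij => ?_) (fun ij => ?_) (fun ij => ?_)).trans (le_of_eq ?_)
  · rw [two_mul]
    exact (enorm_add_le _ _).trans (add_le_add (h𝒳.area _ u t hu.1 h2 h3)
      (h𝒳.area _ u t hu.1 h2 h3))
  · exact ((memLp_mul_half hq0 (hy.memLp' _ u hu) (hz.memLp' _ u hu)).sub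
      (memLp_mul_half hq0 (hy.memLp' _ s hs) (hz.memLp' _ s hs))).1
  · have : y' ij.1 u * z' ij.2 u - y' ij.1 s * z' ij.2 s =
        (y' ij.1 u - y' ij.1 s) * z' ij.2 u + y' ij.1 s * (z' ij.2 u - z' ij.2 s) := by ring
    have m1 := (hy.memLp' ij.1 u hu).sub (hy.memLp' ij.1 s hs)
    have m2 := (hz.memLp' ij.2 u hu).sub (hz.memLp' ij.2 s hs)
    rw [this, two_mul]
    refine (eLpNorm_add_le (memLp_mul_half hq0 m1 (hz.memLp' ij.2 u hu)).1
      (memLp_mul_half hq0 (hy.memLp' ij.1 s hs) m2).1 (by simp; linarith)).trans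
      (add_le_add ?_ ?_)
    · refine (eLpNorm_mul_le_half hq0 m1.1 (hz.memLp' ij.2 u hu).1).trans
        ((mul_le_mul' (hy.incr' _ s u h0 h1 hu.2) (hz.bound' _ u hu)).trans (le_of_eq ?_))
      ring
    · refine (eLpNorm_mul_le_half hq0 (hy.memLp' ij.1 s hs).1 m2.1).trans
        ((mul_le_mul' (hy.bound' _ s hs) (hz.incr' _ s u h0 h1 hu.2)).trans (le_of_eq ?_))
      ring
  · rw [Fintype.card_prod, Fintype.card_fin]
    push_cast
    ring

lemma isGerm_scalarGerm (hq : 4 ≤ q)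
    (hy : IsScalarControlled μ ℱ T q e w C 𝒳.X y y')
    (hz : IsScalarControlled μ ℱ T q e w C 𝒳.X z z') :
    IsGerm μ ℱ T (q / 2) (scalarGerm 𝒳 y y' z z') where
  meas s t h0 h1 h2 := by
    have hs : s ∈ Icc 0 T := ⟨h0, h1.trans h2⟩
    have ht : t ∈ Icc 0 T := ⟨h0.trans h1, h2⟩
    have hle := ℱ.mono h1
    refine StronglyMeasurable.sub (((hy.meas t ht).sub ((hy.meas s hs).mono hle)).mul
      ((hz.meas t ht).sub ((hz.meas s hs).mono hle))) ?_
    exact Finset.stronglyMeasurable_sum _ fun ij _ => StronglyMeasurable.const_smul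
      (((hy.meas' _ s hs).mul (hz.meas' _ s hs)).mono hle) _
  memLp s t h0 h1 h2 := by
    have hs : s ∈ Icc 0 T := ⟨h0, h1.trans h2⟩
    have ht : t ∈ Icc 0 T := ⟨h0.trans h1, h2⟩
    have hq0 : 0 < q := by linarith
    refine (memLp_mul_half hq0 ((hy.memLp t ht).sub (hy.memLp s hs))
      ((hz.memLp t ht).sub (hz.memLp s hs))).sub ?_
    exact memLp_finsetSum' _ fun ij _ =>
      (memLp_mul_half hq0 (hy.memLp' _ s hs) (hz.memLp' _ s hs)).const_smul _
  self s h0 h1 := by simp [scalarGerm, 𝒳.XX_self h0 h1]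

lemma isSewable_scalarGerm [IsProbabilityMeasure μ] (hq : 4 ≤ q) (he : 0 ≤ e) (hC : C < ∞)
    (hw : IsRightControl w T)
    (h𝒳 : IsRoughControl 𝒳 e w C) (hy : IsScalarControlled μ ℱ T q e w C 𝒳.X y y')
    (hz : IsScalarControlled μ ℱ T q e w C 𝒳.X z z') :
    ∃ K : ℝ≥0∞, K < ∞ ∧ IsSewable μ ℱ T (q / 2) e w K (scalarGerm 𝒳 y y' z z') := by
  have hq2 : 1 ≤ ENNReal.ofReal (q / 2) := by simp; linarith
  set a := C ^ 2 + d ^ 2 * C ^ 4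
  set b := C ^ 2 + 2 * d * C ^ 3
  set c := 4 * d ^ 2 * C ^ 3
  have ha : a < ∞ := by simp [a, ENNReal.mul_lt_top_iff, ENNReal.pow_lt_top hC]
  have hb : b < ∞ := by simp [b, ENNReal.mul_lt_top_iff, ENNReal.pow_lt_top hC]
  have hc : c < ∞ := by simp [c, ENNReal.mul_lt_top_iff, ENNReal.pow_lt_top hC]
  have hw0 : w 0 T ^ e < ∞ := ENNReal.rpow_lt_top_of_nonneg he hw.lt_top.ne
  have hg := isGerm_scalarGerm hq hy hz
  refine ⟨a + a + c * w 0 T ^ e + (b + b + c), ?_, hg, fun s u t h0 h1 h2 h3 => ?_,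
    fun s u t h0 h1 h2 h3 => ?_⟩
  · simp [ENNReal.mul_lt_top_iff, ha, hb, hc, hw0]
  · rw [delta_scalarGerm 𝒳 y y' z z' h0 h1 h2 h3]
    have m1 := memLp_crossTerm hq hy hz h0 h1 h2 h3
    have m2 := memLp_crossTerm hq hz hy h0 h1 h2 h3
    have m3 : MemLp (∑ ij : Fin d × Fin d, (𝒳.XX u t ij + 𝒳.XX u t ij.swap) •
        (y' ij.1 u * z' ij.2 u - y' ij.1 s * z' ij.2 s)) (ENNReal.ofReal (q / 2)) μ := by
      have hm := hg.memLp_delta h0 h1 h2 h3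
      rw [delta_scalarGerm 𝒳 y y' z z' h0 h1 h2 h3] at hm
      simpa using hm.sub (m1.add m2)
    refine (eLpNorm_add_le (m1.add m2).1 m3.1 hq2).trans
      ((add_le_add ((eLpNorm_add_le m1.1 m2.1 hq2).trans
        (add_le_add (eLpNorm_crossTerm_le hq h𝒳 hy hz h0 h1 h2 h3)
          (eLpNorm_crossTerm_le hq h𝒳 hz hy h0 h1 h2 h3)))
        (eLpNorm_area_term_le hq h𝒳 hy hz h0 h1 h2 h3)).trans ?_)
    have hsq : w u t ^ (2 * e) ≤ w 0 T ^ e * w u t ^ e := by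
      rw [two_mul, ENNReal.rpow_add_of_nonneg _ _ he he]
      gcongr
      exact hw.mono le_rfl (h0.trans h1) h2 h3 le_rfl
    calc a * (w s u ^ e * w u t ^ e) + a * (w s u ^ e * w u t ^ e) +
          c * (w s u ^ e * w u t ^ (2 * e))
        ≤ a * (w s u ^ e * w u t ^ e) + a * (w s u ^ e * w u t ^ e) +
          c * (w s u ^ e * (w 0 T ^ e * w u t ^ e)) := by gcongr
      _ = (a + a + c * w 0 T ^ e) * (w s u ^ e * w u t ^ e) := by ring
      _ ≤ _ := mul_le_mul' le_self_add le_rfl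
  · rw [delta_scalarGerm 𝒳 y y' z z' h0 h1 h2 h3]
    have m1 := memLp_crossTerm hq hy hz h0 h1 h2 h3
    have m2 := memLp_crossTerm hq hz hy h0 h1 h2 h3
    set D := ∑ ij : Fin d × Fin d, (𝒳.XX u t ij + 𝒳.XX u t ij.swap) •
        (y' ij.1 u * z' ij.2 u - y' ij.1 s * z' ij.2 s) with hD
    have m3 : MemLp D (ENNReal.ofReal (q / 2)) μ := by
      have hm := hg.memLp_delta h0 h1 h2 h3
      rw [delta_scalarGerm 𝒳 y y' z z' h0 h1 h2 h3] at hm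
      simpa using hm.sub (m1.add m2)
    have hE : μ[crossTerm 𝒳.X y y' z z' s u t + crossTerm 𝒳.X z z' y y' s u t + D | ℱ s] =ᵐ[μ]
        μ[crossTerm 𝒳.X y y' z z' s u t | ℱ s] + μ[crossTerm 𝒳.X z z' y y' s u t | ℱ s] +
          μ[D | ℱ s] := by
      refine (condExp_add ((m1.add m2).integrable hq2) (m3.integrable hq2) _).trans ?_
      exact (condExp_add (m1.integrable hq2) (m2.integrable hq2) _).add (EventuallyEq.refl _ _)
    have c1 := m1.condExp (m := ℱ s) hq2
    have c2 := m2.condExp (m := ℱ s) hq2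
    have c3 := m3.condExp (m := ℱ s) hq2
    rw [eLpNorm_congr_ae hE]
    refine (eLpNorm_add_le (c1.add c2).1 c3.1 hq2).trans
      ((add_le_add ((eLpNorm_add_le c1.1 c2.1 hq2).trans
        (add_le_add (eLpNorm_condExp_crossTerm_le hq he h𝒳 hy hz h0 h1 h2 h3)
          (eLpNorm_condExp_crossTerm_le hq he h𝒳 hz hy h0 h1 h2 h3)))
        ((eLpNorm_condExp_le_eLpNorm _ hq2).trans
          (eLpNorm_area_term_le hq h𝒳 hy hz h0 h1 h2 h3))).trans ?_)
    set V := w s u ^ e * w u t ^ (2 * e)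
    set V' := w s u ^ (2 * e) * w u t ^ e
    calc b * (V + V') + b * (V + V') + c * V ≤ b * (V + V') + b * (V + V') + c * (V + V') := by
          gcongr
          exact le_self_add
      _ = (b + b + c) * (V + V') := by ring
      _ ≤ _ := mul_le_mul' le_add_self le_rfl

lemma eLpNorm_scalarGerm_le (hq : 4 ≤ q) (he : 0 ≤ e)
    (h𝒳 : IsRoughControl 𝒳 e w C) (hy : IsScalarControlled μ ℱ T q e w C 𝒳.X y y')
    (hz : IsScalarControlled μ ℱ T q e w C 𝒳.X z z') {s t : ℝ} (h0 : 0 ≤ s) (h1 : s ≤ t)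
    (h2 : t ≤ T) :
    eLpNorm (scalarGerm 𝒳 y y' z z' s t) (ENNReal.ofReal (q / 2)) μ ≤
      (C ^ 2 + 2 * d ^ 2 * C ^ 3) * w s t ^ (2 * e) := by
  have hs : s ∈ Icc 0 T := ⟨h0, h1.trans h2⟩
  have ht : t ∈ Icc 0 T := ⟨h0.trans h1, h2⟩
  have hq0 : 0 < q := by linarith
  have hq2 : 1 ≤ ENNReal.ofReal (q / 2) := by simp; linarith
  have m1 := (hy.memLp t ht).sub (hy.memLp s hs)
  have m2 := (hz.memLp t ht).sub (hz.memLp s hs)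
  have mp := fun ij : Fin d × Fin d =>
    memLp_mul_half hq0 (hy.memLp' ij.1 s hs) (hz.memLp' ij.2 s hs)
  have b1 := (eLpNorm_mul_le_half hq0 m1.1 m2.1).trans
    (mul_le_mul' (hy.incr s t h0 h1 h2) (hz.incr s t h0 h1 h2))
  have b2 := eLpNorm_sum_smul_le (μ := μ) hq2 (A := 2 * (C * w s t ^ (2 * e))) (B := C * C)
    (c := fun ij => 𝒳.XX s t ij + 𝒳.XX s t ij.swap) (fun ij => by
      rw [two_mul]
      exact (enorm_add_le _ _).trans (add_le_add (h𝒳.area _ s t h0 h1 h2)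
        (h𝒳.area _ s t h0 h1 h2)))
    (fun ij => (mp ij).1) (fun ij => (eLpNorm_mul_le_half hq0 (hy.memLp' ij.1 s hs).1
      (hz.memLp' ij.2 s hs).1).trans (mul_le_mul' (hy.bound' _ s hs) (hz.bound' _ s hs)))
  refine (eLpNorm_sub_le (memLp_mul_half hq0 m1 m2).1
    (memLp_finsetSum' _ fun ij _ => (mp ij).const_smul _).1 hq2).trans
    ((add_le_add b1 b2).trans (le_of_eq ?_))
  rw [Fintype.card_prod, Fintype.card_fin, two_mul e, ENNReal.rpow_add_of_nonneg _ _ he he]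
  push_cast
  ring

/-- The bracket of two real controlled paths, as produced by the sewing lemma. -/
lemma exists_scalar_bracket [IsProbabilityMeasure μ] (hq : 4 ≤ q) (he : 1 / 3 < e)
    (he' : e ≤ 1 / 2) (hC : C < ∞) (hw : IsRightControl w T)
    (h𝒳 : IsRoughControl 𝒳 e w C) (hy : IsScalarControlled μ ℱ T q e w C 𝒳.X y y')
    (hz : IsScalarControlled μ ℱ T q e w C 𝒳.X z z') :
    ∃ B : ℝ → Ω → ℝ, (∀ t ∈ Icc 0 T, StronglyMeasurable[ℱ t] (B t) ∧
        MemLp (B t) (ENNReal.ofReal (q / 2)) μ ∧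
        Tendsto (fun P : Partition 0 t =>
            eLpNorm (P.sum (scalarGerm 𝒳 y y' z z') - B t) (ENNReal.ofReal (q / 2)) μ)
          (meshFilter 0 t) (𝓝 0)) ∧
      ∃ K : ℝ≥0∞, K < ∞ ∧ ∀ s t, 0 ≤ s → s ≤ t → t ≤ T →
        eLpNorm (B t - B s) (ENNReal.ofReal (q / 2)) μ ≤ K * w s t ^ (2 * e) := by
  have hq2 : 1 ≤ ENNReal.ofReal (q / 2) := by simp; linarith
  obtain ⟨K, hK, hξ⟩ := isSewable_scalarGerm hq (by linarith) hC hw h𝒳 hy hz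
  obtain ⟨B, hB, K', hK', hBK⟩ := hξ.exists_process (by linarith) he he' hK hw
  refine ⟨B, hB, K' + (C ^ 2 + 2 * d ^ 2 * C ^ 3), ?_, fun s t h0 h1 h2 => ?_⟩
  · simp [ENNReal.mul_lt_top_iff, hK', ENNReal.pow_lt_top hC]
  · have hs : s ∈ Icc 0 T := ⟨h0, h1.trans h2⟩
    have ht : t ∈ Icc 0 T := ⟨h0.trans h1, h2⟩
    have mξ := hξ.germ.memLp s t h0 h1 h2
    rw [← sub_add_cancel (B t - B s) (scalarGerm 𝒳 y y' z z' s t), add_mul]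
    exact (eLpNorm_add_le (((hB t ht).2.1.sub (hB s hs).2.1).sub mξ).1 mξ.1 hq2).trans
      (add_le_add (hBK s t h0 h1 h2)
        (eLpNorm_scalarGerm_le hq (by linarith) h𝒳 hy hz h0 h1 h2))

end ScalarGerm

/-! ### Controls for processes and rough paths of finite variation -/

section Controls

variable {T : ℝ}

lemma IsRightControl.add {w w' : ℝ → ℝ → ℝ≥0∞} (hw : IsRightControl w T)
    (hw' : IsRightControl w' T) : IsRightControl (fun s t => w s t + w' s t) T where
  superadd s u t h0 h1 h2 h3 := by
    have := add_le_add (hw.superadd s u t h0 h1 h2 h3) (hw'.superadd s u t h0 h1 h2 h3)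
    rwa [add_add_add_comm] at this
  lt_top := ENNReal.add_lt_top.2 ⟨hw.lt_top, hw'.lt_top⟩
  right s hs := by simpa using (hw.right s hs).add (hw'.right s hs)

lemma IsRightControl.sum_le {w : ℝ → ℝ → ℝ≥0∞} (hw : IsRightControl w T) {s t : ℝ} (h0 : 0 ≤ s)
    (hT : t ≤ T) (P : Partition s t) : P.sum w ≤ w s t := by
  have key : ∀ j ≤ P.n, ∑ i ∈ Finset.range j, w (P.pts i) (P.pts (i + 1)) ≤ w s (P.pts j) := by
    intro j
    induction j with
    | zero => simp
    | succ j ih =>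
      intro hj
      rw [Finset.sum_range_succ]
      exact (add_le_add (ih (by omega)) le_rfl).trans
        (hw.superadd _ _ _ h0 (P.le_pts (by omega)) (P.pts_lt j hj).le ((P.pts_le hj).trans hT))
  have := key P.n le_rfl
  rwa [P.pts_last] at this

lemma varControl_lt_top_of_pVarOf {ρ : ℝ → ℝ → ℝ≥0∞} {a s t : ℝ} (ha : 0 < a)
    (h : pVarOf ρ a s t < ∞) : varControl (fun u v => ρ u v ^ a) s t < ∞ :=
  (ENNReal.rpow_lt_top_iff_of_pos (one_div_pos.2 ha)).1 h

lemma pVarOf_mono {ρ ρ' : ℝ → ℝ → ℝ≥0∞} {a s t : ℝ} (ha : 0 < a)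
    (h : ∀ u v, s ≤ u → u ≤ v → v ≤ t → ρ u v ≤ ρ' u v) : pVarOf ρ a s t ≤ pVarOf ρ' a s t := by
  refine ENNReal.rpow_le_rpow (iSup_mono fun P => Finset.sum_le_sum fun i hi => ?_)
    (one_div_pos.2 ha).le
  have hi := Finset.mem_range.1 hi
  exact ENNReal.rpow_le_rpow
    (h _ _ (P.le_pts hi.le) (P.pts_lt i hi).le (P.pts_le hi)) ha.le

/-- Finite `a`-variation means being dominated by the `1/a`-th power of a control. -/
lemma exists_rightControl {ρ : ℝ → ℝ → ℝ≥0∞} {a : ℝ} (ha : 0 < a) (hfin : pVarOf ρ a 0 T < ∞)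
    (hself : ∀ s ∈ Icc 0 T, ρ s s = 0) (hright : ∀ s ∈ Ico 0 T, Tendsto (ρ s) (𝓝[>] s) (𝓝 0)) :
    ∃ w, IsRightControl w T ∧ ∀ s t, 0 ≤ s → s ≤ t → t ≤ T → ρ s t ≤ w s t ^ (1 / a) := by
  refine ⟨varControl fun u v => ρ u v ^ a,
    varControl_isRightControl (varControl_lt_top_of_pVarOf ha hfin) fun s hs => ?_,
    fun s t h0 h1 h2 => ?_⟩
  · have h1 := (ENNReal.continuous_rpow_const (y := a)).tendsto 0 |>.comp (hright s hs)
    rwa [ENNReal.zero_rpow_of_pos ha] at h1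
  · rcases h1.eq_or_lt with rfl | h1
    · rw [hself s ⟨h0, h2⟩]
      exact zero_le
    · calc ρ s t = (ρ s t ^ a) ^ (1 / a) := by
            rw [← ENNReal.rpow_mul, mul_one_div_cancel ha.ne', ENNReal.rpow_one]
        _ ≤ _ := ENNReal.rpow_le_rpow (le_varControl (Ψ := fun u v => ρ u v ^ a) h1)
            (one_div_pos.2 ha).le

end Controls

section Processes

variable {Ω : Type*} [mΩ : MeasurableSpace Ω] {μ : Measure Ω}
  {ℱ : Filtration ℝ mΩ} {E : Type*} [NormedAddCommGroup E] {T p q : ℝ} {r : ℝ≥0∞}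

lemma eLpNorm_le_condNorm [IsProbabilityMeasure μ] (hq : 0 < q) (hr : 1 ≤ r) (s : ℝ) (Y : Ω → E) :
    eLpNorm Y (ENNReal.ofReal q) μ ≤ condNorm μ ℱ q r s Y := by
  rw [eLpNorm_eq_lintegral_rpow_enorm_toReal (by simpa using hq) ENNReal.ofReal_ne_top,
    ENNReal.toReal_ofReal hq.le, condNorm, ← lintegral_condLExp (ℱ.le s)]
  refine ENNReal.rpow_le_rpow ?_ (by positivity)
  refine le_trans (le_of_eq ?_) (eLpNorm_le_eLpNorm_of_exponent_le hr
    (measurable_condLExp' (ℱ s) μ _).aestronglyMeasurable)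
  rw [eLpNorm_one_eq_lintegral_enorm]
  rfl

lemma MemVLr.memVL [IsProbabilityMeasure μ] {Y : ℝ → Ω → E} (hp : 0 < p) (hq : 0 < q) (hr : 1 ≤ r)
    (h : MemVLr μ ℱ T p q r Y) : MemVL μ T p q Y :=
  ⟨h.meas, h.rightCont, h.init,
    (pVarOf_mono hp fun u _ _ _ _ => eLpNorm_le_condNorm hq hr u _).trans_lt h.pVar_lt_top⟩

lemma MemVL.memLp {Y : ℝ → Ω → E} (hp : 0 < p) (h : MemVL μ T p q Y)
    {t : ℝ} (ht : t ∈ Icc 0 T) : MemLp (Y t) (ENNReal.ofReal q) μ := by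
  rcases ht.1.eq_or_lt with rfl | h0
  · exact h.init
  have hT : (0 : ℝ) ∈ Icc 0 T := ⟨le_rfl, ht.1.trans ht.2⟩
  have h1 := varControl_lt_top_of_pVarOf hp h.pVar_lt_top
  have h2 := ((le_self_add.trans (varControl_superadd 0 t T ht.1 ht.2)).trans_lt h1)
  have h3 := (le_varControl (Ψ := fun u v => eLpNorm (Y v - Y u) (ENNReal.ofReal q) μ ^ p)
    h0).trans_lt h2
  have h4 := (ENNReal.rpow_lt_top_iff_of_pos hp).1 h3
  have h5 : MemLp (Y t - Y 0) (ENNReal.ofReal q) μ :=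
    ⟨((h.meas t ht).sub (h.meas 0 hT)).aestronglyMeasurable, h4⟩
  simpa using h5.add h.init

/-- Finite `p`-variation in `L^q` upgrades right-continuity in probability to `L^q`. -/
lemma MemVL.tendsto_right {Y : ℝ → Ω → E} (hp : 0 < p) (h : MemVL μ T p q Y)
    {s : ℝ} (hs : s ∈ Ico 0 T) :
    Tendsto (fun t => eLpNorm (Y t - Y s) (ENNReal.ofReal q) μ) (𝓝[>] s) (𝓝 0) := by
  have hs' : s ∈ Icc 0 T := ⟨hs.1, hs.2.le⟩
  refine ENNReal.tendsto_nhds_zero.2 fun ε hε => ?_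
  have hfin := varControl_lt_top_of_pVarOf hp h.pVar_lt_top
  obtain ⟨ε', hε', hεε'⟩ : ∃ ε' : ℝ≥0∞, 0 < ε' ∧ ε' ^ (1 / p) ≤ ε := by
    refine ⟨ε ^ p, ENNReal.rpow_pos_of_nonneg hε hp.le, le_of_eq ?_⟩
    rw [← ENNReal.rpow_mul, mul_one_div_cancel hp.ne', ENNReal.rpow_one]
  -- On `[v, u]` with `s < v < u` the `p`-variation is small if `u` is close to `s`; now let `v`
  -- decrease to `s` and use Fatou's lemma.
  obtain ⟨b, hb, hsmall⟩ := exists_right_small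
    (fun s u t _ h1 h2 _ => varControl_superadd s u t h1 h2) hfin hε' hs.1 hs.2
  refine mem_of_superset (Ioc_mem_nhdsGT hb.1) fun u hu => ?_
  have huT : u ∈ Icc 0 T := ⟨hs.1.trans hu.1.le, hu.2.trans hb.2⟩
  obtain ⟨v, -, hv, hvs⟩ := exists_seq_strictAnti_tendsto' hu.1
  have hvT : ∀ n, v n ∈ Icc 0 T := fun n => ⟨hs.1.trans (hv n).1.le, (hv n).2.le.trans huT.2⟩
  have hvs' : Tendsto v atTop (𝓝[>] s) :=
    tendsto_nhdsWithin_iff.2 ⟨hvs, Eventually.of_forall fun n => (hv n).1⟩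
  have hmeas : TendstoInMeasure μ (fun n => Y u - Y (v n)) atTop (Y u - Y s) := by
    intro δ hδ
    have := (h.rightCont s hs).comp hvs' δ hδ
    simpa using this
  refine eLpNorm_le_of_tendstoInMeasure (Eventually.of_forall fun n => ?_) hmeas
    fun n => ((h.meas u huT).sub (h.meas _ (hvT n))).aestronglyMeasurable
  have h1 := (le_varControl (Ψ := fun u v => eLpNorm (Y v - Y u) (ENNReal.ofReal q) μ ^ p)
    (hv n).2).trans (hsmall (v n) u (hv n).1 (hv n).2.le hu.2)
  have h2 := ENNReal.rpow_le_rpow h1 (one_div_pos.2 hp).le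
  rw [← ENNReal.rpow_mul, mul_one_div_cancel hp.ne', ENNReal.rpow_one] at h2
  exact h2.trans hεε'

lemma MemVL.exists_rightControl {Y : ℝ → Ω → E} (hp : 0 < p) (h : MemVL μ T p q Y) :
    ∃ w, IsRightControl w T ∧ ∀ s t, 0 ≤ s → s ≤ t → t ≤ T →
      eLpNorm (Y t - Y s) (ENNReal.ofReal q) μ ≤ w s t ^ (1 / p) :=
  RoughStoch.exists_rightControl hp h.pVar_lt_top (fun s _ => by simp)
    fun _ hs => h.tendsto_right hp hs

end Processes

section RoughPathControl

variable {p T : ℝ} {d : ℕ}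

lemma RoughPath.exists_rightControl (𝒳 : RoughPath p T d) (hp : 0 < p) :
    ∃ w, IsRightControl w T ∧ (∀ s t, 0 ≤ s → s ≤ t → t ≤ T →
      ‖𝒳.X t - 𝒳.X s‖ₑ ≤ w s t ^ (1 / p)) ∧ ∀ s t, 0 ≤ s → s ≤ t → t ≤ T →
      ‖𝒳.XX s t‖ₑ ≤ w s t ^ (2 * (1 / p)) := by
  obtain ⟨w₁, hw₁, h₁⟩ := RoughStoch.exists_rightControl
    (ρ := fun s t => ‖𝒳.X t - 𝒳.X s‖ₑ) hp 𝒳.memV.2 (fun s _ => by simp) fun s hs => by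
      have := ((𝒳.memV.1.1 s hs).sub_const (𝒳.X s)).enorm
      simpa using this
  obtain ⟨w₂, hw₂, h₂⟩ := RoughStoch.exists_rightControl (ρ := fun s t => ‖𝒳.XX s t‖ₑ)
    (half_pos hp) 𝒳.pVar_lt_top (fun s hs => by simp [𝒳.XX_self hs.1 hs.2]) fun s hs => by
      have h1 : Tendsto (fun t => 𝒳.XX s t) (𝓝[>] s) (𝓝 (𝒳.XX s s)) :=
        (𝒳.cadlag_right s ⟨hs.1, hs.2.le⟩).1 s ⟨le_rfl, hs.2⟩
      rw [𝒳.XX_self hs.1 hs.2.le] at h1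
      simpa using h1.enorm
  refine ⟨fun s t => w₁ s t + w₂ s t, hw₁.add hw₂, fun s t h0 hst hT => (h₁ s t h0 hst hT).trans ?_,
    fun s t h0 hst hT => ?_⟩
  · exact ENNReal.rpow_le_rpow le_self_add (by positivity)
  · refine (h₂ s t h0 hst hT).trans ?_
    rw [one_div_div, ← mul_one_div]
    exact ENNReal.rpow_le_rpow le_add_self (by positivity)

lemma enorm_apply_le_enorm {ι : Type*} [Fintype ι] (x : EuclideanSpace ℝ ι) (i : ι) :
    ‖x i‖ₑ ≤ ‖x‖ₑ :=
  enorm_le_iff_norm_le.2 (PiLp.norm_apply_le x i)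

end RoughPathControl

/-! ### From controlled paths to real controlled paths -/

section ControlledPaths

variable {Ω : Type*} [mΩ : MeasurableSpace Ω] {μ : Measure Ω}
  {ℱ : Filtration ℝ mΩ} {E : Type*} [NormedAddCommGroup E] [NormedSpace ℝ E]
  {T p q : ℝ} {r : ℝ≥0∞} {d : ℕ} {X : ℝ → EuclideanSpace ℝ (Fin d)} {Y : ℝ → Ω → E}
  {Y' : ℝ → Ω → EuclideanSpace ℝ (Fin d) →L[ℝ] E}

lemma le_ofReal_mul (hr : 1 ≤ r) : ENNReal.ofReal q ≤ ENNReal.ofReal q * r := by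
  conv_lhs => rw [← mul_one (ENNReal.ofReal q)]
  gcongr

lemma eLpNorm_apply_le {f : Ω → EuclideanSpace ℝ (Fin d) →L[ℝ] E} (s : ℝ≥0∞)
    (x : EuclideanSpace ℝ (Fin d)) :
    eLpNorm (fun ω => f ω x) s μ ≤ ‖x‖ₑ * eLpNorm f s μ := by
  rw [← ofReal_norm]
  refine eLpNorm_le_mul_eLpNorm_of_ae_le_mul (Eventually.of_forall fun ω => ?_) s
  rw [mul_comm]
  exact (f ω).le_opNorm x

lemma memLp_apply {f : Ω → EuclideanSpace ℝ (Fin d) →L[ℝ] E} {s : ℝ≥0∞}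
    (hf : MemLp f s μ) (x : EuclideanSpace ℝ (Fin d)) : MemLp (fun ω => f ω x) s μ :=
  ⟨(ContinuousLinearMap.apply ℝ E x).continuous.comp_aestronglyMeasurable hf.1,
    (eLpNorm_apply_le s x).trans_lt (ENNReal.mul_lt_top enorm_lt_top hf.2)⟩

lemma IsControlled.memLp_remainder [IsProbabilityMeasure μ] [CompleteSpace E] (hp : 0 < p)
    (hq : 1 ≤ q) (hr : 1 ≤ r) (h : IsControlled μ ℱ T p q r X Y Y')
    {s t : ℝ} (hs : s ∈ Icc 0 T) (ht : t ∈ Icc 0 T) :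
    MemLp (remainder X Y Y' s t) (ENNReal.ofReal q) μ := by
  have hY := h.memVLr.memVL hp (by linarith) hr
  have hY' := h.memVLr'.memVL hp (by linarith) hr
  exact ((hY.memLp hp ht).sub (hY.memLp hp hs)).sub
    (memLp_apply (hY'.memLp hp hs) (X t - X s))

/-- A single control for the increments of a controlled path and for its remainder. -/
lemma IsControlled.exists_rightControl [IsProbabilityMeasure μ] [CompleteSpace E] (hp : 0 < p)
    (hq : 1 ≤ q) (hr : 1 ≤ r) (hX : ∀ s ∈ Ico 0 T, Tendsto X (𝓝[>] s) (𝓝 (X s)))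
    (h : IsControlled μ ℱ T p q r X Y Y') :
    ∃ w, IsRightControl w T ∧ ∀ s t, 0 ≤ s → s ≤ t → t ≤ T →
      eLpNorm (Y t - Y s) (ENNReal.ofReal q) μ ≤ w s t ^ (1 / p) ∧
      eLpNorm (Y' t - Y' s) (ENNReal.ofReal q) μ ≤ w s t ^ (1 / p) ∧
      eLpNorm (μ[remainder X Y Y' s t | ℱ s]) (ENNReal.ofReal q) μ ≤
        w s t ^ (2 * (1 / p)) := by
  have hq1 : 1 ≤ ENNReal.ofReal q := by simpa using hq
  have hY := h.memVLr.memVL hp (by linarith) hr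
  have hY' := h.memVLr'.memVL hp (by linarith) hr
  obtain ⟨w₁, hw₁, h₁⟩ := hY.exists_rightControl hp
  obtain ⟨w₂, hw₂, h₂⟩ := hY'.exists_rightControl hp
  obtain ⟨w₃, hw₃, h₃⟩ := RoughStoch.exists_rightControl
    (ρ := fun s t => eLpNorm (μ[remainder X Y Y' s t | ℱ s]) (ENNReal.ofReal q) μ) (T := T)
    (half_pos hp)
    ((pVarOf_mono (half_pos hp) fun u v _ _ _ => eLpNorm_le_eLpNorm_of_exponent_le
      (le_ofReal_mul hr) integrable_condExp.1).trans_lt h.remainder_lt_top)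
    (fun s _ => by
      have : remainder X Y Y' s s = 0 := by
        ext ω
        simp [remainder]
      rw [this, condExp_zero, eLpNorm_zero])
    (fun s hs => by
      have hs' : s ∈ Icc 0 T := ⟨hs.1, hs.2.le⟩
      have mY' := hY'.memLp hp hs'
      have l1 := hY.tendsto_right hp hs
      have l2 : Tendsto (fun t => ‖X t - X s‖ₑ * eLpNorm (Y' s) (ENNReal.ofReal q) μ)
          (𝓝[>] s) (𝓝 0) := by
        have := ((hX s hs).sub_const (X s)).enorm
        rw [sub_self, enorm_zero] at this
        simpa using ENNReal.Tendsto.mul_const this (Or.inr mY'.2.ne)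
      have l3 := l1.add l2
      rw [add_zero] at l3
      refine tendsto_of_tendsto_of_tendsto_of_le_of_le' tendsto_const_nhds l3
        (Eventually.of_forall fun t => zero_le) ?_
      filter_upwards [Ioo_mem_nhdsGT hs.2] with t ht
      have ht' : t ∈ Icc 0 T := ⟨hs.1.trans ht.1.le, ht.2.le⟩
      refine (eLpNorm_condExp_le_eLpNorm _ hq1).trans ?_
      refine (eLpNorm_sub_le (f := Y t - Y s) (g := fun ω => Y' s ω (X t - X s))
        ((hY.memLp hp ht').sub (hY.memLp hp hs')).1 (memLp_apply mY' _).1 hq1).trans ?_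
      gcongr
      exact eLpNorm_apply_le _ _)
  refine ⟨fun s t => w₁ s t + w₂ s t + w₃ s t, (hw₁.add hw₂).add hw₃, fun s t h0 hst hT =>
    ⟨(h₁ s t h0 hst hT).trans ?_, (h₂ s t h0 hst hT).trans ?_, (h₃ s t h0 hst hT).trans ?_⟩⟩
  · exact ENNReal.rpow_le_rpow (le_self_add.trans le_self_add) (by positivity)
  · exact ENNReal.rpow_le_rpow (le_add_self.trans le_self_add) (by positivity)
  · rw [one_div_div, ← mul_one_div]
    exact ENNReal.rpow_le_rpow le_add_self (by positivity)

/-- The image of a controlled path under a linear functional is a real controlled path. -/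
lemma IsControlled.isScalarControlled [IsProbabilityMeasure μ] [CompleteSpace E] (hp : 0 < p)
    (hq : 1 ≤ q) (hr : 1 ≤ r) (h : IsControlled μ ℱ T p q r X Y Y') {w : ℝ → ℝ → ℝ≥0∞}
    (hw : ∀ s t, 0 ≤ s → s ≤ t → t ≤ T →
      eLpNorm (Y t - Y s) (ENNReal.ofReal q) μ ≤ w s t ^ (1 / p) ∧
      eLpNorm (Y' t - Y' s) (ENNReal.ofReal q) μ ≤ w s t ^ (1 / p) ∧
      eLpNorm (μ[remainder X Y Y' s t | ℱ s]) (ENNReal.ofReal q) μ ≤ w s t ^ (2 * (1 / p)))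
    (φ : E →L[ℝ] ℝ) {C : ℝ≥0∞} (hφ : ‖φ‖ₑ ≤ C)
    (hC : ‖φ‖ₑ * (⨆ s ∈ Icc 0 T, eLpNorm (Y' s) (ENNReal.ofReal q * r) μ) ≤ C) :
    IsScalarControlled μ ℱ T q (1 / p) w C X (fun t ω => φ (Y t ω))
      (fun i t ω => φ (Y' t ω (EuclideanSpace.single i 1))) := by
  have hq1 : 1 ≤ ENNReal.ofReal q := by simpa using hq
  have hY := h.memVLr.memVL hp (by linarith) hr
  have hY' := h.memVLr'.memVL hp (by linarith) hr
  have hφle : ∀ (f : Ω → E) (s : ℝ≥0∞), eLpNorm (fun ω => φ (f ω)) s μ ≤ ‖φ‖ₑ * eLpNorm f s μ :=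
    fun f s => by
      rw [← ofReal_norm]
      exact eLpNorm_le_mul_eLpNorm_of_ae_le_mul (Eventually.of_forall fun ω => φ.le_opNorm _) s
  have hsingle : ∀ i : Fin d, ‖EuclideanSpace.single i (1 : ℝ)‖ₑ = 1 := fun i => by
    rw [← ofReal_norm]; simp
  have hφle' : ∀ (i : Fin d) (f : Ω → EuclideanSpace ℝ (Fin d) →L[ℝ] E) (s : ℝ≥0∞),
      eLpNorm (fun ω => φ (f ω (EuclideanSpace.single i 1))) s μ ≤ ‖φ‖ₑ * eLpNorm f s μ :=
    fun i f s => by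
      refine (hφle _ s).trans ?_
      gcongr
      have := eLpNorm_apply_le (μ := μ) (f := f) s (EuclideanSpace.single i (1 : ℝ))
      rwa [hsingle, one_mul] at this
  have hcont' : ∀ i : Fin d, Continuous fun A : EuclideanSpace ℝ (Fin d) →L[ℝ] E =>
      φ (A (EuclideanSpace.single i 1)) := fun i =>
    φ.continuous.comp (ContinuousLinearMap.apply ℝ E (EuclideanSpace.single i (1 : ℝ))).continuous
  have mφ : ∀ {f : Ω → E}, MemLp f (ENNReal.ofReal q) μ →
      MemLp (fun ω => φ (f ω)) (ENNReal.ofReal q) μ := fun hf => φ.comp_memLp' hf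
  refine
    { meas := fun t ht => φ.continuous.comp_stronglyMeasurable (h.adapted t ht)
      meas' := fun i t ht => (hcont' i).comp_stronglyMeasurable (h.adapted' t ht)
      memLp := fun t ht => mφ (hY.memLp hp ht)
      memLp' := fun i t ht => mφ (memLp_apply (hY'.memLp hp ht) _)
      bound' := fun i t ht => ?_
      incr := fun s t h0 h1 h2 => ?_
      incr' := fun i s t h0 h1 h2 => ?_
      rem := fun s t h0 h1 h2 => ?_ }
  · refine ((hφle' i (Y' t) _).trans ?_).trans hC
    gcongr
    exact (eLpNorm_le_eLpNorm_of_exponent_le (le_ofReal_mul hr) (hY'.memLp hp ht).1).trans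
      (le_iSup₂ (f := fun s _ => eLpNorm (Y' s) (ENNReal.ofReal q * r) μ) t ht)
  · have : ((fun ω => φ (Y t ω)) - fun ω => φ (Y s ω)) = fun ω => φ ((Y t - Y s) ω) := by
      ext ω
      simp
    change eLpNorm ((fun ω => φ (Y t ω)) - fun ω => φ (Y s ω)) _ _ ≤ _
    rw [this]
    exact (hφle _ _).trans (mul_le_mul' hφ (hw s t h0 h1 h2).1)
  · have : ((fun ω => φ (Y' t ω (EuclideanSpace.single i 1))) -
        fun ω => φ (Y' s ω (EuclideanSpace.single i 1))) =
        fun ω => φ ((Y' t - Y' s) ω (EuclideanSpace.single i 1)) := by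
      ext ω
      simp
    change eLpNorm ((fun ω => φ (Y' t ω (EuclideanSpace.single i 1))) -
        fun ω => φ (Y' s ω (EuclideanSpace.single i 1))) _ _ ≤ _
    rw [this]
    exact (hφle' i _ _).trans (mul_le_mul' hφ (hw s t h0 h1 h2).2.1)
  · have hs : s ∈ Icc 0 T := ⟨h0, h1.trans h2⟩
    have ht : t ∈ Icc 0 T := ⟨h0.trans h1, h2⟩
    have heq : (fun ω => φ (Y t ω)) - (fun ω => φ (Y s ω)) - ∑ i, (X t i - X s i) •
        (fun ω => φ (Y' s ω (EuclideanSpace.single i 1))) = φ ∘ remainder X Y Y' s t := by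
      ext ω
      have hx : X t - X s = ∑ i, (X t i - X s i) • EuclideanSpace.single i (1 : ℝ) := by
        ext j
        simp [Finset.sum_apply, Pi.single_apply]
      have hY's : φ (Y' s ω (X t - X s)) =
          ∑ i, (X t i - X s i) * φ (Y' s ω (EuclideanSpace.single i 1)) := by
        rw [hx, map_sum, map_sum]
        simp only [map_smul, smul_eq_mul]
      rw [Function.comp_apply, remainder, map_sub, map_sub, hY's]
      simp [Finset.sum_apply]
    have hae := φ.comp_condExp_comm (m := ℱ s)
      ((h.memLp_remainder hp hq hr hs ht).integrable hq1)
    change eLpNorm (μ[(fun ω => φ (Y t ω)) - (fun ω => φ (Y s ω)) - ∑ i, (X t i - X s i) •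
        (fun ω => φ (Y' s ω (EuclideanSpace.single i 1))) | ℱ s]) _ _ ≤ _
    rw [heq, ← eLpNorm_congr_ae hae]
    exact (hφle _ _).trans (mul_le_mul' hφ (hw s t h0 h1 h2).2.2)

end ControlledPaths

/-! ### Estimates of `p`-variation -/

section Variation

variable {T : ℝ}

lemma pVarOf_eq_zero {ρ : ℝ → ℝ → ℝ≥0∞} {a s t : ℝ} (ha : 0 < a)
    (h : ∀ u v, s ≤ u → u ≤ v → v ≤ t → ρ u v = 0) : pVarOf ρ a s t = 0 := by
  refine le_antisymm ((pVarOf_mono (ρ' := fun _ _ => 0) ha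
    fun u v h1 h2 h3 => (h u v h1 h2 h3).le).trans (le_of_eq ?_)) zero_le
  simp [pVarOf, Partition.sum, ENNReal.zero_rpow_of_pos ha, ENNReal.zero_rpow_of_pos (inv_pos.2 ha)]

lemma IsRightControl.pVarOf_lt_top {w ρ : ℝ → ℝ → ℝ≥0∞} (hw : IsRightControl w T) {K : ℝ≥0∞}
    {p : ℝ} (hp : 0 < p) (hK : K < ∞)
    (h : ∀ u v, 0 ≤ u → u ≤ v → v ≤ T → ρ u v ≤ K * w u v ^ (2 * (1 / p))) :
    pVarOf ρ (p / 2) 0 T < ∞ := by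
  have hp2 : 0 < p / 2 := half_pos hp
  refine ENNReal.rpow_lt_top_of_nonneg (one_div_pos.2 hp2).le (ne_of_lt ?_)
  refine lt_of_le_of_lt (iSup_le fun P => ?_) (ENNReal.mul_lt_top
    (ENNReal.rpow_lt_top_of_nonneg hp2.le hK.ne) hw.lt_top)
  calc P.sum (fun u v => ρ u v ^ (p / 2)) ≤ P.sum fun u v => K ^ (p / 2) * w u v := by
        refine Finset.sum_le_sum fun i hi => ?_
        have hi := Finset.mem_range.1 hi
        refine (ENNReal.rpow_le_rpow (h _ _ (P.le_pts hi.le) (P.pts_lt i hi).le (P.pts_le hi))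
          hp2.le).trans (le_of_eq ?_)
        rw [ENNReal.mul_rpow_of_nonneg _ _ hp2.le, ← ENNReal.rpow_mul,
          show 2 * (1 / p) * (p / 2) = 1 by field_simp, ENNReal.rpow_one]
    _ = K ^ (p / 2) * P.sum w := by rw [Partition.sum, Partition.sum, Finset.mul_sum]
    _ ≤ K ^ (p / 2) * w 0 T := by
        gcongr
        exact hw.sum_le le_rfl le_rfl P

end Variation

/-! ### Coordinates on the tensor product -/

section Coordinates

variable {E F G : Type*} [NormedAddCommGroup E] [NormedSpace ℝ E]
  [NormedAddCommGroup F] [NormedSpace ℝ F] [NormedAddCommGroup G] [NormedSpace ℝ G]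

/-- Coordinates with respect to bases of `E` and `F`; the vectors `g` are the images of the products
of basis vectors. -/
lemma exists_tensor_coordinates [FiniteDimensional ℝ E] [FiniteDimensional ℝ F]
    (τ : E ⊗[ℝ] F ≃ₗ[ℝ] G) :
    ∃ (k l : ℕ) (φ : Fin k → E →L[ℝ] ℝ) (ψ : Fin l → F →L[ℝ] ℝ) (g : Fin k × Fin l → G),
      ∀ x y, τ (x ⊗ₜ[ℝ] y) = ∑ ab, (φ ab.1 x * ψ ab.2 y) • g ab := by
  let bE := Module.finBasis ℝ E
  let bF := Module.finBasis ℝ F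
  refine ⟨_, _, fun a => LinearMap.toContinuousLinearMap (bE.coord a),
    fun b => LinearMap.toContinuousLinearMap (bF.coord b),
    fun ab => τ (bE ab.1 ⊗ₜ[ℝ] bF ab.2), fun x y => ?_⟩
  conv_lhs => rw [← bE.sum_repr x, ← bF.sum_repr y]
  rw [TensorProduct.sum_tmul, map_sum, Fintype.sum_prod_type]
  refine Finset.sum_congr rfl fun a _ => ?_
  rw [TensorProduct.tmul_sum, map_sum]
  refine Finset.sum_congr rfl fun b _ => ?_
  rw [TensorProduct.smul_tmul_smul, map_smul]
  rfl

variable {Ω : Type*} {p T : ℝ} {d : ℕ}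

lemma bracketGerm_eq_sum (𝒳 : RoughPath p T d) (τ : E ⊗[ℝ] F ≃ₗ[ℝ] G) {k l : ℕ}
    {φ : Fin k → E →L[ℝ] ℝ} {ψ : Fin l → F →L[ℝ] ℝ} {g : Fin k × Fin l → G}
    (hτ : ∀ x y, τ (x ⊗ₜ[ℝ] y) = ∑ ab, (φ ab.1 x * ψ ab.2 y) • g ab)
    (Y : ℝ → Ω → E) (Y' : ℝ → Ω → EuclideanSpace ℝ (Fin d) →L[ℝ] E)
    (Z : ℝ → Ω → F) (Z' : ℝ → Ω → EuclideanSpace ℝ (Fin d) →L[ℝ] F) (u v : ℝ) (ω : Ω) :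
    bracketGerm 𝒳 τ Y Y' Z Z' u v ω = ∑ ab : Fin k × Fin l,
      scalarGerm 𝒳 (fun t ω => φ ab.1 (Y t ω))
        (fun i t ω => φ ab.1 (Y' t ω (EuclideanSpace.single i 1)))
        (fun t ω => ψ ab.2 (Z t ω))
        (fun i t ω => ψ ab.2 (Z' t ω (EuclideanSpace.single i 1))) u v ω • g ab := by
  rw [bracketGerm, map_sub, hτ, map_smul, toTensor, map_sum, map_sum]
  have hin : ∀ i j : Fin d, (2 : ℝ) • τ (TensorProduct.map (Y' u ω).toLinearMap (Z' u ω).toLinearMap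
      (symPart (𝒳.XX u v) (i, j) •
        (EuclideanSpace.single i (1 : ℝ) ⊗ₜ[ℝ] EuclideanSpace.single j (1 : ℝ)))) =
      ∑ ab : Fin k × Fin l, ((𝒳.XX u v (i, j) + 𝒳.XX u v (j, i)) *
        (φ ab.1 (Y' u ω (EuclideanSpace.single i 1)) *
          ψ ab.2 (Z' u ω (EuclideanSpace.single j 1)))) • g ab := fun i j => by
    rw [map_smul, TensorProduct.map_tmul, map_smul, ContinuousLinearMap.coe_coe,
      ContinuousLinearMap.coe_coe, hτ, Finset.smul_sum, Finset.smul_sum]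
    refine Finset.sum_congr rfl fun ab _ => ?_
    rw [smul_smul, smul_smul]
    congr 1
    simp only [symPart]
    ring
  have hsum : (2 : ℝ) • ∑ i, τ (TensorProduct.map (Y' u ω).toLinearMap (Z' u ω).toLinearMap
      (∑ j, symPart (𝒳.XX u v) (i, j) •
        (EuclideanSpace.single i (1 : ℝ) ⊗ₜ[ℝ] EuclideanSpace.single j (1 : ℝ)))) =
      ∑ ab : Fin k × Fin l, (∑ ij : Fin d × Fin d, (𝒳.XX u v ij + 𝒳.XX u v ij.swap) *
        (φ ab.1 (Y' u ω (EuclideanSpace.single ij.1 1)) *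
          ψ ab.2 (Z' u ω (EuclideanSpace.single ij.2 1)))) • g ab := by
    simp only [map_sum, Finset.smul_sum, hin, Finset.sum_smul]
    rw [Finset.sum_comm' (t' := Finset.univ) (s' := fun _ => Finset.univ) (by simp),
      ← Fintype.sum_prod_type']
    rw [Finset.sum_comm]
    refine Finset.sum_congr rfl fun ab _ => ?_
    rw [Fintype.sum_prod_type, Fintype.sum_prod_type, Finset.sum_comm]
    rfl
  rw [hsum, ← Finset.sum_sub_distrib]
  refine Finset.sum_congr rfl fun ab _ => ?_
  rw [← sub_smul]
  congr 1
  simp [scalarGerm, Finset.sum_apply]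

lemma eLpNorm_sum_smul_const_le {mΩ : MeasurableSpace Ω} {μ : Measure Ω} {ι : Type*}
    [Fintype ι] {s : ℝ≥0∞} (hs : 1 ≤ s)
    {f : ι → Ω → ℝ} (hf : ∀ i, AEStronglyMeasurable (f i) μ) (g : ι → G) :
    eLpNorm (fun ω => ∑ i, f i ω • g i) s μ ≤ ∑ i, ‖g i‖ₑ * eLpNorm (f i) s μ := by
  have : (fun ω => ∑ i, f i ω • g i) = ∑ i, fun ω => f i ω • g i := by
    ext ω
    simp
  rw [this]
  refine (eLpNorm_sum_le (fun i _ => (hf i).smul_const (g i)) hs).trans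
    (Finset.sum_le_sum fun i _ => ?_)
  rw [← ofReal_norm]
  refine eLpNorm_le_mul_eLpNorm_of_ae_le_mul (Eventually.of_forall fun ω => ?_) s
  rw [norm_smul, mul_comm]

end Coordinates

/-! ### Existence of the bracket -/

section Existence

variable {Ω : Type*} [mΩ : MeasurableSpace Ω] {μ : Measure Ω} [IsProbabilityMeasure μ]
  {ℱ : Filtration ℝ mΩ} {E F G : Type*} [NormedAddCommGroup E] [NormedSpace ℝ E]
  [CompleteSpace E] [NormedAddCommGroup F] [NormedSpace ℝ F] [CompleteSpace F]
  [NormedAddCommGroup G] [NormedSpace ℝ G]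
  {T p q : ℝ} {r : ℝ≥0∞} {d : ℕ} {𝒳 : RoughPath p T d} {Y : ℝ → Ω → E}
  {Y' : ℝ → Ω → EuclideanSpace ℝ (Fin d) →L[ℝ] E} {Z : ℝ → Ω → F}
  {Z' : ℝ → Ω → EuclideanSpace ℝ (Fin d) →L[ℝ] F}

/-- The brackets of `φ ∘ Y` and `ψ ∘ Z` exist for all functionals `φ` and `ψ`, and their increments
are governed by one control that does not depend on `φ` and `ψ`. The germ is named `ξ` because it
occurs several times. -/
lemma exists_coordinate_brackets (hp : 2 ≤ p) (hp3 : p < 3) (hq : 4 ≤ q) (hr : 1 ≤ r)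
    (hY : IsControlled μ ℱ T p q r 𝒳.X Y Y') (hZ : IsControlled μ ℱ T p q r 𝒳.X Z Z') :
    ∃ w, IsRightControl w T ∧ ∀ (φ : E →L[ℝ] ℝ) (ψ : F →L[ℝ] ℝ),
      ∃ B : ℝ → Ω → ℝ, (∀ t ∈ Icc 0 T, StronglyMeasurable[ℱ t] (B t) ∧
          MemLp (B t) (ENNReal.ofReal (q / 2)) μ ∧
          ∀ ξ, (∀ u v, ξ u v = scalarGerm 𝒳 (fun t ω => φ (Y t ω))
              (fun i t ω => φ (Y' t ω (EuclideanSpace.single i 1)))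
              (fun t ω => ψ (Z t ω)) (fun i t ω => ψ (Z' t ω (EuclideanSpace.single i 1))) u v) →
            (∀ P : Partition 0 t, AEStronglyMeasurable (P.sum ξ) μ) ∧
            Tendsto (fun P : Partition 0 t =>
              eLpNorm (P.sum ξ - B t) (ENNReal.ofReal (q / 2)) μ) (meshFilter 0 t) (𝓝 0)) ∧
        ∃ K : ℝ≥0∞, K < ∞ ∧ ∀ s t, 0 ≤ s → s ≤ t → t ≤ T →
          eLpNorm (B t - B s) (ENNReal.ofReal (q / 2)) μ ≤ K * w s t ^ (2 * (1 / p)) := by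
  have hp0 : 0 < p := by linarith
  have he : 0 ≤ 1 / p := by positivity
  have hX : ∀ s ∈ Ico 0 T, Tendsto 𝒳.X (𝓝[>] s) (𝓝 (𝒳.X s)) := 𝒳.memV.1.1
  obtain ⟨w₁, hw₁, h₁, h₁'⟩ := 𝒳.exists_rightControl hp0
  obtain ⟨w₂, hw₂, h₂⟩ := hY.exists_rightControl hp0 (by linarith) hr hX
  obtain ⟨w₃, hw₃, h₃⟩ := hZ.exists_rightControl hp0 (by linarith) hr hX
  set w : ℝ → ℝ → ℝ≥0∞ := fun s t => w₁ s t + w₂ s t + w₃ s t with hw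
  have hww : IsRightControl w T := (hw₁.add hw₂).add hw₃
  have i₁ : ∀ s t, w₁ s t ≤ w s t := fun s t => le_self_add.trans le_self_add
  have i₂ : ∀ s t, w₂ s t ≤ w s t := fun s t => le_add_self.trans le_self_add
  have i₃ : ∀ s t, w₃ s t ≤ w s t := fun s t => le_add_self
  have mono : ∀ {x y : ℝ≥0∞} {a : ℝ}, 0 ≤ a → x ≤ y → x ^ a ≤ y ^ a := fun ha hxy =>
    ENNReal.rpow_le_rpow hxy ha
  have he2 : 0 ≤ 2 * (1 / p) := by positivity
  refine ⟨w, hww, fun φ ψ => ?_⟩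
  set S := ⨆ s ∈ Icc 0 T, eLpNorm (Y' s) (ENNReal.ofReal q * r) μ with hS
  set S' := ⨆ s ∈ Icc 0 T, eLpNorm (Z' s) (ENNReal.ofReal q * r) μ with hS'
  have hSlt : S < ∞ := hY.sup_lt_top
  have hSlt' : S' < ∞ := hZ.sup_lt_top
  set C : ℝ≥0∞ := 1 + (‖φ‖ₑ + ‖φ‖ₑ * S) + (‖ψ‖ₑ + ‖ψ‖ₑ * S') with hC
  have hCtop : C < ∞ := by
    simp [hC, ENNReal.mul_lt_top_iff, hSlt, hSlt']
  have hCφ : ‖φ‖ₑ + ‖φ‖ₑ * S ≤ C := le_add_self.trans le_self_add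
  have hCψ : ‖ψ‖ₑ + ‖ψ‖ₑ * S' ≤ C := le_add_self
  have hC1 : 1 ≤ C := le_self_add.trans le_self_add
  have c𝒳 : IsRoughControl 𝒳 (1 / p) w C := by
    refine ⟨fun i s t h0 hst hT => ?_, fun ij s t h0 hst hT => ?_⟩
    · have := (enorm_apply_le_enorm (𝒳.X t - 𝒳.X s) i).trans
        ((h₁ s t h0 hst hT).trans (mono he (i₁ s t)))
      exact this.trans (by simpa using mul_le_mul' hC1 le_rfl)
    · have := (enorm_apply_le_enorm (𝒳.XX s t) ij).trans
        ((h₁' s t h0 hst hT).trans (mono he2 (i₁ s t)))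
      exact this.trans (by simpa using mul_le_mul' hC1 le_rfl)
  have cY := hY.isScalarControlled hp0 (by linarith) hr (w := w) (fun s t h0 hst hT =>
    ⟨(h₂ s t h0 hst hT).1.trans (mono he (i₂ s t)),
      (h₂ s t h0 hst hT).2.1.trans (mono he (i₂ s t)),
      (h₂ s t h0 hst hT).2.2.trans (mono he2 (i₂ s t))⟩) φ (C := C)
    (le_self_add.trans hCφ) (le_add_self.trans hCφ)
  have cZ := hZ.isScalarControlled hp0 (by linarith) hr (w := w) (fun s t h0 hst hT =>
    ⟨(h₃ s t h0 hst hT).1.trans (mono he (i₃ s t)),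
      (h₃ s t h0 hst hT).2.1.trans (mono he (i₃ s t)),
      (h₃ s t h0 hst hT).2.2.trans (mono he2 (i₃ s t))⟩) ψ (C := C)
    (le_self_add.trans hCψ) (le_add_self.trans hCψ)
  obtain ⟨B, hB, hK⟩ := exists_scalar_bracket hq (one_div_lt_one_div_of_lt hp0 hp3)
    (one_div_le_one_div_of_le two_pos hp) hCtop hww c𝒳 cY cZ
  refine ⟨B, fun t ht => ⟨(hB t ht).1, (hB t ht).2.1, fun ξ hξ => ?_⟩, hK⟩
  obtain rfl : ξ = _ := funext fun u => funext fun v => hξ u v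
  exact ⟨fun P => ((isGerm_scalarGerm hq cY cZ).memLp_sum le_rfl ht.2 P).1, (hB t ht).2.2⟩

/-- The bracket process of two controlled paths: coordinatewise, the limit of the sewing lemma. Its
values at times outside `[0, T]` are set to zero, so that it is measurable at all times. -/
theorem exists_isBracket [FiniteDimensional ℝ E] [FiniteDimensional ℝ F] (hT : 0 < T) (hp : 2 ≤ p)
    (hp3 : p < 3) (hq : 4 ≤ q) (hr : 1 ≤ r)
    (τ : E ⊗[ℝ] F ≃ₗ[ℝ] G)
    (hY : IsControlled μ ℱ T p q r 𝒳.X Y Y') (hZ : IsControlled μ ℱ T p q r 𝒳.X Z Z') :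
    ∃ B : ℝ → Ω → G, IsBracket μ ℱ q 𝒳 τ Y Y' Z Z' B := by
  classical
  have hp0 : 0 < p := by linarith
  have hq2 : 1 ≤ ENNReal.ofReal (q / 2) := by simp; linarith
  obtain ⟨k, l, φ, ψ, g, hτ⟩ := exists_tensor_coordinates τ
  obtain ⟨w, hw, H⟩ := exists_coordinate_brackets hp hp3 hq hr hY hZ
  choose b hb K hK hbK using fun ab : Fin k × Fin l => H (φ ab.1) (ψ ab.2)
  let B : ℝ → Ω → G := fun t => if t ∈ Icc 0 T then fun ω => ∑ ab, b ab t ω • g ab else 0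
  have hBt : ∀ t ∈ Icc 0 T, B t = fun ω => ∑ ab, b ab t ω • g ab := fun t ht => if_pos ht
  have hBm : ∀ t ∈ Icc 0 T, StronglyMeasurable[ℱ t] (B t) := fun t ht => by
    rw [hBt t ht]
    exact Finset.stronglyMeasurable_fun_sum _ fun ab _ => ((hb ab t ht).1).smul_const (g ab)
  have hBm' : ∀ t, StronglyMeasurable (B t) := fun t => by
    by_cases ht : t ∈ Icc 0 T
    · exact (hBm t ht).mono (ℱ.le t)
    · simp only [B, if_neg ht]
      exact stronglyMeasurable_zero
  have hKtop : ∑ ab, ‖g ab‖ₑ * K ab < ∞ :=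
    ENNReal.sum_lt_top.2 fun ab _ => ENNReal.mul_lt_top enorm_lt_top (hK ab)
  have hincr : ∀ s t, 0 ≤ s → s ≤ t → t ≤ T →
      eLpNorm (B t - B s) (ENNReal.ofReal (q / 2)) μ ≤
        (∑ ab, ‖g ab‖ₑ * K ab) * w s t ^ (2 * (1 / p)) := fun s t h0 h1 h2 => by
    have hs : s ∈ Icc 0 T := ⟨h0, h1.trans h2⟩
    have ht : t ∈ Icc 0 T := ⟨h0.trans h1, h2⟩
    have heq : B t - B s = fun ω => ∑ ab, (b ab t - b ab s) ω • g ab := by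
      rw [hBt t ht, hBt s hs]
      ext ω
      simp [sub_smul]
    rw [heq, Finset.sum_mul]
    refine (eLpNorm_sum_smul_const_le hq2
      (fun ab => ((hb ab t ht).2.1.sub (hb ab s hs).2.1).1) g).trans
      (Finset.sum_le_sum fun ab _ => ?_)
    rw [mul_assoc]
    gcongr
    exact hbK ab s t h0 h1 h2
  have h0T : (0 : ℝ) ∈ Icc 0 T := ⟨le_rfl, hT.le⟩
  refine ⟨B, hBm, ⟨fun t _ => hBm' t, fun s hs => ?_, ?_, ?_⟩, fun t ht => ?_⟩
  · refine tendstoInMeasure_of_tendsto_eLpNorm (p := ENNReal.ofReal (q / 2))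
      (zero_lt_one.trans_le hq2).ne' (fun t => (hBm' t).aestronglyMeasurable)
      (hBm' s).aestronglyMeasurable ?_
    have h1 := (ENNReal.continuous_rpow_const (y := 2 * (1 / p))).tendsto 0 |>.comp (hw.right s hs)
    rw [ENNReal.zero_rpow_of_pos (by positivity)] at h1
    have h2 := ENNReal.Tendsto.const_mul (a := ∑ ab, ‖g ab‖ₑ * K ab) h1 (Or.inr hKtop.ne)
    rw [mul_zero] at h2
    refine tendsto_of_tendsto_of_tendsto_of_le_of_le' tendsto_const_nhds h2
      (Eventually.of_forall fun _ => zero_le) ?_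
    filter_upwards [Ioo_mem_nhdsGT hs.2] with t ht
    exact hincr s t hs.1 ht.1.le ht.2.le
  · rw [hBt 0 h0T]
    exact memLp_finsetSum _ fun ab _ => by
      refine ⟨(hb ab 0 h0T).2.1.1.smul_const (g ab), ?_⟩
      have := eLpNorm_sum_smul_const_le (ι := Unit) hq2 (fun _ => (hb ab 0 h0T).2.1.1)
        (fun _ => g ab)
      simp only [Finset.univ_unique, Finset.sum_singleton] at this
      exact this.trans_lt (ENNReal.mul_lt_top enorm_lt_top (hb ab 0 h0T).2.1.2)
  · exact hw.pVarOf_lt_top hp0 hKtop hincr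
  · let ξ : Fin k × Fin l → ℝ → ℝ → Ω → ℝ := fun ab => scalarGerm 𝒳 (fun t ω => φ ab.1 (Y t ω))
        (fun i t ω => φ ab.1 (Y' t ω (EuclideanSpace.single i 1)))
        (fun t ω => ψ ab.2 (Z t ω))
        (fun i t ω => ψ ab.2 (Z' t ω (EuclideanSpace.single i 1)))
    have hξ := fun ab => (hb ab t ht).2.2 (ξ ab) fun _ _ => rfl
    have heq : ∀ P : Partition 0 t, P.sum (bracketGerm 𝒳 τ Y Y' Z Z') - B t =
        fun ω => ∑ ab, (P.sum (ξ ab) - b ab t) ω • g ab := fun P => by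
      rw [hBt t ht]
      ext ω
      simp only [Partition.sum, Pi.sub_apply, Finset.sum_apply, sub_smul,
        Finset.sum_sub_distrib, bracketGerm_eq_sum 𝒳 τ hτ, Finset.sum_smul]
      rw [Finset.sum_comm]
    have hlim : Tendsto (fun P : Partition 0 t => ∑ ab, ‖g ab‖ₑ *
        eLpNorm (P.sum (ξ ab) - b ab t) (ENNReal.ofReal (q / 2)) μ) (meshFilter 0 t) (𝓝 0) := by
      have : Tendsto (fun P : Partition 0 t => ∑ ab, ‖g ab‖ₑ *
          eLpNorm (P.sum (ξ ab) - b ab t) (ENNReal.ofReal (q / 2)) μ) (meshFilter 0 t)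
          (𝓝 (∑ ab : Fin k × Fin l, ‖g ab‖ₑ * 0)) :=
        tendsto_finsetSum _ fun ab _ =>
          ENNReal.Tendsto.const_mul (hξ ab).2 (Or.inr enorm_ne_top)
      simpa using this
    refine tendsto_of_tendsto_of_tendsto_of_le_of_le tendsto_const_nhds hlim
      (fun _ => zero_le) fun P => ?_
    simp only [heq P]
    exact eLpNorm_sum_smul_const_le hq2 (fun ab => ((hξ ab).1 P).sub (hb ab t ht).2.1.1) g

end Existence

/-! ### Deterministic processes -/

section Deterministic

variable {Ω : Type*} {mΩ : MeasurableSpace Ω} {μ : Measure Ω} [IsProbabilityMeasure μ]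
  {ℱ : Filtration ℝ mΩ} {E : Type*} [NormedAddCommGroup E] {T p q : ℝ} {r : ℝ≥0∞}

lemma condNorm_const (hq : 0 < q) (hr : 1 ≤ r) (s : ℝ) (c : E) :
    condNorm μ ℱ q r s (fun _ => c) = ‖c‖ₑ := by
  rw [condNorm, condLExp_const (ℱ.le s)]
  rw [eLpNorm_const _ (zero_lt_one.trans_le hr).ne' (IsProbabilityMeasure.ne_zero μ)]
  simp [← ENNReal.rpow_mul, hq.ne']

/-- A deterministic right-continuous path of finite `p`-variation is a process in `V^p L^{q,r}`. -/
lemma memVLr_of_deterministic (hq : 0 < q) (hr : 1 ≤ r) {f : ℝ → E}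
    (hf : ∀ s ∈ Ico 0 T, Tendsto f (𝓝[>] s) (𝓝 (f s)))
    (hv : pVar (fun u v => f v - f u) p 0 T < ∞) :
    MemVLr μ ℱ T p q r (fun t _ => f t) := by
  refine ⟨fun t _ => stronglyMeasurable_const, fun s hs => ?_, memLp_const _, ?_⟩
  · refine tendstoInMeasure_of_tendsto_eLpNorm (p := 1) one_ne_zero
      (fun t => aestronglyMeasurable_const) aestronglyMeasurable_const ?_
    have h : ∀ t, eLpNorm ((fun _ : Ω => f t) - fun _ => f s) 1 μ = edist (f t) (f s) := fun t => by
      have : ((fun _ : Ω => f t) - fun _ => f s) = fun _ => f t - f s := rfl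
      rw [this, eLpNorm_const _ one_ne_zero (IsProbabilityMeasure.ne_zero μ)]
      simp [edist_eq_enorm_sub]
    simp only [h]
    exact tendsto_iff_edist_tendsto_0.1 (hf s hs)
  · have : (fun u v => condNorm μ ℱ q r u ((fun _ : Ω => f v) - fun _ => f u)) =
        fun u v => ‖f v - f u‖ₑ := by
      ext u v
      exact condNorm_const hq hr u (f v - f u)
    rw [pqrVar, this]
    exact hv

lemma memVLr_const (hp : 0 < p) (hq : 0 < q) (hr : 1 ≤ r) (c : E) :
    MemVLr μ ℱ T p q r (fun _ _ => c) :=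
  memVLr_of_deterministic (f := fun _ => c) hq hr (fun _ _ => tendsto_const_nhds) (by
    rw [pVar, pVarOf_eq_zero hp (by simp)]
    exact ENNReal.zero_lt_top)

end Deterministic

/-! ### Martingales -/

section Martingales

variable {Ω : Type*} {mΩ : MeasurableSpace Ω} {μ : Measure Ω}
  {ℱ : Filtration ℝ mΩ} {E F G : Type*} [NormedAddCommGroup E] [NormedSpace ℝ E]
  [NormedAddCommGroup F] [NormedSpace ℝ F] [NormedAddCommGroup G] [NormedSpace ℝ G]
  {T p q : ℝ} {r : ℝ≥0∞} {d : ℕ}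

/-- The remainder of `(M, 0)` is the increment of `M`, whose conditional expectation vanishes. -/
lemma IsMartingaleOn.isControlled [IsProbabilityMeasure μ] [CompleteSpace E] (hp : 0 < p)
    (hq : 0 < q) (hr : 1 ≤ r) (X : ℝ → EuclideanSpace ℝ (Fin d)) {M : ℝ → Ω → E}
    (hM : IsMartingaleOn μ ℱ T M) (hM' : MemVLr μ ℱ T p q r M) : IsControlled μ ℱ T p q r X M (fun _ _ => 0) := by
  refine ⟨hM.adapted, fun _ _ => stronglyMeasurable_const, hM', memVLr_const hp hq hr 0, ?_, ?_⟩
  · exact (iSup₂_le fun s _ => le_rfl).trans_lt (memLp_const (μ := μ)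
      (0 : EuclideanSpace ℝ (Fin d) →L[ℝ] E)).2
  · rw [pqVar, pVarOf_eq_zero (half_pos hp)]
    · exact ENNReal.zero_lt_top
    intro u v h0 h1 h2
    have hu : u ∈ Icc 0 T := ⟨h0, h1.trans h2⟩
    have hv : v ∈ Icc 0 T := ⟨h0.trans h1, h2⟩
    have hrem : remainder X M (fun _ _ => 0) u v = M v - M u := by
      ext ω
      simp [remainder]
    rw [hrem, eLpNorm_congr_ae (g := 0), eLpNorm_zero]
    filter_upwards [condExp_sub (hM.integrable v hv) (hM.integrable u hu) (ℱ u),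
      hM.condExp_eq u v h0 h1 h2] with ω e1 e2
    rw [e1, Pi.sub_apply, e2, condExp_of_stronglyMeasurable (ℱ.le u) (hM.adapted u hu)
      (hM.integrable u hu), sub_self, Pi.zero_apply]

lemma IsBracket.isQuadCovariation [FiniteDimensional ℝ E] [FiniteDimensional ℝ F] (hq : 0 < q)
    {𝒳 : RoughPath p T d} {τ : E ⊗[ℝ] F ≃ₗ[ℝ] G} {M : ℝ → Ω → E} {N : ℝ → Ω → F}
    (hM : IsAdaptedOn ℱ T M) (hN : IsAdaptedOn ℱ T N) {B : ℝ → Ω → G}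
    (hB : IsBracket μ ℱ q 𝒳 τ M (fun _ _ => 0) N (fun _ _ => 0) B) :
    IsQuadCovariation μ T τ M N B := by
  intro t ht
  have hgerm : bracketGerm 𝒳 τ M (fun _ _ => 0) N (fun _ _ => 0) =
      fun u v ω => τ ((M v ω - M u ω) ⊗ₜ[ℝ] (N v ω - N u ω)) := by
    ext u v ω
    simp [bracketGerm]
  have hlim := hB.tendsto t ht
  rw [hgerm] at hlim
  obtain ⟨k, l, φ, ψ, g, hτ⟩ := exists_tensor_coordinates τ
  have hm : ∀ u ∈ Icc 0 T, ∀ v ∈ Icc 0 T, AEStronglyMeasurable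
      (fun ω => τ ((M v ω - M u ω) ⊗ₜ[ℝ] (N v ω - N u ω))) μ := fun u hu v hv => by
    have hMM : StronglyMeasurable fun ω => M v ω - M u ω :=
      ((hM v hv).mono (ℱ.le v)).sub ((hM u hu).mono (ℱ.le u))
    have hNN : StronglyMeasurable fun ω => N v ω - N u ω :=
      ((hN v hv).mono (ℱ.le v)).sub ((hN u hu).mono (ℱ.le u))
    simp only [hτ]
    exact (Finset.stronglyMeasurable_fun_sum _ fun ab _ =>
      (((φ ab.1).continuous.comp_stronglyMeasurable hMM).mul
        ((ψ ab.2).continuous.comp_stronglyMeasurable hNN)).smul_const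
          (g ab)).aestronglyMeasurable
  refine tendstoInMeasure_of_tendsto_eLpNorm (p := ENNReal.ofReal (q / 2))
    (by simpa using hq) (fun P => ?_) (hB.memVL.meas t ht).aestronglyMeasurable hlim
  refine Finset.aestronglyMeasurable_sum _ fun i hi => ?_
  have hi := Finset.mem_range.1 hi
  exact hm _ ⟨P.le_pts hi.le, (P.pts_le hi.le).trans ht.2⟩ _
    ⟨P.le_pts hi, (P.pts_le hi).trans ht.2⟩

end Martingales

/-! ### The bracket of the rough path -/

section RoughBracket

variable {T p : ℝ} {d : ℕ} {H : Type*} [NormedAddCommGroup H] [NormedSpace ℝ H]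

/-- The matrix `δX ⊗ δX - 2 Sym(𝕏)`. -/
def RoughPath.bracketMatrix (𝒳 : RoughPath p T d) (s t : ℝ) : Fin d × Fin d → ℝ := fun ij =>
  (𝒳.X t ij.1 - 𝒳.X s ij.1) * (𝒳.X t ij.2 - 𝒳.X s ij.2) - (𝒳.XX s t ij + 𝒳.XX s t ij.swap)

/-- By Chen's relation, the cross terms of `δX ⊗ δX` cancel against those of `2 Sym(𝕏)`, which
makes `δX ⊗ δX - 2 Sym(𝕏)` additive. -/
lemma RoughPath.bracketMatrix_add (𝒳 : RoughPath p T d) {s u t : ℝ} (h0 : 0 ≤ s) (hsu : s ≤ u)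
    (hut : u ≤ t) (htT : t ≤ T) :
    𝒳.bracketMatrix s t = 𝒳.bracketMatrix s u + 𝒳.bracketMatrix u t := by
  ext ⟨i, j⟩
  simp only [bracketMatrix, Pi.add_apply, Prod.swap_prod_mk]
  rw [𝒳.chen s u t h0 hsu hut htT i j, 𝒳.chen s u t h0 hsu hut htT j i]
  ring

/-- The linear map `ℝ^{d × d} → H` given by `σ`, in coordinates. -/
def ofMatrix (σ : EuclideanSpace ℝ (Fin d) ⊗[ℝ] EuclideanSpace ℝ (Fin d) ≃ₗ[ℝ] H)
    (A : Fin d × Fin d → ℝ) : H :=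
  ∑ ij : Fin d × Fin d, A ij •
    σ (EuclideanSpace.single ij.1 (1 : ℝ) ⊗ₜ[ℝ] EuclideanSpace.single ij.2 (1 : ℝ))

lemma ofMatrix_bracketMatrix (𝒳 : RoughPath p T d)
    (σ : EuclideanSpace ℝ (Fin d) ⊗[ℝ] EuclideanSpace ℝ (Fin d) ≃ₗ[ℝ] H) (s t : ℝ) :
    ofMatrix σ (𝒳.bracketMatrix s t) = σ ((𝒳.X t - 𝒳.X s) ⊗ₜ[ℝ] (𝒳.X t - 𝒳.X s)
      - (2 : ℝ) • toTensor (symPart (𝒳.XX s t))) := by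
  have hx : ∀ x : EuclideanSpace ℝ (Fin d), x ⊗ₜ[ℝ] x =
      ∑ i, ∑ j, (x i * x j) •
        (EuclideanSpace.single i (1 : ℝ) ⊗ₜ[ℝ] EuclideanSpace.single j (1 : ℝ)) := fun x => by
    have hsum : x = ∑ i, x i • EuclideanSpace.single i (1 : ℝ) := by
      ext k
      simp [Finset.sum_apply, Pi.single_apply]
    conv_lhs => rw [hsum]
    simp only [TensorProduct.sum_tmul, TensorProduct.tmul_sum, TensorProduct.smul_tmul_smul]
    exact Finset.sum_comm
  rw [hx, toTensor, ofMatrix, Fintype.sum_prod_type]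
  simp only [Finset.smul_sum, smul_smul, ← Finset.sum_sub_distrib, ← sub_smul, map_sum, map_smul]
  refine Finset.sum_congr rfl fun i _ => Finset.sum_congr rfl fun j _ => ?_
  congr 1
  simp only [RoughPath.bracketMatrix, symPart, Prod.swap_prod_mk, PiLp.sub_apply]
  ring

theorem exists_isRoughBracket (hp : 0 < p) (hT : 0 < T) (𝒳 : RoughPath p T d)
    (σ : EuclideanSpace ℝ (Fin d) ⊗[ℝ] EuclideanSpace ℝ (Fin d) ≃ₗ[ℝ] H) :
    ∃ b : ℝ → H, IsRoughBracket 𝒳 σ b := by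
  let b : ℝ → H := fun t => ofMatrix σ (𝒳.bracketMatrix 0 t)
  have hincr : ∀ s t, 0 ≤ s → s ≤ t → t ≤ T → b t - b s = ofMatrix σ (𝒳.bracketMatrix s t) :=
    fun s t h0 hst htT => by
      simp only [b, ofMatrix, 𝒳.bracketMatrix_add le_rfl h0 hst htT, Pi.add_apply, add_smul,
        Finset.sum_add_distrib, add_sub_cancel_left]
  obtain ⟨w, hw, hX, hXX⟩ := 𝒳.exists_rightControl hp
  have h0T : (0 : ℝ) ∈ Icc 0 T := ⟨le_rfl, hT.le⟩
  -- a limit of the pair `(X, 𝕏_{0,·})` gives a limit of the bracket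
  have hlim : ∀ {l : Filter ℝ} {x : EuclideanSpace ℝ (Fin d)}
      {A : EuclideanSpace ℝ (Fin d × Fin d)}, Tendsto 𝒳.X l (𝓝 x) →
      Tendsto (fun t => 𝒳.XX 0 t) l (𝓝 A) → Tendsto b l (𝓝 (ofMatrix σ fun ij =>
        (x ij.1 - 𝒳.X 0 ij.1) * (x ij.2 - 𝒳.X 0 ij.2) - (A ij + A ij.swap))) := by
    intro l x A hx hA
    have hx' : ∀ i, Tendsto (β := ℝ) (fun t => 𝒳.X t i) l (𝓝 (x i)) := fun i =>
      ((EuclideanSpace.proj (𝕜 := ℝ) i).continuous.tendsto x).comp hx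
    have hA' : ∀ i, Tendsto (β := ℝ) (fun t => 𝒳.XX 0 t i) l (𝓝 (A i)) := fun i =>
      ((EuclideanSpace.proj (𝕜 := ℝ) i).continuous.tendsto A).comp hA
    exact tendsto_finsetSum _ fun ij _ =>
      ((((hx' _).sub_const _).mul ((hx' _).sub_const _)).sub
        ((hA' _).add (hA' _))).smul_const _
  refine ⟨b, ?_, fun s t h0 hst htT => ?_, ⟨fun t ht => ?_, fun t ht => ?_⟩, ?_⟩
  · simp [b, ofMatrix, RoughPath.bracketMatrix, 𝒳.XX_self le_rfl hT.le]
  · rw [hincr s t h0 hst htT, ofMatrix_bracketMatrix]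
  · exact hlim (𝒳.memV.1.1 t ht) ((𝒳.cadlag_right 0 h0T).1 t ht)
  · obtain ⟨x, hx⟩ := 𝒳.memV.1.2 t ht
    obtain ⟨A, hA⟩ := (𝒳.cadlag_right 0 h0T).2 t ht
    exact ⟨_, hlim hx hA⟩
  · refine hw.pVarOf_lt_top (K := ∑ ij : Fin d × Fin d, 3 * ‖σ (EuclideanSpace.single ij.1 (1 : ℝ)
      ⊗ₜ[ℝ] EuclideanSpace.single ij.2 (1 : ℝ))‖ₑ) hp
      (ENNReal.sum_lt_top.2 fun ij _ => ENNReal.mul_lt_top (by simp) enorm_lt_top)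
      fun u v h0 huv hvT => ?_
    simp only [hincr u v h0 huv hvT, ofMatrix]
    refine (enorm_sum_le _ _).trans ?_
    rw [Finset.sum_mul]
    refine Finset.sum_le_sum fun ij _ => ?_
    rw [enorm_smul, mul_right_comm]
    refine mul_le_mul' ?_ le_rfl
    have e1 : ∀ i, ‖𝒳.X v i - 𝒳.X u i‖ₑ ≤ w u v ^ (1 / p) := fun i =>
      (enorm_apply_le_enorm (𝒳.X v - 𝒳.X u) i).trans (hX u v h0 huv hvT)
    have e2 : ∀ i, ‖𝒳.XX u v i‖ₑ ≤ w u v ^ (2 * (1 / p)) := fun i =>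
      (enorm_apply_le_enorm (𝒳.XX u v) i).trans (hXX u v h0 huv hvT)
    calc ‖𝒳.bracketMatrix u v ij‖ₑ
        ≤ ‖(𝒳.X v ij.1 - 𝒳.X u ij.1) * (𝒳.X v ij.2 - 𝒳.X u ij.2)‖ₑ +
          ‖𝒳.XX u v ij + 𝒳.XX u v ij.swap‖ₑ := enorm_sub_le
      _ ≤ w u v ^ (1 / p) * w u v ^ (1 / p) +
          (w u v ^ (2 * (1 / p)) + w u v ^ (2 * (1 / p))) := by
          rw [enorm_mul]
          exact add_le_add (mul_le_mul' (e1 _) (e1 _))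
            ((enorm_add_le _ _).trans (add_le_add (e2 _) (e2 _)))
      _ = 3 * w u v ^ (2 * (1 / p)) := by
          rw [← ENNReal.rpow_add_of_nonneg _ _ (by positivity) (by positivity), ← two_mul]
          ring

variable {Ω : Type*} {mΩ : MeasurableSpace Ω} {μ : Measure Ω}
  {ℱ : Filtration ℝ mΩ} {q : ℝ} {r : ℝ≥0∞}

lemma RoughPath.isControlled [IsProbabilityMeasure μ] (hp : 0 < p) (hq : 0 < q) (hr : 1 ≤ r)
    (𝒳 : RoughPath p T d) :
    IsControlled μ ℱ T p q r 𝒳.X (fun t _ => 𝒳.X t)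
      (fun _ _ => ContinuousLinearMap.id ℝ (EuclideanSpace ℝ (Fin d))) := by
  refine ⟨fun _ _ => stronglyMeasurable_const, fun _ _ => stronglyMeasurable_const,
    memVLr_of_deterministic hq hr 𝒳.memV.1.1 𝒳.memV.2, memVLr_const hp hq hr _, ?_, ?_⟩
  · exact (iSup₂_le fun s _ => le_rfl).trans_lt (memLp_const (μ := μ)
      (ContinuousLinearMap.id ℝ (EuclideanSpace ℝ (Fin d)))).2
  · rw [pqVar, pVarOf_eq_zero (half_pos hp)]
    · exact ENNReal.zero_lt_top
    intro u v _ _ _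
    have hrem : remainder 𝒳.X (fun t (_ : Ω) => 𝒳.X t)
        (fun _ _ => ContinuousLinearMap.id ℝ (EuclideanSpace ℝ (Fin d))) u v = 0 := by
      ext ω
      simp [remainder]
    rw [hrem, condExp_zero, eLpNorm_zero]

/-- For the pair `(X, 1)` the sums defining the bracket process telescope. -/
lemma IsBracket.ae_eq_of_isRoughBracket (hq : 0 < q) {𝒳 : RoughPath p T d}
    {σ : EuclideanSpace ℝ (Fin d) ⊗[ℝ] EuclideanSpace ℝ (Fin d) ≃ₗ[ℝ] H} {b : ℝ → H}
    (hb : IsRoughBracket 𝒳 σ b) {B : ℝ → Ω → H}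
    (hB : IsBracket μ ℱ q 𝒳 σ
      (fun t _ => 𝒳.X t) (fun _ _ => ContinuousLinearMap.id ℝ _)
      (fun t _ => 𝒳.X t) (fun _ _ => ContinuousLinearMap.id ℝ _) B) {t : ℝ} (ht : t ∈ Icc 0 T) :
    B t =ᵐ[μ] fun _ => b t := by
  have hsum : ∀ P : Partition 0 t, P.sum (bracketGerm (Ω := Ω) 𝒳 σ
      (fun t _ => 𝒳.X t) (fun _ _ => ContinuousLinearMap.id ℝ _)
      (fun t _ => 𝒳.X t) (fun _ _ => ContinuousLinearMap.id ℝ _)) = fun _ => b t := fun P => by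
    have h := P.sum_sub_eq fun t (_ : Ω) => b t
    have h0 : ((fun _ => b t) - fun _ => b 0 : Ω → H) = fun _ => b t := by
      ext ω
      simp [hb.zero]
    rw [← h0, ← h]
    refine Finset.sum_congr rfl fun i hi => ?_
    have hi := Finset.mem_range.1 hi
    ext ω
    simp only [Pi.sub_apply]
    rw [hb.increment _ _ (P.le_pts hi.le) (P.pts_lt i hi).le ((P.pts_le hi).trans ht.2),
      bracketGerm, ContinuousLinearMap.coe_id, TensorProduct.map_id, LinearMap.id_apply]
  have hlim := hB.tendsto t ht
  simp only [hsum] at hlim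
  have := meshFilter_neBot ht.1
  have hzero := tendsto_nhds_unique tendsto_const_nhds hlim
  rw [eLpNorm_eq_zero_iff (aestronglyMeasurable_const.sub
    (hB.memVL.meas t ht).aestronglyMeasurable) (by simpa using hq)] at hzero
  filter_upwards [hzero] with ω hω
  exact (sub_eq_zero.1 hω).symm

end RoughBracket

end RoughStoch

end

/-- Existence of the bracket of two stochastic controlled paths; for martingales it is the
quadratic covariation, and for `(X, 1)` it is the bracket of the rough path. -/
theorem lemma5p1
    {Ω : Type*} [mΩ : MeasurableSpace Ω] (μ : Measure Ω) [IsProbabilityMeasure μ]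
    {E F G H : Type*}
    [NormedAddCommGroup E] [NormedSpace ℝ E] [FiniteDimensional ℝ E] [CompleteSpace E]
    [NormedAddCommGroup F] [NormedSpace ℝ F] [FiniteDimensional ℝ F] [CompleteSpace F]
    [NormedAddCommGroup G] [NormedSpace ℝ G]
    [NormedAddCommGroup H] [NormedSpace ℝ H]
    (T : ℝ) (hT : 0 < T) (ℱ : Filtration ℝ mΩ)
    (p q : ℝ) (r : ℝ≥0∞) (hp : 2 ≤ p) (hp3 : p < 3) (hq : 4 ≤ q) (hr : 1 ≤ r)
    (d : ℕ) (𝒳 : RoughPath p T d)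
    (τ : E ⊗[ℝ] F ≃ₗ[ℝ] G)
    (σ : EuclideanSpace ℝ (Fin d) ⊗[ℝ] EuclideanSpace ℝ (Fin d) ≃ₗ[ℝ] H) :
    -- existence of the bracket
    (∀ (Y : ℝ → Ω → E) (Y' : ℝ → Ω → EuclideanSpace ℝ (Fin d) →L[ℝ] E)
        (Z : ℝ → Ω → F) (Z' : ℝ → Ω → EuclideanSpace ℝ (Fin d) →L[ℝ] F),
        IsControlled μ ℱ T p q r 𝒳.X Y Y' → IsControlled μ ℱ T p q r 𝒳.X Z Z' →
        ∃ B : ℝ → Ω → G, IsBracket μ ℱ q 𝒳 τ Y Y' Z Z' B) ∧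
    -- martingales
    (∀ (M : ℝ → Ω → E) (N : ℝ → Ω → F),
        IsMartingaleOn μ ℱ T M → MemVLr μ ℱ T p q r M →
        IsMartingaleOn μ ℱ T N → MemVLr μ ℱ T p q r N →
        IsControlled μ ℱ T p q r 𝒳.X M (fun _ _ => 0) ∧
        IsControlled μ ℱ T p q r 𝒳.X N (fun _ _ => 0) ∧
        ∀ B : ℝ → Ω → G, IsBracket μ ℱ q 𝒳 τ M (fun _ _ => 0) N (fun _ _ => 0) B →
          IsQuadCovariation μ T τ M N B) ∧
    -- the rough path itself
    (IsControlled μ ℱ T p q r 𝒳.X (fun t _ => 𝒳.X t)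
        (fun _ _ => ContinuousLinearMap.id ℝ (EuclideanSpace ℝ (Fin d))) ∧
      ∃ b : ℝ → H, IsRoughBracket 𝒳 σ b ∧
        ∀ B : ℝ → Ω → H,
          IsBracket μ ℱ q 𝒳 σ
            (fun t _ => 𝒳.X t) (fun _ _ => ContinuousLinearMap.id ℝ _)
            (fun t _ => 𝒳.X t) (fun _ _ => ContinuousLinearMap.id ℝ _) B →
          ∀ t ∈ Icc 0 T, B t =ᵐ[μ] fun _ => b t) := by
  have hp0 : 0 < p := by linarith
  have hq0 : 0 < q := by linarith
  refine ⟨fun Y Y' Z Z' hY hZ => exists_isBracket hT hp hp3 hq hr τ hY hZ,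
    fun M N hM hM' hN hN' => ⟨hM.isControlled hp0 hq0 hr 𝒳.X hM',
      hN.isControlled hp0 hq0 hr 𝒳.X hN',
      fun B hB => hB.isQuadCovariation hq0 hM.adapted hN.adapted⟩,
    𝒳.isControlled hp0 hq0 hr, ?_⟩
  obtain ⟨b, hb⟩ := exists_isRoughBracket hp0 hT 𝒳 σ
  exact ⟨b, hb, fun B hB t ht => hB.ae_eq_of_isRoughBracket hq0 hb ht⟩
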